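/- \textbf{Setting.} Let $Q$ be a smooth (Hausdorff, finite-dimensional, boundaryless) manifold with $\tau_Q:TQ\to Q$, let $L:TQ\to\mathbb R$ be a smooth regular Lagrangian (its fibre Hessian is nonsingular everywhere) and let $\mathcal D\subseteq TQ$ be a smooth distribution of constant rank with annihilator $\mathcal D^{o}\subseteq T^*Q$. Let $S$ be the vertical endomorphism of $TQ$, $\omega_L=-d(S^*dL)$ the Poincaré–Cartan form, $E_L=\Delta L-L$ the energy ($\Delta$ the Liouville vector field), and $F^o=S^*((T\mathcal D)^o)$ along $\mathcal D$. Assume that $(Q,L,\mathcal D)$ is regular, i.e. for all $v\in\mathcal D$ one has $\dim (T_v\mathcal D)^o=\dim F^o_v$ and $T_v\mathcal D\cap\sharp(F_v^o)=\{0\}$, where $\sharp$ is the inverse of $X\mapsto i_X\omega_L$. Let $\Gamma_{nh}$ be the nonholonomic vector field on $\mathcal D$, i.e. the solution of $i_{\Gamma_{nh}}\omega_L-dE_L\in F^o$, $\Gamma_{nh}\in T\mathcal D$, and let $F_{nh}:\mathcal D\to T^*Q$ be the nonholonomic force, determined by $i_{\Gamma_{nh}}\omega_L=dE_L-\langle F_{nh},T\tau_Q(\cdot)\rangle$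 along $\mathcal D$. Let $\widetilde F:TQ\to T^*Q$ be any smooth fibre-preserving extension of $F_{nh}$, and let $\Gamma$ be the forced Lagrangian vector field on $TQ$, defined by $i_{\Gamma}\omega_L=dE_L-\langle\widetilde F,T\tau_Q(\cdot)\rangle$, with flow $\phi_t$. Let $h>0$ and let $W\subseteq TQ$ be an open set of vectors $v$ for which $\phi_t(v)$ is defined for all $t\in[0,h]$ and on which $\exp_h(v)=(\tau_Q(v),\tau_Q(\phi_h(v)))$ is a diffeomorphism onto an open subset of $Q\times Q$; let $R^{-}:\exp_h(W)\to W$ be its inverse. Define, for $(q_0,q_1)\in \exp_h(W)$, $$L_d(q_0,q_1)=\int_0^h L\big(\phi_t(R^{-}(q_0,q_1))\big)\,dt,$$ $$\langle F_d(q_0,q_1),(X_0,X_1)\rangle=\int_0^h\big\langle\widetilde F\big(\phi_t(R^{-}(q_0,q_1))\big),\,T_{(q_0,q_1)}(\tau_Q\circ\phi_t\circ R^{-})(X_0,X_1)\big\rangle\,dt,$$ $\langle F_d^{+},X_1\rangle=\langle F_d,(0,X_1)\rangle$ and $\langle F_d^{-},X_0\rangle=\langle F_d,(X_0,0)\rangle$.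 Let $\phi^{nh}_t$ be the flow of $\Gamma_{nh}$ on $\mathcal D$, let $\mathcal U_h$ be the set of those $v\in W\cap\mathcal D$ for which $\phi^{nh}_t(v)$ is defined for all $t\in[0,h]$, let $\exp_h^{nh}(v)=(\tau_Q(v),\tau_Q(\phi^{nh}_h(v)))$, and let $\mathcal M_h=\exp_h^{nh}(\mathcal U_h)$ be the exact discrete nonholonomic constraint space. Let $R^{-}_{nh}:\mathcal M_h\to\mathcal U_h$ be the inverse of $\exp_h^{nh}|_{\mathcal U_h}$ and $R^{+}_{nh}=\phi^{nh}_h\circ R^{-}_{nh}$. With $l=L|_{\mathcal D}$ and $\mathbb Fl:\mathcal D\to\mathcal D^*$, $\langle\mathbb Fl(u),w\rangle=\frac{d}{dt}\big|_{t=0}l(u+tw)$, put $\mathbb F^{\pm}_{h,nh}l=\mathbb Fl\circ R^{\pm}_{nh}:\mathcal M_h\to\mathcal D^*$. \textbf{Theorem.} For every $N$ and every sequence $(q_0,\dots,q_N)$ in $Q$ the following three statements are equivalent. (i) (Modified Lagrange–d'Alembert principle.) $(q_k,q_{k+1})\in\mathcal M_h$ for $0\le k\le N-1$, and for all variations $\delta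 q_k\in\mathcal D_{q_k}$ with fixed end points ($\delta q_0=\delta q_N=0$), where $S_d(q_0,\dots,q_N)=\sum_{k=0}^{N-1}L_d(q_k,q_{k+1})$, $$dS_d(q_0,\dots,q_N)\cdot\delta q+\sum_{k=1}^{N-1}\big[F_d^{+}(q_{k-1},q_k)+F_d^{-}(q_k,q_{k+1})\big]\cdot\delta q_k=0.$$ (ii) (Modified Lagrange–d'Alembert equations.) $(q_k,q_{k+1})\in\mathcal M_h$ for $0\le k\le N-1$, and for $1\le k\le N-1$ $$D_2L_d(q_{k-1},q_k)+D_1L_d(q_k,q_{k+1})+F_d^{+}(q_{k-1},q_k)+F_d^{-}(q_k,q_{k+1})\in\mathcal D^{o}_{q_k}.$$ (iii) (Exact discrete nonholonomic equations, momentum matching.) $(q_k,q_{k+1})\in\mathcal M_h$ for $0\le k\le N-1$, and for $1\le k\le N-1$ $$\mathbb F^{+}_{h,nh}l(q_{k-1},q_k)-\mathbb F^{-}_{h,nh}l(q_k,q_{k+1})=0\quad\text{in }\mathcal D^*_{q_k}.$$ -/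

import Mathlib

open scoped Manifold ContDiff Topology
open Set Bundle

noncomputable section

namespace NonholonomicMechanics

section Geometry

variable {E : Type*} [NormedAddCommGroup E] [NormedSpace ℝ E] [FiniteDimensional ℝ E]
  {Q : Type*} [TopologicalSpace Q] [ChartedSpace E Q] [IsManifold 𝓘(ℝ, E) ∞ Q]

/-! ### Tangent-bundle geometry -/

/-- The exterior derivative of a one-form `θ` on a (boundaryless) manifold `M`, at the point `x`:
pull `θ` back to the model space by the inverse of the preferred chart at `x`, and take
`(X, Y) ↦ D_X θ (Y) - D_Y θ (X)` there. -/
def extDerivOneForm {F H M : Type*} [NormedAddCommGroup F] [NormedSpace ℝ F] [TopologicalSpace H]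
    (J : ModelWithCorners ℝ F H) [TopologicalSpace M] [ChartedSpace H M]
    (θ : (x : M) → TangentSpace J x →L[ℝ] ℝ) (x : M) (X : TangentSpace J x) :
    TangentSpace J x →L[ℝ] ℝ :=
  let θ' : F → F →L[ℝ] ℝ := fun y =>
    (θ ((extChartAt J x).symm y)).comp (mfderiv 𝓘(ℝ, F) J (extChartAt J x).symm y)
  let dθ : F →L[ℝ] F →L[ℝ] ℝ := fderiv ℝ θ' (extChartAt J x x)
  (dθ X - dθ.flip X : F →L[ℝ] ℝ)

/-- The tangent map `T_v τ_Q` of the projection `τ_Q : TQ → Q`. -/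
def tangentProj (v : TangentBundle 𝓘(ℝ, E) Q) :
    TangentSpace 𝓘(ℝ, E).tangent v →L[ℝ] TangentSpace 𝓘(ℝ, E) v.proj :=
  mfderiv 𝓘(ℝ, E).tangent 𝓘(ℝ, E) (fun u : TangentBundle 𝓘(ℝ, E) Q => u.proj) v

/-- The vertical lift `w ↦ w^V_v = d/dt|_{t=0} (v + t w)`, that is, the differential at `v` of the
inclusion of the fibre `T_q Q` in `TQ`. -/
def verticalLift (v : TangentBundle 𝓘(ℝ, E) Q) :
    TangentSpace 𝓘(ℝ, E) v.proj →L[ℝ] TangentSpace 𝓘(ℝ, E).tangent v :=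
  mfderiv 𝓘(ℝ, E) 𝓘(ℝ, E).tangent
    (fun w : E => (⟨v.proj, w⟩ : TangentBundle 𝓘(ℝ, E) Q)) v.snd

/-- The vertical endomorphism `S`. -/
def verticalEndo (v : TangentBundle 𝓘(ℝ, E) Q) :
    TangentSpace 𝓘(ℝ, E).tangent v →L[ℝ] TangentSpace 𝓘(ℝ, E).tangent v :=
  (verticalLift v).comp (tangentProj v)

/-- The differential of a function on `TQ`. -/
def dFun (f : TangentBundle 𝓘(ℝ, E) Q → ℝ) (v : TangentBundle 𝓘(ℝ, E) Q) :
    TangentSpace 𝓘(ℝ, E).tangent v →L[ℝ] ℝ :=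
  mfderiv 𝓘(ℝ, E).tangent 𝓘(ℝ, ℝ) f v

/-! ### Lagrangian and forced Lagrangian mechanics -/

/-- The energy `E_L = Δ L - L`, where `Δ v = v^V_v` is the Liouville vector field. -/
def energy (L : TangentBundle 𝓘(ℝ, E) Q → ℝ) (v : TangentBundle 𝓘(ℝ, E) Q) : ℝ :=
  dFun L v (verticalLift v v.snd) - L v

/-- The Poincaré-Cartan two-form `ω_L = - d (S^* dL)`; `poincareCartan L v X` is `i_X ω_L`. -/
def poincareCartan (L : TangentBundle 𝓘(ℝ, E) Q → ℝ) (v : TangentBundle 𝓘(ℝ, E) Q)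
    (X : TangentSpace 𝓘(ℝ, E).tangent v) : TangentSpace 𝓘(ℝ, E).tangent v →L[ℝ] ℝ :=
  - extDerivOneForm 𝓘(ℝ, E).tangent (fun u => (dFun L u).comp (verticalEndo u)) v X

/-- `L` is regular: its fibre Hessian is nonsingular at every point of `TQ`. -/
def IsRegularLagrangian (L : TangentBundle 𝓘(ℝ, E) Q → ℝ) : Prop :=
  ∀ v : TangentBundle 𝓘(ℝ, E) Q, Function.Injective
    (fderiv ℝ (fderiv ℝ (fun w : E => L ⟨v.proj, w⟩)) (v.snd : E) : E → E →L[ℝ] ℝ)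

/-- Smoothness of an external force `F : TQ → T^*Q` (a fibre-preserving map). -/
def IsSmoothForce (F : (v : TangentBundle 𝓘(ℝ, E) Q) → TangentSpace 𝓘(ℝ, E) v.proj →L[ℝ] ℝ) :
    Prop :=
  ContMDiff 𝓘(ℝ, E).tangent (𝓘(ℝ, E).prod 𝓘(ℝ, E →L[ℝ] ℝ)) ∞
    (fun v : TangentBundle 𝓘(ℝ, E) Q =>
      TotalSpace.mk' (E →L[ℝ] ℝ) (E := fun q : Q => TangentSpace 𝓘(ℝ, E) q →L[ℝ] ℝ)
        v.proj (F v))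

open Classical in
/-- The forced Lagrangian vector field `Γ_{(L,F)}`: the solution of
`i_Γ ω_L = dE_L - μ_F`, where `μ_F(v) = F(v) ∘ T_v τ_Q`. -/
def forcedField (L : TangentBundle 𝓘(ℝ, E) Q → ℝ)
    (F : (v : TangentBundle 𝓘(ℝ, E) Q) → TangentSpace 𝓘(ℝ, E) v.proj →L[ℝ] ℝ)
    (v : TangentBundle 𝓘(ℝ, E) Q) : TangentSpace 𝓘(ℝ, E).tangent v :=
  if H : ∃ X : TangentSpace 𝓘(ℝ, E).tangent v,
      poincareCartan L v X = dFun (energy L) v - (F v).comp (tangentProj v)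
  then H.choose else 0

/-! ### Nonholonomic mechanics -/

/-- `D` is a smooth distribution of corank `k`: locally it is the common kernel of `k` smooth,
pointwise linearly independent one-forms. -/
def IsSmoothDistribution (k : ℕ) (D : (q : Q) → Submodule ℝ (TangentSpace 𝓘(ℝ, E) q)) : Prop :=
  ∀ q₀ : Q, ∃ U : Set Q, IsOpen U ∧ q₀ ∈ U ∧
    ∃ μ : Fin k → (q : Q) → TangentSpace 𝓘(ℝ, E) q →L[ℝ] ℝ,
      (∀ a, ContMDiffOn 𝓘(ℝ, E) (𝓘(ℝ, E).prod 𝓘(ℝ, E →L[ℝ] ℝ)) ∞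
        (fun q : Q => TotalSpace.mk' (E →L[ℝ] ℝ)
          (E := fun q : Q => TangentSpace 𝓘(ℝ, E) q →L[ℝ] ℝ) q (μ a q)) U) ∧
      ∀ q ∈ U, LinearIndependent ℝ (fun a => μ a q) ∧
        ∀ w : TangentSpace 𝓘(ℝ, E) q, w ∈ D q ↔ ∀ a, μ a q w = 0

/-- `D` as a subset of `TQ`. -/
def distSet (D : (q : Q) → Submodule ℝ (TangentSpace 𝓘(ℝ, E) q)) :
    Set (TangentBundle 𝓘(ℝ, E) Q) :=
  {v | v.snd ∈ D v.proj}

/-- `T_v D ⊆ T_v TQ`: the velocities at `v` of the smooth curves in `D` through `v`. -/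
def distTangent (D : (q : Q) → Submodule ℝ (TangentSpace 𝓘(ℝ, E) q))
    (v : TangentBundle 𝓘(ℝ, E) Q) : Submodule ℝ (TangentSpace 𝓘(ℝ, E).tangent v) :=
  Submodule.span ℝ {X | ∃ γ : ℝ → TangentBundle 𝓘(ℝ, E) Q, γ 0 = v ∧
    ContMDiffAt 𝓘(ℝ, ℝ) 𝓘(ℝ, E).tangent ∞ γ 0 ∧ (∀ᶠ s in 𝓝 (0 : ℝ), γ s ∈ distSet D) ∧
    (mfderiv 𝓘(ℝ, ℝ) 𝓘(ℝ, E).tangent γ 0 (1 : ℝ) : E × E) = X}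

/-- `F^o_v = S^* ((T_v D)^o)`. -/
def reactionForms (D : (q : Q) → Submodule ℝ (TangentSpace 𝓘(ℝ, E) q))
    (v : TangentBundle 𝓘(ℝ, E) Q) :
    Submodule ℝ (Module.Dual ℝ (TangentSpace 𝓘(ℝ, E).tangent v)) :=
  (distTangent D v).dualAnnihilator.map (verticalEndo v).toLinearMap.dualMap

/-- The nonholonomic system `(Q, L, D)` is regular. -/
structure IsRegularSystem (L : TangentBundle 𝓘(ℝ, E) Q → ℝ)
    (D : (q : Q) → Submodule ℝ (TangentSpace 𝓘(ℝ, E) q)) : Prop where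
  /-- `dim (T_v D)^o = dim F^o_v`. -/
  admissible : ∀ v ∈ distSet D,
    Module.finrank ℝ (distTangent D v).dualAnnihilator = Module.finrank ℝ (reactionForms D v)
  /-- `T_v D ∩ ♯(F^o_v) = 0`, where `♯` is the inverse of `X ↦ i_X ω_L`. -/
  compatible : ∀ v ∈ distSet D, ∀ X ∈ distTangent D v,
    (poincareCartan L v X).toLinearMap ∈ reactionForms D v → X = 0

open Classical in
/-- The nonholonomic vector field `Γ_nh` along `D`: the solution of
`i_Γ ω_L - dE_L ∈ F^o` and `Γ ∈ TD`. (Only its values on `D` are meaningful.) -/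
def nonholonomicField (L : TangentBundle 𝓘(ℝ, E) Q → ℝ)
    (D : (q : Q) → Submodule ℝ (TangentSpace 𝓘(ℝ, E) q))
    (v : TangentBundle 𝓘(ℝ, E) Q) : TangentSpace 𝓘(ℝ, E).tangent v :=
  if H : ∃ X : TangentSpace 𝓘(ℝ, E).tangent v, X ∈ distTangent D v ∧
      (poincareCartan L v X - dFun (energy L) v).toLinearMap ∈ reactionForms D v
  then H.choose else 0

open Classical in
/-- The nonholonomic force `F_nh : D → T^*Q`: the covector which makes the nonholonomic equations
forced Euler-Lagrange equations, that is, `i_{Γ_nh} ω_L = dE_L - F_nh ∘ T τ_Q` along `D`.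
(Only its values on `D` are meaningful.) -/
def nonholonomicForce (L : TangentBundle 𝓘(ℝ, E) Q → ℝ)
    (D : (q : Q) → Submodule ℝ (TangentSpace 𝓘(ℝ, E) q))
    (v : TangentBundle 𝓘(ℝ, E) Q) : TangentSpace 𝓘(ℝ, E) v.proj →L[ℝ] ℝ :=
  if H : ∃ β : TangentSpace 𝓘(ℝ, E) v.proj →L[ℝ] ℝ,
      poincareCartan L v (nonholonomicField L D v) =
        dFun (energy L) v - β.comp (tangentProj v)
  then H.choose else 0

/-! ### Flows, exponential maps and retractions -/

/-- `γ` is an integral curve of `Γ` in `C`, starting at `v`, on an open interval that contains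
`0` and `t`. -/
def IsTrajectory (Γ : (v : TangentBundle 𝓘(ℝ, E) Q) → TangentSpace 𝓘(ℝ, E).tangent v)
    (C : Set (TangentBundle 𝓘(ℝ, E) Q)) (t : ℝ) (v : TangentBundle 𝓘(ℝ, E) Q)
    (γ : ℝ → TangentBundle 𝓘(ℝ, E) Q) : Prop :=
  ∃ a b : ℝ, 0 ∈ Ioo a b ∧ t ∈ Ioo a b ∧ γ 0 = v ∧ (∀ s ∈ Ioo a b, γ s ∈ C) ∧
    IsMIntegralCurveOn γ Γ (Ioo a b)

open Classical in
/-- The flow `φ_t^Γ(v)` on `C` of a vector field along `C` (`v` itself, where it is undefined). -/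
def flow (Γ : (v : TangentBundle 𝓘(ℝ, E) Q) → TangentSpace 𝓘(ℝ, E).tangent v)
    (C : Set (TangentBundle 𝓘(ℝ, E) Q)) (t : ℝ) (v : TangentBundle 𝓘(ℝ, E) Q) :
    TangentBundle 𝓘(ℝ, E) Q :=
  if H : ∃ γ, IsTrajectory Γ C t v γ then H.choose t else v

/-- `M_h^Γ`: the vectors for which the flow is defined for all `t ∈ [0, h]`. -/
def flowDomain (Γ : (v : TangentBundle 𝓘(ℝ, E) Q) → TangentSpace 𝓘(ℝ, E).tangent v)
    (C : Set (TangentBundle 𝓘(ℝ, E) Q)) (h : ℝ) : Set (TangentBundle 𝓘(ℝ, E) Q) :=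
  {v | ∀ t ∈ Icc 0 h, ∃ γ, IsTrajectory Γ C t v γ}

/-- The exponential map `exp_h^Γ(v) = (τ_Q(v), τ_Q(φ_h^Γ(v)))`. -/
def expMap (Γ : (v : TangentBundle 𝓘(ℝ, E) Q) → TangentSpace 𝓘(ℝ, E).tangent v)
    (C : Set (TangentBundle 𝓘(ℝ, E) Q)) (h : ℝ) (v : TangentBundle 𝓘(ℝ, E) Q) : Q × Q :=
  (v.proj, (flow Γ C h v).proj)

open Classical in
/-- The exact retraction `R_h^{e-} : exp_h^Γ(W) → W`, inverse of `exp_h^Γ` on `W` (with the value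
`0_{q₀}` at the pairs `(q₀, q₁)` outside `exp_h^Γ(W)`). -/
def retractMinus (Γ : (v : TangentBundle 𝓘(ℝ, E) Q) → TangentSpace 𝓘(ℝ, E).tangent v)
    (C : Set (TangentBundle 𝓘(ℝ, E) Q)) (h : ℝ) (W : Set (TangentBundle 𝓘(ℝ, E) Q))
    (p : Q × Q) : TangentBundle 𝓘(ℝ, E) Q :=
  if H : ∃ v ∈ W, expMap Γ C h v = p then H.choose else ⟨p.1, 0⟩

/-- `R_h^{e+} = φ_h^Γ ∘ R_h^{e-}`. -/
def retractPlus (Γ : (v : TangentBundle 𝓘(ℝ, E) Q) → TangentSpace 𝓘(ℝ, E).tangent v)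
    (C : Set (TangentBundle 𝓘(ℝ, E) Q)) (h : ℝ) (W : Set (TangentBundle 𝓘(ℝ, E) Q))
    (p : Q × Q) : TangentBundle 𝓘(ℝ, E) Q :=
  flow Γ C h (retractMinus Γ C h W p)

/-- `W` is an open subset of `M_h^Γ ⊆ TQ` on which `exp_h^Γ` is a diffeomorphism onto an open
subset of `Q × Q`. -/
structure IsRetractionDomain
    (Γ : (v : TangentBundle 𝓘(ℝ, E) Q) → TangentSpace 𝓘(ℝ, E).tangent v)
    (h : ℝ) (W : Set (TangentBundle 𝓘(ℝ, E) Q)) : Prop where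
  isOpen : IsOpen W
  subset : W ⊆ flowDomain Γ univ h
  injOn : InjOn (expMap Γ univ h) W
  isLocalDiffeomorphOn : IsLocalDiffeomorphOn 𝓘(ℝ, E).tangent (𝓘(ℝ, E).prod 𝓘(ℝ, E)) ∞
    (expMap Γ univ h) W

/-! ### Forced exact discrete objects -/

/-- The forced exact discrete Lagrangian
`L_{d,F}^{e,h} = ∫_0^h L ∘ φ_t^{Γ_{(L,F)}} ∘ R_{h,F}^{e-} dt`. -/
def exactLagrangian (L : TangentBundle 𝓘(ℝ, E) Q → ℝ)
    (F : (v : TangentBundle 𝓘(ℝ, E) Q) → TangentSpace 𝓘(ℝ, E) v.proj →L[ℝ] ℝ)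
    (h : ℝ) (W : Set (TangentBundle 𝓘(ℝ, E) Q)) (p : Q × Q) : ℝ :=
  ∫ t in (0 : ℝ)..h,
    L (flow (forcedField L F) univ t (retractMinus (forcedField L F) univ h W p))

/-- The double exact discrete force
`⟨F_d^{e,h}(q₀, q₁), (X₀, X₁)⟩ = ∫_0^h ⟨F(φ_t(R_{h,F}^{e-}(q₀, q₁))), X_{0,1}(t)⟩ dt`, where
`X_{0,1}(t) = T_{(q₀, q₁)}(τ_Q ∘ φ_t ∘ R_{h,F}^{e-})(X₀, X₁)`. -/
def exactDoubleForce (L : TangentBundle 𝓘(ℝ, E) Q → ℝ)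
    (F : (v : TangentBundle 𝓘(ℝ, E) Q) → TangentSpace 𝓘(ℝ, E) v.proj →L[ℝ] ℝ)
    (h : ℝ) (W : Set (TangentBundle 𝓘(ℝ, E) Q)) (p : Q × Q)
    (X₀ : TangentSpace 𝓘(ℝ, E) p.1) (X₁ : TangentSpace 𝓘(ℝ, E) p.2) : ℝ :=
  ∫ t in (0 : ℝ)..h,
    F (flow (forcedField L F) univ t (retractMinus (forcedField L F) univ h W p))
      (mfderiv (𝓘(ℝ, E).prod 𝓘(ℝ, E)) 𝓘(ℝ, E)
        (fun p' : Q × Q =>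
          (flow (forcedField L F) univ t (retractMinus (forcedField L F) univ h W p')).proj)
        p ((X₀, X₁) : E × E))

/-- The exact discrete force `F_d^{e,+}(q₀, q₁) ∈ T^*_{q₁} Q`, as a function on `T_{q₁} Q`. -/
def exactForcePlus (L : TangentBundle 𝓘(ℝ, E) Q → ℝ)
    (F : (v : TangentBundle 𝓘(ℝ, E) Q) → TangentSpace 𝓘(ℝ, E) v.proj →L[ℝ] ℝ)
    (h : ℝ) (W : Set (TangentBundle 𝓘(ℝ, E) Q)) (p : Q × Q)
    (X₁ : TangentSpace 𝓘(ℝ, E) p.2) : ℝ :=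
  exactDoubleForce L F h W p 0 X₁

/-- The exact discrete force `F_d^{e,-}(q₀, q₁) ∈ T^*_{q₀} Q`, as a function on `T_{q₀} Q`. -/
def exactForceMinus (L : TangentBundle 𝓘(ℝ, E) Q → ℝ)
    (F : (v : TangentBundle 𝓘(ℝ, E) Q) → TangentSpace 𝓘(ℝ, E) v.proj →L[ℝ] ℝ)
    (h : ℝ) (W : Set (TangentBundle 𝓘(ℝ, E) Q)) (p : Q × Q)
    (X₀ : TangentSpace 𝓘(ℝ, E) p.1) : ℝ :=
  exactDoubleForce L F h W p X₀ 0

/-! ### Discrete mechanics: the modified Lagrange-d'Alembert principle and its equations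

A sequence `(q_0, …, q_N)` is a map `q : ℕ → Q` of which only the terms up to `N` are used. -/

/-- The discrete action `S_d(q_0, …, q_N) = ∑_{k=0}^{N-1} L_d(q_k, q_{k+1})`. -/
def discreteAction (Ld : Q × Q → ℝ) (N : ℕ) (q : ℕ → Q) : ℝ :=
  ∑ k ∈ Finset.range N, Ld (q k, q (k + 1))

/-- `D₁ L_d(q₀, q₁) ∈ T^*_{q₀} Q`. -/
def partialOne (Ld : Q × Q → ℝ) (p : Q × Q) (X₀ : TangentSpace 𝓘(ℝ, E) p.1) : ℝ :=
  mfderiv (𝓘(ℝ, E).prod 𝓘(ℝ, E)) 𝓘(ℝ, ℝ) Ld p ((X₀, 0) : E × E)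

/-- `D₂ L_d(q₀, q₁) ∈ T^*_{q₁} Q`. -/
def partialTwo (Ld : Q × Q → ℝ) (p : Q × Q) (X₁ : TangentSpace 𝓘(ℝ, E) p.2) : ℝ :=
  mfderiv (𝓘(ℝ, E).prod 𝓘(ℝ, E)) 𝓘(ℝ, ℝ) Ld p ((0, X₁) : E × E)

/-- `c` is a smooth variation of `(q_0, …, q_N)` with fixed end points and with infinitesimal
variation `δ`, where `δ k ∈ T_{q_k} Q`. -/
structure IsVariation (N : ℕ) (q : ℕ → Q) (δ : (k : ℕ) → TangentSpace 𝓘(ℝ, E) (q k))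
    (c : ℕ → ℝ → Q) : Prop where
  base : ∀ k ≤ N, c k 0 = q k
  smooth : ∀ k ≤ N, ContMDiffAt 𝓘(ℝ, ℝ) 𝓘(ℝ, E) ∞ (c k) 0
  velocity : ∀ k ≤ N, (mfderiv 𝓘(ℝ, ℝ) 𝓘(ℝ, E) (c k) 0 (1 : ℝ) : E) = δ k
  fixed_left : ∀ s, c 0 s = q 0
  fixed_right : ∀ s, c N s = q N

/-- The modified Lagrange-d'Alembert principle for the distribution `D`, the discrete constraint
space `M`, the discrete Lagrangian `Ld` and the discrete forces `Fp`, `Fm`: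
`dS_d(q_d) · δq_d + ∑_{k=1}^{N-1} [F⁺(q_{k-1}, q_k) + F⁻(q_k, q_{k+1})] · δq_k = 0` for all
variations with fixed end points and `δq_k ∈ D_{q_k}`, and `(q_k, q_{k+1}) ∈ M`. -/
def ModifiedLdAPrinciple (D : (q : Q) → Submodule ℝ (TangentSpace 𝓘(ℝ, E) q)) (M : Set (Q × Q))
    (Ld : Q × Q → ℝ) (Fp : (p : Q × Q) → TangentSpace 𝓘(ℝ, E) p.2 → ℝ)
    (Fm : (p : Q × Q) → TangentSpace 𝓘(ℝ, E) p.1 → ℝ) (N : ℕ) (q : ℕ → Q) : Prop :=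
  (∀ (δ : (k : ℕ) → TangentSpace 𝓘(ℝ, E) (q k)) (c : ℕ → ℝ → Q), IsVariation N q δ c →
    (∀ k ≤ N, δ k ∈ D (q k)) →
    ∃ dS : ℝ, HasDerivAt (fun s => discreteAction Ld N (fun k => c k s)) dS 0 ∧
      dS + ∑ k ∈ Finset.Ioo 0 N,
        (Fp (q (k - 1), q k) (δ k) + Fm (q k, q (k + 1)) (δ k)) = 0) ∧
  ∀ k < N, (q k, q (k + 1)) ∈ M

/-- The modified Lagrange-d'Alembert equations
`D₂L_d(q_{k-1}, q_k) + D₁L_d(q_k, q_{k+1}) + F⁺(q_{k-1}, q_k) + F⁻(q_k, q_{k+1}) ∈ D^o_{q_k}`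
for `1 ≤ k ≤ N - 1`, and `(q_k, q_{k+1}) ∈ M` for `0 ≤ k ≤ N - 1`. -/
def ModifiedLdAEquations (D : (q : Q) → Submodule ℝ (TangentSpace 𝓘(ℝ, E) q)) (M : Set (Q × Q))
    (Ld : Q × Q → ℝ) (Fp : (p : Q × Q) → TangentSpace 𝓘(ℝ, E) p.2 → ℝ)
    (Fm : (p : Q × Q) → TangentSpace 𝓘(ℝ, E) p.1 → ℝ) (N : ℕ) (q : ℕ → Q) : Prop :=
  (∀ k, 0 < k → k < N → ∀ w ∈ D (q k),
    partialTwo Ld (q (k - 1), q k) w + partialOne Ld (q k, q (k + 1)) w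
      + Fp (q (k - 1), q k) w + Fm (q k, q (k + 1)) w = 0) ∧
  ∀ k < N, (q k, q (k + 1)) ∈ M

/-! ### Exact discrete nonholonomic mechanics -/

/-- The nonholonomic Legendre map `𝔽l : D → D^*`, `⟨𝔽l(u), w⟩ = d/dt|_{t=0} l(u + t w)` for
`u, w ∈ D_q`, where `l = L|_D`. -/
def legendreNh (L : TangentBundle 𝓘(ℝ, E) Q → ℝ) (u : TangentBundle 𝓘(ℝ, E) Q)
    (w : TangentSpace 𝓘(ℝ, E) u.proj) : ℝ :=
  deriv (fun t : ℝ => L ⟨u.proj, u.snd + t • w⟩) 0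

/-- The open subset `U_h = W ∩ M_h^{Γ_nh}` of `D`. -/
def nhDomain (L : TangentBundle 𝓘(ℝ, E) Q → ℝ)
    (D : (q : Q) → Submodule ℝ (TangentSpace 𝓘(ℝ, E) q)) (h : ℝ)
    (W : Set (TangentBundle 𝓘(ℝ, E) Q)) : Set (TangentBundle 𝓘(ℝ, E) Q) :=
  W ∩ flowDomain (nonholonomicField L D) (distSet D) h

/-- The exact discrete nonholonomic constraint space `M_h^{e,nh} = exp_h^{Γ_nh}(U_h)`. -/
def exactConstraint (L : TangentBundle 𝓘(ℝ, E) Q → ℝ)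
    (D : (q : Q) → Submodule ℝ (TangentSpace 𝓘(ℝ, E) q)) (h : ℝ)
    (W : Set (TangentBundle 𝓘(ℝ, E) Q)) : Set (Q × Q) :=
  expMap (nonholonomicField L D) (distSet D) h '' nhDomain L D h W

/-- `R_{h,nh}^{e-}`, the inverse of `exp_h^{Γ_nh} : U_h → M_h^{e,nh}`. -/
def nhRetractMinus (L : TangentBundle 𝓘(ℝ, E) Q → ℝ)
    (D : (q : Q) → Submodule ℝ (TangentSpace 𝓘(ℝ, E) q)) (h : ℝ)
    (W : Set (TangentBundle 𝓘(ℝ, E) Q)) (p : Q × Q) : TangentBundle 𝓘(ℝ, E) Q :=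
  retractMinus (nonholonomicField L D) (distSet D) h (nhDomain L D h W) p

/-- `R_{h,nh}^{e+} = φ_h^{Γ_nh} ∘ R_{h,nh}^{e-}`. -/
def nhRetractPlus (L : TangentBundle 𝓘(ℝ, E) Q → ℝ)
    (D : (q : Q) → Submodule ℝ (TangentSpace 𝓘(ℝ, E) q)) (h : ℝ)
    (W : Set (TangentBundle 𝓘(ℝ, E) Q)) (p : Q × Q) : TangentBundle 𝓘(ℝ, E) Q :=
  retractPlus (nonholonomicField L D) (distSet D) h (nhDomain L D h W) p

/-- The exact discrete nonholonomic equations (momentum matching)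
`𝔽⁺_{h,nh} l(q_{k-1}, q_k) - 𝔽⁻_{h,nh} l(q_k, q_{k+1}) = 0` in `D^*_{q_k}` for `1 ≤ k ≤ N - 1`,
with `(q_k, q_{k+1}) ∈ M_h^{e,nh}` for `0 ≤ k ≤ N - 1`, where
`𝔽^±_{h,nh} l = 𝔽l ∘ R_{h,nh}^{e±}`. For such pairs both retractions take values over `q_k`. -/
def MomentumMatching (L : TangentBundle 𝓘(ℝ, E) Q → ℝ)
    (D : (q : Q) → Submodule ℝ (TangentSpace 𝓘(ℝ, E) q)) (h : ℝ)
    (W : Set (TangentBundle 𝓘(ℝ, E) Q)) (N : ℕ) (q : ℕ → Q) : Prop :=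
  (∀ k, 0 < k → k < N → ∀ w ∈ D (q k),
    legendreNh L (nhRetractPlus L D h W (q (k - 1), q k)) (w : E)
      - legendreNh L (nhRetractMinus L D h W (q k, q (k + 1))) (w : E) = 0) ∧
  ∀ k < N, (q k, q (k + 1)) ∈ exactConstraint L D h W

end Geometry

end NonholonomicMechanics

end

/-! Everything follows from the first variation formula of the action along the forced flow. Write
`FL` for the fibre derivative of `L`. Differentiating the action along forced trajectories and
integrating by parts leaves, after adding the work of the force, only the boundary term: momentum at
time `h` paired with the final displacement, minus momentum at time `0` paired with the initial one.
Composing with the retraction, whose end point maps are the two projections of `Q × Q`, gives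
`dL_d(X₀, X₁) + F_d(X₀, X₁) = ⟨FL ∘ R⁺, X₁⟩ - ⟨FL ∘ R⁻, X₀⟩` (`exactLagrangian_first_variation`).
Hence the left side of the modified equations at `q_k` is the momentum mismatch there, and testing
on `D` leaves the mismatch of the nonholonomic momenta, provided that the forced and nonholonomic
retractions agree.

They agree on `M_h`: as the force extends the nonholonomic one, both fields solve the same equation
along `D`, and nondegeneracy of the Poincaré-Cartan form makes them equal
(`forcedField_eq_nonholonomicField`). So a nonholonomic trajectory is a forced one, and injectivity
of the exponential map on `W` identifies the initial vectors (`retract_eq_of_mem_exactConstraint`).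

The variation formula is proved for short times in a natural chart of `TQ`
(`local_first_variation`), using differentiability of the local flow in its initial condition
(`exists_local_flow_hasFDerivAt`). It is additive under concatenation of times
(`SatisfiesVariationFormula.add`), and compactness of `[0, h]` carries it to time `h`.

The equivalence of principle and equations is summation by parts, together with variations that move
a single interior point (`modifiedLdAPrinciple_iff_equations`). -/

noncomputable section

namespace NonholonomicMechanics

/-! ### Differentiability of a local flow in the initial condition. -/

section LocalFlow

variable {V : Type*} [NormedAddCommGroup V] [NormedSpace ℝ V]

/-- Mean value inequality on the segment from `x` to `y`, where `fderiv ℝ f` differs from its value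
at `x` by at most `K * ‖y - x‖`. -/
theorem norm_image_sub_sub_fderiv_le_sq {f : V → V} {s : Set V} (hs : Convex ℝ s) {K : NNReal}
    (hf : ∀ x ∈ s, DifferentiableAt ℝ f x) (hK : LipschitzOnWith K (fderiv ℝ f) s)
    {x y : V} (hx : x ∈ s) (hy : y ∈ s) :
    ‖f y - f x - fderiv ℝ f x (y - x)‖ ≤ K * ‖y - x‖ ^ 2 := by
  have hseg : segment ℝ x y ⊆ s := hs.segment_subset hx hy
  have := (convex_segment x y).norm_image_sub_le_of_norm_hasFDerivWithin_le' (f := f)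
    (f' := fderiv ℝ f) (φ := fderiv ℝ f x) (C := K * ‖y - x‖)
    (fun z hz => (hf z (hseg hz)).hasFDerivAt.hasFDerivWithinAt)
    (fun z hz => (hK.norm_sub_le (hseg hz) hx).trans
      (mul_le_mul_of_nonneg_left (norm_sub_le_of_mem_segment hz) K.2))
    (left_mem_segment ℝ x y) (right_mem_segment ℝ x y)
  calc _ ≤ _ := this
    _ = _ := by ring

theorem gronwallBound_zero_eq_mul (K ε x : ℝ) :
    gronwallBound 0 K ε x = ε * gronwallBound 0 K 1 x := by
  unfold gronwallBound
  split_ifs <;> ring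

/-- The difference of two integral curves of `f` is, up to a quadratic error, the solution of the
linearised equation along one of them. -/
theorem norm_sub_sub_variation_le_sq {f : V → V} {s : Set V} (hs : Convex ℝ s) {K C : NNReal}
    {B t : ℝ} (ht : 0 ≤ t) (hf : ∀ x ∈ s, DifferentiableAt ℝ f x)
    (hK : LipschitzOnWith K (fderiv ℝ f) s) (hB : ∀ x ∈ s, ‖fderiv ℝ f x‖ ≤ B)
    {α β m : ℝ → V} {ρ : ℝ} (hα : ∀ τ ∈ Icc 0 t, HasDerivAt α (f (α τ)) τ)
    (hβ : ∀ τ ∈ Icc 0 t, HasDerivAt β (f (β τ)) τ)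
    (hm : ∀ τ ∈ Icc 0 t, HasDerivAt m (fderiv ℝ f (α τ) (m τ)) τ)
    (h0 : m 0 = β 0 - α 0) (hαs : ∀ τ ∈ Icc 0 t, α τ ∈ s) (hβs : ∀ τ ∈ Icc 0 t, β τ ∈ s)
    (hαβ : ∀ τ ∈ Icc 0 t, ‖β τ - α τ‖ ≤ C * ρ) :
    ‖β t - α t - m t‖ ≤ K * (C * ρ) ^ 2 * gronwallBound 0 B 1 t := by
  have hd : ∀ τ ∈ Icc 0 t, HasDerivAt (fun τ => β τ - α τ - m τ)
      (f (β τ) - f (α τ) - fderiv ℝ f (α τ) (m τ)) τ := fun τ hτ =>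
    ((hβ τ hτ).sub (hα τ hτ)).sub (hm τ hτ)
  have := norm_le_gronwallBound_of_norm_deriv_right_le (f := fun τ => β τ - α τ - m τ)
    (δ := 0) (K := B) (ε := K * (C * ρ) ^ 2) (a := 0) (b := t)
    (fun τ hτ => (hd τ hτ).continuousAt.continuousWithinAt)
    (fun τ hτ => (hd τ (Ico_subset_Icc_self hτ)).hasDerivWithinAt) (by simp [h0])
    (fun τ hτ => ?_) t (right_mem_Icc.2 ht)
  · rw [sub_zero, gronwallBound_zero_eq_mul] at this
    exact this
  · have hτ' := Ico_subset_Icc_self hτ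
    -- The error `β - α - m` solves the linearised equation up to a Taylor remainder that is
    -- quadratic in `β - α`; since it vanishes at time `0`, Grönwall keeps it quadratic.
    have e : f (β τ) - f (α τ) - fderiv ℝ f (α τ) (m τ) =
        fderiv ℝ f (α τ) (β τ - α τ - m τ) +
          (f (β τ) - f (α τ) - fderiv ℝ f (α τ) (β τ - α τ)) := by
      simp only [map_sub]; abel
    rw [e]
    refine (norm_add_le _ _).trans (add_le_add ?_ ?_)
    · exact (ContinuousLinearMap.le_opNorm _ _).trans
        (mul_le_mul_of_nonneg_right (hB _ (hαs τ hτ')) (norm_nonneg _))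
    · refine (norm_image_sub_sub_fderiv_le_sq hs hf hK (hαs τ hτ') (hβs τ hτ')).trans ?_
      gcongr
      exact hαβ τ hτ'

/-- A vector field of class `C²` has a local flow which is differentiable in the initial condition,
and the derivative solves the variational equation. -/
theorem exists_local_flow_hasFDerivAt [CompleteSpace V] {f : V → V} {U : Set V} (hU : IsOpen U)
    (hf : ContDiffOn ℝ 2 f U) {x₀ : V} (hx₀ : x₀ ∈ U) :
    ∃ r > 0, ∃ ε > 0, ∃ (α : V → ℝ → V) (M : V → ℝ → V →L[ℝ] V), ∀ x ∈ Metric.ball x₀ r,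
      α x 0 = x ∧ M x 0 = ContinuousLinearMap.id ℝ V ∧ ∀ t ∈ Ioo (-ε) ε,
        α x t ∈ U ∧ HasDerivAt (α x) (f (α x t)) t ∧
        HasDerivAt (M x) ((fderiv ℝ f (α x t)).comp (M x t)) t ∧
        (0 ≤ t → HasFDerivAt (fun y => α y t) (M x t) x) := by
  have hfat : ContDiffAt ℝ 2 f x₀ := hf.contDiffAt (hU.mem_nhds hx₀)
  have hf' : ContDiffAt ℝ 1 (fderiv ℝ f) x₀ := hfat.fderiv_right (by norm_num)
  obtain ⟨K, s, hs, hK⟩ := hf'.exists_lipschitzOnWith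
  have hbd : ∀ᶠ x in 𝓝 x₀, ‖fderiv ℝ f x‖ < ‖fderiv ℝ f x₀‖ + 1 :=
    hf'.continuousAt.norm.eventually_lt_const (by linarith)
  obtain ⟨R, hR, hRsub⟩ := Metric.mem_nhds_iff.1
    (Filter.inter_mem (Filter.inter_mem hs hbd) (hU.mem_nhds hx₀))
  set B := Metric.ball x₀ R
  -- The equation and its variational equation are solved as one system. It is of class `C¹` because
  -- `f` is `C²`, so Picard-Lindelöf supplies the flow and the candidate derivative on a common time
  -- interval.
  set g : V × (V →L[ℝ] V) → V × (V →L[ℝ] V) := fun p => (f p.1, (fderiv ℝ f p.1).comp p.2)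
  set p₀ : V × (V →L[ℝ] V) := (x₀, ContinuousLinearMap.id ℝ V)
  have hg : ContDiffAt ℝ 1 g p₀ := by
    refine ContDiffAt.prodMk ?_ ?_
    · exact (hfat.of_le (by norm_num)).comp p₀ contDiffAt_fst
    · exact (hf'.comp p₀ contDiffAt_fst).clm_comp contDiffAt_snd
  obtain ⟨ε₁, hε₁, a, r₁, L, K₁, hr₁, hpl⟩ := IsPicardLindelof.of_contDiffAt_one hg
  obtain ⟨β, hβ, C, hC⟩ :=
    (hpl 0).exists_forall_mem_closedBall_eq_hasDerivWithinAt_lipschitzOnWith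
  simp only [zero_sub, zero_add] at hβ hC
  have hmem₀ : p₀ ∈ Metric.closedBall p₀ (r₁ : ℝ) := Metric.mem_closedBall_self r₁.2
  have hder : ∀ p ∈ Metric.closedBall p₀ (r₁ : ℝ), ∀ t ∈ Ioo (-ε₁) ε₁,
      HasDerivAt (β p) (g (β p t)) t := fun p hp t ht =>
    ((hβ p hp).2 t (Ioo_subset_Icc_self ht)).hasDerivAt (Icc_mem_nhds ht.1 ht.2)
  have hcont : ContinuousAt (β p₀) 0 := (hder p₀ hmem₀ 0 ⟨by linarith, hε₁⟩).continuousAt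
  have hnear : ∀ᶠ t in 𝓝 (0 : ℝ), dist (β p₀ t) p₀ < R / 2 := by
    have := Metric.tendsto_nhds.1 hcont (R / 2) (by linarith)
    simpa [(hβ p₀ hmem₀).1] using this
  obtain ⟨ε₂, hε₂, hε₂sub⟩ := Metric.mem_nhds_iff.1 hnear
  -- The central trajectory moves less than `R / 2` before time `ε₂`, and a trajectory starting
  -- within `R / (2 * (C + 1))` stays within `R / 2` of it. So all of them remain in `B`, where the
  -- bounds on `f` hold; the `+ 1` guards against `C = 0`.
  refine ⟨min r₁ (R / (2 * (C + 1))), lt_min hr₁ (by positivity), min ε₁ ε₂, lt_min hε₁ hε₂,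
    fun x t => (β (x, ContinuousLinearMap.id ℝ V) t).1,
    fun x t => (β (x, ContinuousLinearMap.id ℝ V) t).2, ?_⟩
  set r := min (r₁ : ℝ) (R / (2 * (C + 1))) with hr
  set ι : V → V × (V →L[ℝ] V) := fun x => (x, ContinuousLinearMap.id ℝ V) with hι
  have hdist : ∀ x y, dist (ι x) (ι y) = dist x y := fun x y => by
    simp [hι, Prod.dist_eq]
  have hball : ∀ x ∈ Metric.ball x₀ r, ι x ∈ Metric.closedBall p₀ (r₁ : ℝ) := fun x hx => by
    have h1 : dist (ι x) p₀ = dist x x₀ := hdist x x₀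
    rw [Metric.mem_closedBall, h1]
    exact (Metric.mem_ball.1 hx).le.trans (min_le_left _ _)
  have hLip : ∀ x ∈ Metric.ball x₀ r, ∀ y ∈ Metric.ball x₀ r, ∀ t ∈ Ioo (-min ε₁ ε₂) (min ε₁ ε₂),
      ‖(β (ι y) t).1 - (β (ι x) t).1‖ ≤ C * ‖y - x‖ := fun x hx y hy t ht => by
    have ht' : t ∈ Icc (-ε₁) ε₁ :=
      ⟨by linarith [ht.1, min_le_left ε₁ ε₂], by linarith [ht.2, min_le_left ε₁ ε₂]⟩
    have h1 := (hC t ht').dist_le_mul _ (hball y hy) _ (hball x hx)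
    rw [hdist, dist_eq_norm, dist_eq_norm] at h1
    exact (norm_fst_le _).trans h1
  have hx₀r : x₀ ∈ Metric.ball x₀ r :=
    Metric.mem_ball_self (lt_min hr₁ (by positivity))
  have hB : ∀ x ∈ Metric.ball x₀ r, ∀ t ∈ Ioo (-min ε₁ ε₂) (min ε₁ ε₂), (β (ι x) t).1 ∈ B := by
    intro x hx t ht
    have h1 := hLip x₀ hx₀r x hx t ht
    have h2 : dist (β p₀ t) p₀ < R / 2 := hε₂sub (by
      rw [Metric.mem_ball, Real.dist_eq, sub_zero, abs_lt]
      exact ⟨by linarith [ht.1, min_le_right ε₁ ε₂], by linarith [ht.2, min_le_right ε₁ ε₂]⟩)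
    have h3 : ‖(β p₀ t).1 - x₀‖ < R / 2 := by
      rw [dist_eq_norm] at h2
      exact (norm_fst_le (β p₀ t - p₀)).trans_lt h2
    have h4 : C * ‖x - x₀‖ ≤ R / 2 := by
      have h5 : ‖x - x₀‖ ≤ R / (2 * (C + 1)) := by
        rw [← dist_eq_norm]
        exact (Metric.mem_ball.1 hx).le.trans (min_le_right _ _)
      calc C * ‖x - x₀‖ ≤ (C + 1) * (R / (2 * (C + 1))) := by gcongr; simp
        _ = R / 2 := by have : (C : ℝ) + 1 ≠ 0 := by positivity
                        field_simp
    rw [Metric.mem_ball, dist_eq_norm]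
    calc ‖(β (ι x) t).1 - x₀‖ ≤ ‖(β (ι x) t).1 - (β p₀ t).1‖ + ‖(β p₀ t).1 - x₀‖ :=
          norm_sub_le_norm_sub_add_norm_sub _ _ _
      _ < R := by have : ι x₀ = p₀ := rfl
                  rw [this] at h1; linarith
  have hfd : ∀ x ∈ B, DifferentiableAt ℝ f x := fun x hx =>
    (hf.contDiffAt (hU.mem_nhds (hRsub hx).2)).differentiableAt (by norm_num)
  have hmain : ∀ x ∈ Metric.ball x₀ r, ∀ t ∈ Ioo (-min ε₁ ε₂) (min ε₁ ε₂),
      HasDerivAt (β (ι x)) (g (β (ι x) t)) t := fun x hx t ht =>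
    hder _ (hball x hx) t
      ⟨by linarith [ht.1, min_le_left ε₁ ε₂], by linarith [ht.2, min_le_left ε₁ ε₂]⟩
  intro x hx
  refine ⟨congrArg Prod.fst (hβ _ (hball x hx)).1, congrArg Prod.snd (hβ _ (hball x hx)).1,
    fun t ht => ?_⟩
  refine ⟨(hRsub (hB x hx t ht)).2, (hmain x hx t ht).fst, (hmain x hx t ht).snd, fun ht0 => ?_⟩
  have hsub : Icc 0 t ⊆ Ioo (-min ε₁ ε₂) (min ε₁ ε₂) := fun τ hτ =>
    ⟨by linarith [hτ.1, lt_min hε₁ hε₂], hτ.2.trans_lt ht.2⟩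
  rw [hasFDerivAt_iff_isLittleO]
  -- The quadratic Grönwall estimate is stronger than differentiability. It is run forward from time
  -- `0`, which is why `0 ≤ t` is assumed.
  have hO : (fun y => (β (ι y) t).1 - (β (ι x) t).1 - (β (ι x) t).2 (y - x)) =O[𝓝 x]
      fun y => ‖y - x‖ ^ 2 := by
    refine Asymptotics.IsBigO.of_bound
      (K * C ^ 2 * gronwallBound 0 (‖fderiv ℝ f x₀‖ + 1) 1 t) ?_
    filter_upwards [Metric.isOpen_ball.mem_nhds hx] with y hy
    have := norm_sub_sub_variation_le_sq (f := f) (convex_ball x₀ R) (K := K) (C := C)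
      (B := ‖fderiv ℝ f x₀‖ + 1) (α := fun τ => (β (ι x) τ).1) (β := fun τ => (β (ι y) τ).1)
      (m := fun τ => (β (ι x) τ).2 (y - x)) (ρ := ‖y - x‖) ht0 hfd
      (hK.mono fun z hz => (hRsub hz).1.1) (fun z hz => (hRsub hz).1.2.le)
      (fun τ hτ => (hmain x hx τ (hsub hτ)).fst) (fun τ hτ => (hmain y hy τ (hsub hτ)).fst)
      (fun τ hτ => by
        have h1 : HasDerivAt (fun τ => (β (ι x) τ).2) (g (β (ι x) τ)).2 τ :=
          (hmain x hx τ (hsub hτ)).snd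
        simpa [g] using! h1.clm_apply (hasDerivAt_const τ (y - x)))
      (by simp only [(hβ _ (hball x hx)).1, (hβ _ (hball y hy)).1]; rfl)
      (fun τ hτ => hB x hx τ (hsub hτ)) (fun τ hτ => hB y hy τ (hsub hτ))
      (fun τ hτ => hLip x hx y hy τ (hsub hτ))
    rw [norm_pow, norm_norm]
    calc _ ≤ _ := this
      _ = _ := by ring
  refine hO.trans_isLittleO ?_
  have h1 : (fun y => ‖y - x‖ ^ 2) =o[𝓝 x] fun y => y - x :=
    Asymptotics.isLittleO_norm_right.1 (by
    have : Filter.Tendsto (fun y => ‖y - x‖) (𝓝 x) (𝓝 0) := by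
      have : ContinuousAt (fun y => ‖y - x‖) x := by fun_prop
      simpa [ContinuousAt] using this
    exact (Asymptotics.isLittleO_pow_id one_lt_two).comp_tendsto this)
  exact h1

end LocalFlow

/-! ### One-forms and their exterior derivative in preferred charts. -/

section Charts

variable {F H M : Type*} [NormedAddCommGroup F] [NormedSpace ℝ F] [TopologicalSpace H]
  (J : ModelWithCorners ℝ F H) [TopologicalSpace M] [ChartedSpace H M]

/-- The derivative of the inverse of the preferred chart at `x₀`. -/
def chartDeriv (x₀ : M) (z : F) : F →L[ℝ] F :=
  mfderiv 𝓘(ℝ, F) J (extChartAt J x₀).symm z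

/-- The derivative of the preferred chart at `x₀`. -/
def chartFDeriv (x₀ x : M) : F →L[ℝ] F :=
  mfderiv J 𝓘(ℝ, F) (extChartAt J x₀) x

/-- A one-form, written in the preferred chart at `x₀`. -/
def localForm (θ : (x : M) → TangentSpace J x →L[ℝ] ℝ) (x₀ : M) (y : F) : F →L[ℝ] ℝ :=
  (θ ((extChartAt J x₀).symm y)).comp (chartDeriv J x₀ y)

theorem extDerivOneForm_eq (θ : (x : M) → TangentSpace J x →L[ℝ] ℝ) (x : M) (X Y : F) :
    extDerivOneForm J θ x X Y =
      fderiv ℝ (localForm J θ x) (extChartAt J x x) X Y -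
        fderiv ℝ (localForm J θ x) (extChartAt J x x) Y X :=
  rfl

variable {J} [IsManifold J ∞ M]

theorem contMDiffAt_extChartAt_of_mem {x₀ x : M} (hx : x ∈ (extChartAt J x₀).source) :
    ContMDiffAt J 𝓘(ℝ, F) ∞ (extChartAt J x₀) x :=
  contMDiffAt_extChartAt' (by rwa [extChartAt_source] at hx)

theorem hasMFDerivAt_extChartAt_of_mem {x₀ x : M} (hx : x ∈ (extChartAt J x₀).source) :
    HasMFDerivAt J 𝓘(ℝ, F) (extChartAt J x₀) x (chartFDeriv (F := F) J x₀ x) :=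
  ((contMDiffAt_extChartAt_of_mem hx).mdifferentiableAt (by simp)).hasMFDerivAt

variable [J.Boundaryless]

theorem contMDiffAt_extChartAt_symm {x₀ : M} {z : F} (hz : z ∈ (extChartAt J x₀).target) :
    ContMDiffAt 𝓘(ℝ, F) J ∞ (extChartAt J x₀).symm z :=
  (contMDiffOn_extChartAt_symm x₀).contMDiffAt ((isOpen_extChartAt_target x₀).mem_nhds hz)

theorem hasMFDerivAt_extChartAt_symm {x₀ : M} {z : F} (hz : z ∈ (extChartAt J x₀).target) :
    HasMFDerivAt 𝓘(ℝ, F) J (extChartAt J x₀).symm z (chartDeriv (F := F) J x₀ z) :=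
  ((contMDiffAt_extChartAt_symm hz).mdifferentiableAt (by simp)).hasMFDerivAt

theorem chartFDeriv_comp_chartDeriv {x₀ : M} {z : F} (hz : z ∈ (extChartAt J x₀).target) :
    (chartFDeriv J x₀ ((extChartAt J x₀).symm z)).comp
      (chartDeriv J x₀ z) = ContinuousLinearMap.id ℝ F := by
  have : IsManifold J 1 M := .of_le (n := ∞) (by simp)
  have := mfderiv_extChartAt_comp_mfderivWithin_extChartAt_symm (I := J) (x := x₀) hz
  rw [J.range_eq_univ, mfderivWithin_univ] at this
  exact this

theorem chartDeriv_comp_chartFDeriv {x₀ : M} {z : F} (hz : z ∈ (extChartAt J x₀).target) :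
    (chartDeriv J x₀ z).comp
      (chartFDeriv J x₀ ((extChartAt J x₀).symm z)) =
      ContinuousLinearMap.id ℝ F := by
  have : IsManifold J 1 M := .of_le (n := ∞) (by simp)
  have := mfderivWithin_extChartAt_symm_comp_mfderiv_extChartAt (I := J) (x := x₀) hz
  rw [J.range_eq_univ, mfderivWithin_univ] at this
  exact this

theorem chartDeriv_bijective {x₀ : M} {z : F} (hz : z ∈ (extChartAt J x₀).target) :
    Function.Bijective (chartDeriv J x₀ z) :=
  ⟨Function.LeftInverse.injective fun X =>
      DFunLike.congr_fun (chartFDeriv_comp_chartDeriv hz) X,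
    Function.RightInverse.surjective fun X =>
      DFunLike.congr_fun (chartDeriv_comp_chartFDeriv hz) X⟩

/-- The identification of `T_x M` with the model space is the one given by the preferred chart at
`x` itself. -/
theorem chartDeriv_self (x : M) :
    chartDeriv J x (extChartAt J x x) = ContinuousLinearMap.id ℝ F := by
  have : IsManifold J 1 M := .of_le (n := ∞) (by simp)
  have := mfderivWithin_range_extChartAt_symm (I := J) (x := x)
  rw [J.range_eq_univ, mfderivWithin_univ] at this
  exact this

/-- The exterior derivative of a one-form may be computed in any preferred chart. -/
theorem extDerivOneForm_apply_chartDeriv (θ : (x : M) → TangentSpace J x →L[ℝ] ℝ) (x₀ : M) {z : F}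
    (hz : z ∈ (extChartAt J x₀).target) (hθ : DifferentiableAt ℝ (localForm J θ x₀) z) (X Y : F) :
    extDerivOneForm J θ ((extChartAt J x₀).symm z) (chartDeriv J x₀ z X) (chartDeriv J x₀ z Y) =
      fderiv ℝ (localForm J θ x₀) z X Y - fderiv ℝ (localForm J θ x₀) z Y X := by
  set x : M := (extChartAt J x₀).symm z with hx
  set z₁ : F := extChartAt J x x with hz₁
  set ψ : F → F := fun y => extChartAt J x₀ ((extChartAt J x).symm y) with hψ
  have hxs : x ∈ (extChartAt J x₀).source := (extChartAt J x₀).map_target hz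
  have hz₁t : z₁ ∈ (extChartAt J x).target := mem_extChartAt_target x
  have hsymm : (extChartAt J x).symm z₁ = x := (extChartAt J x).left_inv (mem_extChartAt_source x)
  have hψz : ψ z₁ = z := by
    change extChartAt J x₀ ((extChartAt J x).symm z₁) = z
    rw [hsymm, hx, (extChartAt J x₀).right_inv hz]
  have hgood : ∀ᶠ y in 𝓝 z₁, y ∈ (extChartAt J x).target ∧
      (extChartAt J x).symm y ∈ (extChartAt J x₀).source := by
    refine Filter.Eventually.and ((isOpen_extChartAt_target x).mem_nhds hz₁t) ?_
    refine (contMDiffAt_extChartAt_symm hz₁t).continuousAt.eventually ?_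
    rw [hsymm]
    exact (isOpen_extChartAt_source x₀).mem_nhds hxs
  have hψs : ∀ y, y ∈ (extChartAt J x).target ∧
      (extChartAt J x).symm y ∈ (extChartAt J x₀).source → ContDiffAt ℝ ∞ ψ y := fun y hy => by
    rw [← contMDiffAt_iff_contDiffAt]
    exact (contMDiffAt_extChartAt_of_mem hy.2).comp y (contMDiffAt_extChartAt_symm hy.1)
  have hder : ∀ᶠ y in 𝓝 z₁, chartDeriv J x y = (chartDeriv J x₀ (ψ y)).comp (fderiv ℝ ψ y) := by
    filter_upwards [hgood.eventually_nhds] with y hy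
    have hy' := hy.self_of_nhds
    have hψd : HasFDerivAt ψ (fderiv ℝ ψ y) y :=
      ((hψs y hy').differentiableAt (by simp)).hasFDerivAt
    have h1 : HasMFDerivAt 𝓘(ℝ, F) J ((extChartAt J x₀).symm ∘ ψ) y
        ((chartDeriv J x₀ (ψ y)).comp (fderiv ℝ ψ y)) :=
      (hasMFDerivAt_extChartAt_symm ((extChartAt J x₀).map_source hy'.2)).comp y
        hψd.hasMFDerivAt
    have h2 : (extChartAt J x).symm =ᶠ[𝓝 y] (extChartAt J x₀).symm ∘ ψ := by
      filter_upwards [hy] with w hw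
      exact ((extChartAt J x₀).left_inv hw.2).symm
    exact (h1.congr_of_eventuallyEq h2).mfderiv
  have hform : localForm J θ x =ᶠ[𝓝 z₁]
      fun y => (localForm J θ x₀ (ψ y)).comp (fderiv ℝ ψ y) := by
    filter_upwards [hder, hgood] with y hy hy'
    -- The fibres over different points are definitionally the same space, but the type of `θ a`
    -- depends on `a`; generalising the base point makes the substitution legitimate. The later
    -- `key` statements serve the same purpose.
    have key : ∀ a b : M, a = b → ∀ A B : F →L[ℝ] F,
        A = B → (show F →L[ℝ] ℝ from θ a).comp A = (show F →L[ℝ] ℝ from θ b).comp B := by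
      rintro a b rfl A B rfl; rfl
    exact key _ _ ((extChartAt J x₀).left_inv hy'.2).symm _ _ hy
  have hψ₁ : ContDiffAt ℝ ∞ ψ z₁ := hψs z₁ hgood.self_of_nhds
  have hψ₂ : HasFDerivAt ψ (fderiv ℝ ψ z₁) z₁ := (hψ₁.differentiableAt (by simp)).hasFDerivAt
  have hψ₃ : HasFDerivAt (fderiv ℝ ψ) (fderiv ℝ (fderiv ℝ ψ) z₁) z₁ :=
    ((hψ₁.fderiv_right (m := 1) (by norm_cast)).differentiableAt (by simp)).hasFDerivAt
  -- Changing charts by `ψ` adds a term in the second derivative of `ψ`; by symmetry it cancels on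
  -- antisymmetrising.
  have hsym : IsSymmSndFDerivAt ℝ ψ z₁ := hψ₁.isSymmSndFDerivAt (by simp only [minSmoothness_of_isRCLikeNormedField]; exact WithTop.coe_le_coe.2 le_top)
  rw [← hψz] at hθ
  have hcomp : HasFDerivAt (fun y => localForm J θ x₀ (ψ y))
      ((fderiv ℝ (localForm J θ x₀) (ψ z₁)).comp (fderiv ℝ ψ z₁)) z₁ :=
    hθ.hasFDerivAt.comp z₁ hψ₂
  have hall := (hcomp.clm_comp hψ₃).congr_of_eventuallyEq hform
  have hid : (chartDeriv J x₀ z).comp (fderiv ℝ ψ z₁) = ContinuousLinearMap.id ℝ F := by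
    rw [← chartDeriv_self (J := J) x, hder.self_of_nhds, hψz]
  -- A right inverse of the bijection `chartDeriv J x₀ z` is also a left inverse.
  have hinv : ∀ X, fderiv ℝ ψ z₁ (chartDeriv J x₀ z X) = X := fun X =>
    (chartDeriv_bijective hz).1 (DFunLike.congr_fun hid (chartDeriv J x₀ z X))
  rw [extDerivOneForm_eq, hall.fderiv]
  simp only [add_apply, ContinuousLinearMap.comp_apply,
    ContinuousLinearMap.compL_apply, ContinuousLinearMap.flip_apply, hinv, hψz]
  rw [hsym.eq (chartDeriv J x₀ z X) (chartDeriv J x₀ z Y)]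
  ring

end Charts

/-! ### Natural charts of the tangent bundle and the vertical endomorphism. -/

section NaturalCharts

variable {E : Type*} [NormedAddCommGroup E] [NormedSpace ℝ E]
  {Q : Type*} [TopologicalSpace Q] [ChartedSpace E Q] [IsManifold 𝓘(ℝ, E) ∞ Q]

/-- The chart of `TQ` induced by the preferred chart of `Q` at `q₀`. -/
def natChart (q₀ : Q) : PartialEquiv (TangentBundle 𝓘(ℝ, E) Q) (E × E) :=
  extChartAt 𝓘(ℝ, E).tangent (⟨q₀, 0⟩ : TangentBundle 𝓘(ℝ, E) Q)

/-- The derivative of the inverse of `natChart q₀`. -/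
def natDeriv (q₀ : Q) (z : E × E) : E × E →L[ℝ] E × E :=
  chartDeriv 𝓘(ℝ, E).tangent (⟨q₀, 0⟩ : TangentBundle 𝓘(ℝ, E) Q) z

/-- The derivative of `natChart q₀`. -/
def natFDeriv (q₀ : Q) (v : TangentBundle 𝓘(ℝ, E) Q) : E × E →L[ℝ] E × E :=
  chartFDeriv 𝓘(ℝ, E).tangent (⟨q₀, 0⟩ : TangentBundle 𝓘(ℝ, E) Q) v

/-- The derivative of the inverse of the preferred chart of `Q` at `q₀`. -/
def baseDeriv (q₀ : Q) (x : E) : E →L[ℝ] E :=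
  chartDeriv 𝓘(ℝ, E) q₀ x

theorem mem_natChart_source {q₀ : Q} {v : TangentBundle 𝓘(ℝ, E) Q} :
    v ∈ (natChart q₀).source ↔ v.proj ∈ (extChartAt 𝓘(ℝ, E) q₀).source := by
  simp [natChart]

theorem mem_natChart_target {q₀ : Q} {z : E × E} :
    z ∈ (natChart q₀).target ↔ z.1 ∈ (extChartAt 𝓘(ℝ, E) q₀).target := by
  have h1 : z ∈ (natChart q₀).target ↔
      z ∈ (chartAt (ModelProd E E) (⟨q₀, 0⟩ : TangentBundle 𝓘(ℝ, E) Q)).target := by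
    rw [natChart, extChartAt_target, ModelWithCorners.range_eq_univ, inter_univ]
    exact Iff.rfl
  rw [h1]
  exact (TangentBundle.mem_chart_target_iff (I := 𝓘(ℝ, E)) z _).trans (by simp [extChartAt])

theorem isOpen_natChart_target (q₀ : Q) : IsOpen (natChart (E := E) q₀).target :=
  isOpen_extChartAt_target _

theorem isOpen_natChart_source (q₀ : Q) : IsOpen (natChart (E := E) q₀).source :=
  isOpen_extChartAt_source _

/-- The fibre part of a chart of `TQ` is the tangent trivialization at `q₀`, whose inverse is the
derivative of the inverse base chart. -/
theorem natChart_symm_eq (q₀ : Q) {z : E × E} (hz : z ∈ (natChart q₀).target) :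
    (natChart q₀).symm z = ⟨(extChartAt 𝓘(ℝ, E) q₀).symm z.1, baseDeriv q₀ z.1 z.2⟩ := by
  have : IsManifold 𝓘(ℝ, E) 1 Q := .of_le (n := ∞) (by simp)
  have hz1 := mem_natChart_target.1 hz
  have hmem : (extChartAt 𝓘(ℝ, E) q₀).symm z.1 ∈ (chartAt E q₀).source := by
    have := (extChartAt 𝓘(ℝ, E) q₀).map_target hz1
    rwa [extChartAt_source] at this
  have h1 := TangentBundle.symmL_trivializationAt (I := 𝓘(ℝ, E)) hmem
  rw [TangentBundle.symmL_trivializationAt_eq_core hmem, (extChartAt 𝓘(ℝ, E) q₀).right_inv hz1,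
    modelWithCornersSelf_coe, range_id, mfderivWithin_univ] at h1
  exact congrArg (TotalSpace.mk _) (DFunLike.congr_fun h1 z.2)

theorem hasMFDerivAt_natChart_symm {q₀ : Q} {z : E × E} (hz : z ∈ (natChart q₀).target) :
    HasMFDerivAt 𝓘(ℝ, E × E) 𝓘(ℝ, E).tangent (natChart q₀).symm z
      (natDeriv (E := E) q₀ z) :=
  hasMFDerivAt_extChartAt_symm hz

theorem contMDiffAt_natChart_symm {q₀ : Q} {z : E × E} (hz : z ∈ (natChart q₀).target) :
    ContMDiffAt 𝓘(ℝ, E × E) 𝓘(ℝ, E).tangent ∞ (natChart q₀).symm z :=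
  contMDiffAt_extChartAt_symm hz

theorem hasMFDerivAt_natChart {q₀ : Q} {v : TangentBundle 𝓘(ℝ, E) Q}
    (hv : v ∈ (natChart q₀).source) :
    HasMFDerivAt 𝓘(ℝ, E).tangent 𝓘(ℝ, E × E) (natChart q₀) v (natFDeriv (E := E) q₀ v) :=
  hasMFDerivAt_extChartAt_of_mem hv

theorem contMDiffAt_natChart {q₀ : Q} {v : TangentBundle 𝓘(ℝ, E) Q}
    (hv : v ∈ (natChart q₀).source) :
    ContMDiffAt 𝓘(ℝ, E).tangent 𝓘(ℝ, E × E) ∞ (natChart q₀) v :=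
  contMDiffAt_extChartAt_of_mem hv

theorem natFDeriv_natDeriv {q₀ : Q} {z : E × E} (hz : z ∈ (natChart q₀).target) (X : E × E) :
    natFDeriv q₀ ((natChart q₀).symm z) (natDeriv q₀ z X) = X :=
  DFunLike.congr_fun (chartFDeriv_comp_chartDeriv hz) X

theorem natDeriv_natFDeriv {q₀ : Q} {z : E × E} (hz : z ∈ (natChart q₀).target) (X : E × E) :
    natDeriv q₀ z (natFDeriv q₀ ((natChart q₀).symm z) X) = X :=
  DFunLike.congr_fun (chartDeriv_comp_chartFDeriv hz) X

theorem natDeriv_bijective {q₀ : Q} {z : E × E} (hz : z ∈ (natChart q₀).target) :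
    Function.Bijective (natDeriv q₀ z) :=
  chartDeriv_bijective hz

/-! ### The canonical structures in natural charts -/

theorem hasMFDerivAt_proj (v : TangentBundle 𝓘(ℝ, E) Q) :
    HasMFDerivAt 𝓘(ℝ, E).tangent 𝓘(ℝ, E) (fun u : TangentBundle 𝓘(ℝ, E) Q => u.proj) v
      (tangentProj v) :=
  ((contMDiff_proj (TangentSpace 𝓘(ℝ, E) : Q → Type _) (n := ∞)).contMDiffAt.mdifferentiableAt
    (by simp)).hasMFDerivAt

theorem tangentProj_natDeriv {q₀ : Q} {z : E × E} (hz : z ∈ (natChart q₀).target) (X : E × E) :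
    tangentProj ((natChart q₀).symm z) (natDeriv q₀ z X) = baseDeriv q₀ z.1 X.1 := by
  have h1 := (hasMFDerivAt_proj ((natChart q₀).symm z)).comp z (hasMFDerivAt_natChart_symm hz)
  have h2 : HasMFDerivAt 𝓘(ℝ, E × E) 𝓘(ℝ, E) ((extChartAt 𝓘(ℝ, E) q₀).symm ∘ Prod.fst) z
      ((baseDeriv (E := E) q₀ z.1).comp (ContinuousLinearMap.fst ℝ E E)) :=
    (hasMFDerivAt_extChartAt_symm (mem_natChart_target.1 hz)).comp z
      (hasFDerivAt_fst (𝕜 := ℝ) (p := z)).hasMFDerivAt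
  exact DFunLike.congr_fun (hasMFDerivAt_unique h1 h2) X

/-- In the natural chart the inclusion of a fibre is the affine map `w ↦ (z.1, A w)`, with `A`
inverse to `baseDeriv q₀ z.1`. -/
theorem hasMFDerivAt_totalSpaceMk {q₀ : Q} {z : E × E} (hz : z ∈ (natChart q₀).target) :
    HasMFDerivAt 𝓘(ℝ, E) 𝓘(ℝ, E).tangent
      (fun w : E => (⟨(extChartAt 𝓘(ℝ, E) q₀).symm z.1, w⟩ : TangentBundle 𝓘(ℝ, E) Q))
      (baseDeriv q₀ z.1 z.2) (show E →L[ℝ] E × E from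
        (natDeriv q₀ z).comp ((ContinuousLinearMap.inr ℝ E E).comp
          (chartFDeriv 𝓘(ℝ, E) q₀ ((extChartAt 𝓘(ℝ, E) q₀).symm z.1)))) := by
  have hz1 := mem_natChart_target.1 hz
  set q : Q := (extChartAt 𝓘(ℝ, E) q₀).symm z.1 with hq
  set A : E →L[ℝ] E := chartFDeriv 𝓘(ℝ, E) q₀ q with hA
  have hAB : ∀ w, A (baseDeriv q₀ z.1 w) = w := fun w =>
    DFunLike.congr_fun (chartFDeriv_comp_chartDeriv hz1) w
  have hBA : ∀ w, baseDeriv q₀ z.1 (A w) = w := fun w =>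
    DFunLike.congr_fun (chartDeriv_comp_chartFDeriv hz1) w
  have hfun : (fun w : E => (⟨q, w⟩ : TangentBundle 𝓘(ℝ, E) Q)) =
      (natChart q₀).symm ∘ fun w => (z.1, A w) := by
    funext w
    have hzw : (z.1, A w) ∈ (natChart q₀).target := mem_natChart_target.2 hz1
    rw [Function.comp_apply, natChart_symm_eq q₀ hzw]
    exact congrArg (TotalSpace.mk q) (hBA w).symm
  have hin : HasFDerivAt (fun w => (z.1, A w)) ((ContinuousLinearMap.inr ℝ E E).comp A)
      (baseDeriv q₀ z.1 z.2) := (hasFDerivAt_const z.1 _).prodMk A.hasFDerivAt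
  have hpt : (z.1, A (baseDeriv q₀ z.1 z.2)) = z := by rw [hAB]
  rw [hfun]
  refine HasMFDerivAt.comp _ ?_ hin.hasMFDerivAt
  rw [hpt]
  exact hasMFDerivAt_natChart_symm hz

/-- Guarantees that the `mfderiv` defining `verticalLift` is a genuine derivative and not the
default value `0`. -/
theorem hasMFDerivAt_verticalLift (v : TangentBundle 𝓘(ℝ, E) Q) :
    HasMFDerivAt 𝓘(ℝ, E) 𝓘(ℝ, E).tangent
      (fun w : E => (⟨v.proj, w⟩ : TangentBundle 𝓘(ℝ, E) Q)) v.snd (verticalLift v) := by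
  refine MDifferentiableAt.hasMFDerivAt ?_
  have hv : v ∈ (natChart (E := E) v.proj).source :=
    mem_extChartAt_source (I := 𝓘(ℝ, E).tangent) v
  have hz := (natChart v.proj).map_source hv
  have h1 := (hasMFDerivAt_totalSpaceMk hz).mdifferentiableAt
  have h2 : (⟨_, baseDeriv v.proj (natChart v.proj v).1 (natChart v.proj v).2⟩ :
      TangentBundle 𝓘(ℝ, E) Q) = v :=
    (natChart_symm_eq v.proj hz).symm.trans ((natChart v.proj).left_inv hv)
  have key : ∀ (a b : TangentBundle 𝓘(ℝ, E) Q), a = b →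
      MDifferentiableAt 𝓘(ℝ, E) 𝓘(ℝ, E).tangent
        (fun w : E => (⟨a.proj, w⟩ : TangentBundle 𝓘(ℝ, E) Q)) a.snd →
      MDifferentiableAt 𝓘(ℝ, E) 𝓘(ℝ, E).tangent
        (fun w : E => (⟨b.proj, w⟩ : TangentBundle 𝓘(ℝ, E) Q)) b.snd := by rintro a _ rfl h; exact h
  exact key _ _ h2 h1

theorem verticalLift_baseDeriv {q₀ : Q} {z : E × E} (hz : z ∈ (natChart q₀).target) (Y : E) :
    verticalLift ((natChart q₀).symm z) (baseDeriv q₀ z.1 Y) = natDeriv q₀ z (0, Y) := by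
  have h2 := DFunLike.congr_fun (hasMFDerivAt_totalSpaceMk hz).mfderiv (baseDeriv q₀ z.1 Y)
  have h3 : verticalLift ((natChart q₀).symm z) (baseDeriv q₀ z.1 Y) =
      mfderiv 𝓘(ℝ, E) 𝓘(ℝ, E).tangent
      (fun w : E => (⟨(extChartAt 𝓘(ℝ, E) q₀).symm z.1, w⟩ : TangentBundle 𝓘(ℝ, E) Q))
        (baseDeriv q₀ z.1 z.2) (baseDeriv q₀ z.1 Y) := by
    rw [natChart_symm_eq q₀ hz]; rfl
  refine h3.trans (h2.trans (congrArg (fun w => natDeriv q₀ z (0, w)) ?_))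
  exact DFunLike.congr_fun (chartFDeriv_comp_chartDeriv (mem_natChart_target.1 hz)) Y

theorem verticalEndo_natDeriv {q₀ : Q} {z : E × E} (hz : z ∈ (natChart q₀).target) (X : E × E) :
    verticalEndo ((natChart q₀).symm z) (natDeriv q₀ z X) = natDeriv q₀ z (0, X.1) :=
  (congrArg (verticalLift ((natChart q₀).symm z)) (tangentProj_natDeriv hz X)).trans
    (verticalLift_baseDeriv hz X.1)

theorem dFun_natDeriv {L : TangentBundle 𝓘(ℝ, E) Q → ℝ} {q₀ : Q} {z : E × E}
    (hz : z ∈ (natChart q₀).target)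
    (hL : ContMDiffAt 𝓘(ℝ, E).tangent 𝓘(ℝ, ℝ) ∞ L ((natChart q₀).symm z)) (X : E × E) :
    dFun L ((natChart q₀).symm z) (natDeriv q₀ z X) =
      fderiv ℝ (fun y => L ((natChart q₀).symm y)) z X := by
  have h1 := (hL.mdifferentiableAt (by simp)).hasMFDerivAt.comp z (hasMFDerivAt_natChart_symm hz)
  have h2 : HasFDerivAt (fun y => L ((natChart q₀).symm y))
      ((show E × E →L[ℝ] ℝ from dFun L ((natChart q₀).symm z)).comp (natDeriv q₀ z)) z :=
    hasMFDerivAt_iff_hasFDerivAt.1 h1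
  rw [h2.fderiv]
  rfl

theorem contDiffOn_comp_natChart_symm {L : TangentBundle 𝓘(ℝ, E) Q → ℝ}
    (hL : ContMDiff 𝓘(ℝ, E).tangent 𝓘(ℝ, ℝ) ∞ L) (q₀ : Q) :
    ContDiffOn ℝ ∞ (fun y => L ((natChart q₀).symm y)) (natChart q₀).target := fun z hz =>
  (contMDiffAt_iff_contDiffAt.1
    (hL.contMDiffAt.comp z (contMDiffAt_natChart_symm hz))).contDiffWithinAt

/-- An external force, written in the natural chart at `q₀`. -/
def localForce (F : (v : TangentBundle 𝓘(ℝ, E) Q) → TangentSpace 𝓘(ℝ, E) v.proj →L[ℝ] ℝ)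
    (q₀ : Q) (z : E × E) : E →L[ℝ] ℝ :=
  (show E →L[ℝ] ℝ from F ((natChart q₀).symm z)).comp (baseDeriv q₀ z.1)

/-- The trivialization of the cotangent bundle at `q₀` precomposes a covector with the inverse
tangent trivialization, which is `baseDeriv`. Hence `localForce` is exactly the fibre component of
the smooth map `F`. -/
theorem contDiffOn_localForce
    {F : (v : TangentBundle 𝓘(ℝ, E) Q) → TangentSpace 𝓘(ℝ, E) v.proj →L[ℝ] ℝ}
    (hF : IsSmoothForce F) (q₀ : Q) : ContDiffOn ℝ ∞ (localForce F q₀) (natChart q₀).target := by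
  intro z hz
  have : IsManifold 𝓘(ℝ, E) 1 Q := .of_le (n := ∞) (by simp)
  have hbase : ∀ y ∈ (natChart (E := E) q₀).target,
      (extChartAt 𝓘(ℝ, E) q₀).symm y.1 ∈ (chartAt E q₀).source := fun y hy => by
    have := (extChartAt 𝓘(ℝ, E) q₀).map_target (mem_natChart_target.1 hy)
    rwa [extChartAt_source] at this
  have h1 := (hF.contMDiffAt (x := (natChart q₀).symm z)).comp z (contMDiffAt_natChart_symm hz)
  have h2 := (Trivialization.contMDiffAt_iff (IB := 𝓘(ℝ, E)) (n := ∞)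
    (e := trivializationAt (E →L[ℝ] ℝ) (fun q : Q => TangentSpace 𝓘(ℝ, E) q →L[ℝ] ℝ) q₀) 
    (f := (fun v : TangentBundle 𝓘(ℝ, E) Q =>
      TotalSpace.mk' (E →L[ℝ] ℝ) (E := fun q : Q => TangentSpace 𝓘(ℝ, E) q →L[ℝ] ℝ)
        v.proj (F v)) ∘ (natChart q₀).symm) (x₀ := z) (by 
      rw [hom_trivializationAt_source]
      exact ⟨hbase z hz, mem_univ _⟩)).1 h1
  refine ((contMDiffAt_iff_contDiffAt.1 h2.2).congr_of_eventuallyEq ?_).contDiffWithinAt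
  filter_upwards [(isOpen_natChart_target q₀).mem_nhds hz] with y hy
  have hS := TangentBundle.symmL_trivializationAt (I := 𝓘(ℝ, E)) (hbase y hy)
  rw [(extChartAt 𝓘(ℝ, E) q₀).right_inv (mem_natChart_target.1 hy), modelWithCornersSelf_coe,
    range_id, mfderivWithin_univ] at hS
  ext w
  rw [Function.comp_apply, hom_trivializationAt_apply]
  change F ((natChart q₀).symm y) (baseDeriv q₀ y.1 w) =
    Trivialization.continuousLinearMapAt ℝ (trivializationAt ℝ (Bundle.Trivial Q ℝ) q₀)
      ((natChart q₀).symm y).proj (F ((natChart q₀).symm y)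
        (Trivialization.symmL ℝ (trivializationAt E (TangentSpace 𝓘(ℝ, E)) q₀)
          ((extChartAt 𝓘(ℝ, E) q₀).symm y.1) w))
  rw [hS]
  exact (DFunLike.congr_fun (Bundle.Trivial.continuousLinearMapAt_trivialization ℝ Q ℝ _) _).symm
-- Needed for uniqueness of integral curves in `TQ`. Vectors over one point are separated in a
-- natural chart, vectors over distinct points by the projection.
instance [T2Space Q] : T2Space (TangentBundle 𝓘(ℝ, E) Q) := by
  refine ⟨fun u v huv => ?_⟩
  by_cases h : u.proj = v.proj
  · have hu : u ∈ (natChart u.proj).source := mem_natChart_source.2 (mem_extChartAt_source _)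
    have hv : v ∈ (natChart u.proj).source :=
      mem_natChart_source.2 (h ▸ mem_extChartAt_source (I := 𝓘(ℝ, E)) _)
    obtain ⟨A, B, hA, hB, huA, hvB, hAB⟩ :=
      t2_separation fun h' => huv ((natChart u.proj).injOn hu hv h')
    have hc : ContinuousOn (natChart (E := E) u.proj) (natChart (E := E) u.proj).source :=
      continuousOn_extChartAt _
    refine ⟨_, _, hc.isOpen_inter_preimage (isOpen_natChart_source _) hA,
      hc.isOpen_inter_preimage (isOpen_natChart_source _) hB, ⟨hu, huA⟩, ⟨hv, hvB⟩, ?_⟩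
    exact (hAB.preimage _).mono inter_subset_right inter_subset_right
  · obtain ⟨A, B, hA, hB, huA, hvB, hAB⟩ := t2_separation h
    have hc : Continuous (fun u : TangentBundle 𝓘(ℝ, E) Q => u.proj) :=
      FiberBundle.continuous_proj E (TangentSpace 𝓘(ℝ, E) : Q → Type _)
    exact ⟨_, _, hA.preimage hc, hB.preimage hc, huA, hvB, hAB.preimage _⟩

end NaturalCharts

/-! ### The forced Euler-Lagrange equations in coordinates. -/

section FlatLagrangian

variable {E : Type*} [NormedAddCommGroup E] [NormedSpace ℝ E]

/-- The momentum `∂ℓ/∂y` of a Lagrangian `ℓ(x, y)` in coordinates. -/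
def localMomentum (ℓ : E × E → ℝ) (z : E × E) : E →L[ℝ] ℝ :=
  (fderiv ℝ ℓ z).comp (ContinuousLinearMap.inr ℝ E E)

/-- The fibre Hessian `∂²ℓ/∂y∂y` of a Lagrangian `ℓ(x, y)` in coordinates. -/
def localHessian (ℓ : E × E → ℝ) (z : E × E) : E →L[ℝ] E →L[ℝ] ℝ :=
  (fderiv ℝ (localMomentum ℓ) z).comp (ContinuousLinearMap.inr ℝ E E)

/-- The forced Euler-Lagrange vector field in coordinates. -/
def localField (ℓ : E × E → ℝ) (f : E × E → E →L[ℝ] ℝ) (z : E × E) : E × E :=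
  (z.2, (localHessian ℓ z).inverse
    ((fderiv ℝ ℓ z).comp (ContinuousLinearMap.inl ℝ E E) + f z -
      fderiv ℝ (localMomentum ℓ) z (z.2, 0)))

variable {ℓ : E × E → ℝ} {z : E × E}

theorem contDiffAt_localMomentum (hℓ : ContDiffAt ℝ ∞ ℓ z) :
    ContDiffAt ℝ ∞ (localMomentum ℓ) z :=
  (hℓ.fderiv_right (m := ∞) (by simp)).clm_comp contDiffAt_const

theorem hasFDerivAt_localMomentum (hℓ : ContDiffAt ℝ ∞ ℓ z) :
    HasFDerivAt (localMomentum ℓ) (fderiv ℝ (localMomentum ℓ) z) z :=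
  ((contDiffAt_localMomentum hℓ).differentiableAt (by simp)).hasFDerivAt

theorem fderiv_localMomentum_apply (hℓ : ContDiffAt ℝ ∞ ℓ z) (X : E × E) (w : E) :
    fderiv ℝ (localMomentum ℓ) z X w = fderiv ℝ (fderiv ℝ ℓ) z X (0, w) := by
  have h1 : HasFDerivAt (fderiv ℝ ℓ) (fderiv ℝ (fderiv ℝ ℓ) z) z :=
    ((hℓ.fderiv_right (m := ∞) (by simp)).differentiableAt (by simp)).hasFDerivAt
  have h2 := h1.clm_comp (hasFDerivAt_const (ContinuousLinearMap.inr ℝ E E) z)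
  have h3 : HasFDerivAt (localMomentum ℓ) _ z := h2
  rw [h3.fderiv]
  simp

theorem localHessian_symm (hℓ : ContDiffAt ℝ ∞ ℓ z) (u w : E) :
    localHessian ℓ z u w = localHessian ℓ z w u := by
  have hs : IsSymmSndFDerivAt ℝ ℓ z := hℓ.isSymmSndFDerivAt
    (by simp only [minSmoothness_of_isRCLikeNormedField]; exact WithTop.coe_le_coe.2 le_top)
  change fderiv ℝ (localMomentum ℓ) z (0, u) w = fderiv ℝ (localMomentum ℓ) z (0, w) u
  rw [fderiv_localMomentum_apply hℓ, fderiv_localMomentum_apply hℓ, hs.eq]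

/-- The Euler-Lagrange equations `i_a ω = dE - f` in coordinates. -/
theorem symplectic_eq_iff (hℓ : ContDiffAt ℝ ∞ ℓ z)
    (hH : Function.Injective (localHessian ℓ z)) (f : E →L[ℝ] ℝ) (a : E × E) :
    (∀ Y : E × E, -(fderiv ℝ (localMomentum ℓ) z a Y.1 - fderiv ℝ (localMomentum ℓ) z Y a.1) =
      fderiv ℝ (localMomentum ℓ) z Y z.2 - fderiv ℝ ℓ z (Y.1, 0) - f Y.1) ↔
    a.1 = z.2 ∧ ∀ w, fderiv ℝ (localMomentum ℓ) z a w = fderiv ℝ ℓ z (w, 0) + f w := by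
  constructor
  · intro h
    have h1 : a.1 = z.2 := by
      -- Vertical test vectors `(0, y)` give the second-order condition, by injectivity and symmetry
      -- of the Hessian; horizontal ones `(w, 0)` then give the momentum balance.
      refine hH (ContinuousLinearMap.ext fun y => ?_)
      rw [localHessian_symm hℓ, localHessian_symm hℓ z.2]
      have := h (0, y)
      simpa [localHessian, Prod.mk_zero_zero] using this
    refine ⟨h1, fun w => ?_⟩
    have := h (w, 0)
    rw [h1] at this
    simp only at this
    linarith
  · rintro ⟨h1, h2⟩ Y
    rw [h1, h2]
    ring

/-- The form vanishes on pairs of vertical vectors and pairs vertical with horizontal ones through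
the Hessian. So vertical tests kill `a.1`, and then horizontal tests kill `a.2`. -/
theorem symplectic_nondegenerate (hℓ : ContDiffAt ℝ ∞ ℓ z)
    (hH : Function.Injective (localHessian ℓ z)) (a : E × E)
    (h : ∀ Y : E × E,
      fderiv ℝ (localMomentum ℓ) z a Y.1 - fderiv ℝ (localMomentum ℓ) z Y a.1 = 0) : a = 0 := by
  have h1 : a.1 = 0 := by
    refine hH (ContinuousLinearMap.ext fun y => ?_)
    rw [localHessian_symm hℓ]
    simpa [localHessian, Prod.mk_zero_zero] using h (0, y)
  have h2 : a.2 = 0 := by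
    refine hH (ContinuousLinearMap.ext fun y => ?_)
    have h3 := h (y, 0)
    have h4 : a = (0, a.2) := Prod.ext h1 rfl
    rw [h1, map_zero, sub_zero, h4] at h3
    simpa [localHessian, Prod.mk_zero_zero] using h3
  exact Prod.ext h1 h2

variable [FiniteDimensional ℝ E]

theorem exists_localHessian_equiv (hH : Function.Injective (localHessian ℓ z)) :
    ∃ e : E ≃L[ℝ] (E →L[ℝ] ℝ), (e : E →L[ℝ] E →L[ℝ] ℝ) = localHessian ℓ z := by
  have hdim : Module.finrank ℝ E = Module.finrank ℝ (E →L[ℝ] ℝ) := by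
    rw [← (LinearMap.toContinuousLinearMap (𝕜 := ℝ) (E := E) (F' := ℝ)).finrank_eq]
    exact (Subspace.dual_finrank_eq (K := ℝ) (V := E)).symm
  refine ⟨(LinearEquiv.ofInjectiveOfFinrankEq (localHessian ℓ z).toLinearMap hH
    hdim).toContinuousLinearEquiv, ?_⟩
  ext; rfl

theorem localHessian_inverse_apply (hH : Function.Injective (localHessian ℓ z)) (β : E →L[ℝ] ℝ) :
    localHessian ℓ z ((localHessian ℓ z).inverse β) = β := by
  obtain ⟨e, he⟩ := exists_localHessian_equiv hH
  rw [← he, ContinuousLinearMap.inverse_equiv]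
  exact e.apply_symm_apply β

theorem fderiv_localMomentum_localField (hH : Function.Injective (localHessian ℓ z))
    (f : E × E → E →L[ℝ] ℝ) (w : E) :
    fderiv ℝ (localMomentum ℓ) z (localField ℓ f z) w = fderiv ℝ ℓ z (w, 0) + f z w := by
  have h1 : localField ℓ f z = (z.2, 0) + (0, (localField ℓ f z).2) := by
    simp [localField]
  have h2 : fderiv ℝ (localMomentum ℓ) z (0, (localField ℓ f z).2) =
      (fderiv ℝ ℓ z).comp (ContinuousLinearMap.inl ℝ E E) + f z -
      fderiv ℝ (localMomentum ℓ) z (z.2, 0) := localHessian_inverse_apply hH _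
  rw [h1, map_add, h2]
  simp

/-- Inversion of operators is smooth at the Hessian, which is an isomorphism because it is injective
between spaces of equal finite dimension. -/
theorem contDiffAt_localField (hℓ : ContDiffAt ℝ ∞ ℓ z)
    (hH : Function.Injective (localHessian ℓ z)) {f : E × E → E →L[ℝ] ℝ}
    (hf : ContDiffAt ℝ ∞ f z) : ContDiffAt ℝ ∞ (localField ℓ f) z := by
  have hP := contDiffAt_localMomentum hℓ
  have hDP : ContDiffAt ℝ ∞ (fderiv ℝ (localMomentum ℓ)) z := hP.fderiv_right (m := ∞) (by simp)
  have hHs : ContDiffAt ℝ ∞ (localHessian ℓ) z := hDP.clm_comp contDiffAt_const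
  obtain ⟨e, he⟩ := exists_localHessian_equiv hH
  have hinv : ContDiffAt ℝ ∞ (fun y => (localHessian ℓ y).inverse) z := by
    refine ContDiffAt.comp z (g := ContinuousLinearMap.inverse) ?_ hHs
    rw [← he]
    exact contDiffAt_map_inverse e
  refine contDiffAt_snd.prodMk (hinv.clm_apply (ContDiffAt.sub (ContDiffAt.add ?_ hf) ?_))
  · exact (hℓ.fderiv_right (m := ∞) (by simp)).clm_comp contDiffAt_const
  · exact hDP.clm_apply (contDiffAt_snd.prodMk contDiffAt_const)

end FlatLagrangian

/-! ### The forced Lagrangian vector field in natural charts. -/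

section ForcedField

variable {E : Type*} [NormedAddCommGroup E] [NormedSpace ℝ E]
  {Q : Type*} [TopologicalSpace Q] [ChartedSpace E Q] [IsManifold 𝓘(ℝ, E) ∞ Q]

/-- A Lagrangian, written in the natural chart at `q₀`. -/
def localLagrangian (L : TangentBundle 𝓘(ℝ, E) Q → ℝ) (q₀ : Q) (y : E × E) : ℝ :=
  L ((natChart q₀).symm y)

/-- The Poincaré-Cartan one-form `S^* dL`. -/
def lagrangeForm (L : TangentBundle 𝓘(ℝ, E) Q → ℝ) (v : TangentBundle 𝓘(ℝ, E) Q) :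
    TangentSpace 𝓘(ℝ, E).tangent v →L[ℝ] ℝ :=
  (dFun L v).comp (verticalEndo v)

variable {L : TangentBundle 𝓘(ℝ, E) Q → ℝ} {q₀ : Q} {z : E × E}

theorem contDiffAt_localLagrangian (hL : ContMDiff 𝓘(ℝ, E).tangent 𝓘(ℝ, ℝ) ∞ L)
    (hz : z ∈ (natChart q₀).target) : ContDiffAt ℝ ∞ (localLagrangian L q₀) z :=
  (contDiffOn_comp_natChart_symm hL q₀).contDiffAt ((isOpen_natChart_target q₀).mem_nhds hz)

theorem lagrangeForm_natDeriv (hL : ContMDiff 𝓘(ℝ, E).tangent 𝓘(ℝ, ℝ) ∞ L)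
    (hz : z ∈ (natChart q₀).target) (X : E × E) :
    lagrangeForm L ((natChart q₀).symm z) (natDeriv q₀ z X) =
      localMomentum (localLagrangian L q₀) z X.1 :=
  (congrArg (dFun L ((natChart q₀).symm z)) (verticalEndo_natDeriv hz X)).trans
    (dFun_natDeriv hz hL.contMDiffAt (0, X.1))

theorem localForm_lagrangeForm (hL : ContMDiff 𝓘(ℝ, E).tangent 𝓘(ℝ, ℝ) ∞ L)
    (hz : z ∈ (natChart q₀).target) :
    localForm 𝓘(ℝ, E).tangent (lagrangeForm L) (⟨q₀, 0⟩ : TangentBundle 𝓘(ℝ, E) Q) =ᶠ[𝓝 z]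
      fun y => (localMomentum (localLagrangian L q₀) y).comp (ContinuousLinearMap.fst ℝ E E) := by
  filter_upwards [(isOpen_natChart_target q₀).mem_nhds hz] with y hy
  exact ContinuousLinearMap.ext fun X => lagrangeForm_natDeriv hL hy X

/-- In natural coordinates `S^* dL` is `∂ℓ/∂y dx`, and chart independence of the exterior derivative
allows one fixed chart to be used at all of its points. -/
theorem poincareCartan_natDeriv (hL : ContMDiff 𝓘(ℝ, E).tangent 𝓘(ℝ, ℝ) ∞ L)
    (hz : z ∈ (natChart q₀).target) (X Y : E × E) :
    poincareCartan L ((natChart q₀).symm z) (natDeriv q₀ z X) (natDeriv q₀ z Y) =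
      -(fderiv ℝ (localMomentum (localLagrangian L q₀)) z X Y.1 -
        fderiv ℝ (localMomentum (localLagrangian L q₀)) z Y X.1) := by
  have hev := localForm_lagrangeForm hL hz
  have hP := (hasFDerivAt_localMomentum (contDiffAt_localLagrangian hL hz)).clm_comp
    (hasFDerivAt_const (ContinuousLinearMap.fst ℝ E E) z)
  have hθ := hP.congr_of_eventuallyEq hev
  have h1 := extDerivOneForm_apply_chartDeriv (J := 𝓘(ℝ, E).tangent) (lagrangeForm L)
    (⟨q₀, 0⟩ : TangentBundle 𝓘(ℝ, E) Q) hz hθ.differentiableAt X Y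
  refine (congrArg Neg.neg h1).trans ?_
  rw [hθ.fderiv]
  simp

theorem energy_natChart_symm (hL : ContMDiff 𝓘(ℝ, E).tangent 𝓘(ℝ, ℝ) ∞ L)
    (hz : z ∈ (natChart q₀).target) :
    energy L ((natChart q₀).symm z) =
      localMomentum (localLagrangian L q₀) z z.2 - localLagrangian L q₀ z := by
  have h1 : ((natChart q₀).symm z).snd = baseDeriv q₀ z.1 z.2 := by
    rw [natChart_symm_eq q₀ hz]
  have h2 : verticalLift ((natChart q₀).symm z) ((natChart q₀).symm z).snd =
      natDeriv q₀ z (0, z.2) :=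
    (congrArg (verticalLift ((natChart q₀).symm z)) h1).trans (verticalLift_baseDeriv hz z.2)
  exact congrArg (· - L ((natChart q₀).symm z))
    ((congrArg (dFun L ((natChart q₀).symm z)) h2).trans
      (dFun_natDeriv hz hL.contMDiffAt (0, z.2)))

/-- Differentiate `⟨∂ℓ/∂y, y⟩ - ℓ`: the fibre derivative of `ℓ` cancels the term in which `y` is
varied. -/
theorem hasFDerivAt_energy (hL : ContMDiff 𝓘(ℝ, E).tangent 𝓘(ℝ, ℝ) ∞ L)
    (hz : z ∈ (natChart q₀).target) :
    ContDiffAt ℝ ∞ (fun y => energy L ((natChart q₀).symm y)) z ∧ ∀ Y : E × E,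
      fderiv ℝ (fun y => energy L ((natChart q₀).symm y)) z Y =
        fderiv ℝ (localMomentum (localLagrangian L q₀)) z Y z.2 -
          fderiv ℝ (localLagrangian L q₀) z (Y.1, 0) := by
  have hℓ := contDiffAt_localLagrangian hL hz
  have hP := contDiffAt_localMomentum hℓ
  have hev : (fun y => energy L ((natChart q₀).symm y)) =ᶠ[𝓝 z]
      fun y => localMomentum (localLagrangian L q₀) y y.2 - localLagrangian L q₀ y := by
    filter_upwards [(isOpen_natChart_target q₀).mem_nhds hz] with y hy
    exact energy_natChart_symm hL hy
  refine ⟨((hP.clm_apply contDiffAt_snd).sub hℓ).congr_of_eventuallyEq hev, fun Y => ?_⟩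
  have hd := ((hasFDerivAt_localMomentum hℓ).clm_apply (hasFDerivAt_snd (p := z))).sub
    (hℓ.differentiableAt (by simp)).hasFDerivAt
  rw [(hd.congr_of_eventuallyEq hev).fderiv]
  have hY : Y = (Y.1, 0) + (0, Y.2) := by simp
  have h2 : fderiv ℝ (localLagrangian L q₀) z Y = fderiv ℝ (localLagrangian L q₀) z (Y.1, 0) +
      fderiv ℝ (localLagrangian L q₀) z (0, Y.2) := by rw [← map_add, ← hY]
  simp only [sub_apply, add_apply, ContinuousLinearMap.comp_apply, ContinuousLinearMap.flip_apply,
    h2, ContinuousLinearMap.coe_snd', localMomentum, ContinuousLinearMap.inr_apply]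
  ring

theorem contMDiffAt_of_comp_natChart_symm {g : TangentBundle 𝓘(ℝ, E) Q → ℝ}
    (hz : z ∈ (natChart q₀).target) (hg : ContDiffAt ℝ ∞ (fun y => g ((natChart q₀).symm y)) z) :
    ContMDiffAt 𝓘(ℝ, E).tangent 𝓘(ℝ, ℝ) ∞ g ((natChart q₀).symm z) := by
  have hs : (natChart q₀).symm z ∈ (natChart (E := E) q₀).source := (natChart q₀).map_target hz
  have h1 : ContDiffAt ℝ ∞ (fun y => g ((natChart q₀).symm y))
      (natChart q₀ ((natChart q₀).symm z)) := by rwa [(natChart q₀).right_inv hz]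
  refine (h1.contMDiffAt.comp _ (contMDiffAt_natChart hs)).congr_of_eventuallyEq ?_
  filter_upwards [(isOpen_natChart_source q₀).mem_nhds hs] with u hu
  exact congrArg g ((natChart q₀).left_inv hu).symm

theorem dFun_energy_natDeriv (hL : ContMDiff 𝓘(ℝ, E).tangent 𝓘(ℝ, ℝ) ∞ L)
    (hz : z ∈ (natChart q₀).target) (Y : E × E) :
    dFun (energy L) ((natChart q₀).symm z) (natDeriv q₀ z Y) =
      fderiv ℝ (localMomentum (localLagrangian L q₀)) z Y z.2 -
        fderiv ℝ (localLagrangian L q₀) z (Y.1, 0) :=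
  (dFun_natDeriv hz (contMDiffAt_of_comp_natChart_symm hz (hasFDerivAt_energy hL hz).1) Y).trans
    ((hasFDerivAt_energy hL hz).2 Y)

theorem fderiv_fibre (hL : ContMDiff 𝓘(ℝ, E).tangent 𝓘(ℝ, ℝ) ∞ L)
    (hz : z ∈ (natChart q₀).target) (w : E) :
    HasFDerivAt (fun w : E => L ⟨(extChartAt 𝓘(ℝ, E) q₀).symm z.1, w⟩)
      ((localMomentum (localLagrangian L q₀)
        (z.1, chartFDeriv 𝓘(ℝ, E) q₀ ((extChartAt 𝓘(ℝ, E) q₀).symm z.1) w)).comp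
          (chartFDeriv 𝓘(ℝ, E) q₀ ((extChartAt 𝓘(ℝ, E) q₀).symm z.1))) w := by
  have hz1 := mem_natChart_target.1 hz
  set q : Q := (extChartAt 𝓘(ℝ, E) q₀).symm z.1 with hq
  set A : E →L[ℝ] E := chartFDeriv 𝓘(ℝ, E) q₀ q with hA
  have hBA : ∀ w, baseDeriv q₀ z.1 (A w) = w := fun w =>
    DFunLike.congr_fun (chartDeriv_comp_chartFDeriv hz1) w
  have hfun : (fun w : E => L ⟨q, w⟩) = localLagrangian L q₀ ∘ fun w => (z.1, A w) := by
    funext w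
    have hzw : (z.1, A w) ∈ (natChart q₀).target := mem_natChart_target.2 hz1
    rw [Function.comp_apply, localLagrangian, natChart_symm_eq q₀ hzw]
    exact congrArg (fun u => L (TotalSpace.mk q u)) (hBA w).symm
  have hin : HasFDerivAt (fun w => (z.1, A w)) ((ContinuousLinearMap.inr ℝ E E).comp A) w :=
    (hasFDerivAt_const z.1 _).prodMk A.hasFDerivAt
  rw [hfun]
  exact ((contDiffAt_localLagrangian hL (z := (z.1, A w))
    (mem_natChart_target.2 hz1)).differentiableAt (by simp)).hasFDerivAt.comp w hin

/-- The Hessian on the fibre and the one in natural coordinates are congruent through the linear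
isomorphism `A`. -/
theorem localHessian_injective (hL : ContMDiff 𝓘(ℝ, E).tangent 𝓘(ℝ, ℝ) ∞ L)
    (hLreg : IsRegularLagrangian L) (hz : z ∈ (natChart q₀).target) :
    Function.Injective (localHessian (localLagrangian L q₀) z) := by
  have hz1 := mem_natChart_target.1 hz
  have hreg := hLreg ((natChart q₀).symm z)
  rw [natChart_symm_eq q₀ hz] at hreg
  set q : Q := (extChartAt 𝓘(ℝ, E) q₀).symm z.1 with hq
  set A : E →L[ℝ] E := chartFDeriv 𝓘(ℝ, E) q₀ q with hA
  have hAB : ∀ w, A (baseDeriv q₀ z.1 w) = w := fun w =>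
    DFunLike.congr_fun (chartFDeriv_comp_chartDeriv hz1) w
  have h1 : fderiv ℝ (fun w : E => L ⟨q, w⟩) =
      fun w => (localMomentum (localLagrangian L q₀) (z.1, A w)).comp A :=
    funext fun w => (fderiv_fibre hL hz w).fderiv
  have hin : HasFDerivAt (fun w => (z.1, A w)) ((ContinuousLinearMap.inr ℝ E E).comp A)
      (baseDeriv q₀ z.1 z.2) := (hasFDerivAt_const z.1 _).prodMk A.hasFDerivAt
  have hP : HasFDerivAt (localMomentum (localLagrangian L q₀))
      (fderiv ℝ (localMomentum (localLagrangian L q₀)) z) (z.1, A (baseDeriv q₀ z.1 z.2)) := by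
    rw [hAB]
    exact hasFDerivAt_localMomentum (contDiffAt_localLagrangian hL hz)
  have h2 := (HasFDerivAt.comp (f := fun w => (z.1, A w)) (baseDeriv q₀ z.1 z.2) hP
    hin).clm_comp (hasFDerivAt_const A (baseDeriv q₀ z.1 z.2))
  have h3 : ∀ u w, fderiv ℝ (fderiv ℝ (fun w : E => L ⟨q, w⟩)) (baseDeriv q₀ z.1 z.2) u w =
      localHessian (localLagrangian L q₀) z (A u) (A w) := fun u w => by
    rw [h1]
    erw [h2.fderiv]
    simp [localHessian]
  intro y₁ y₂ hy
  have h4 : baseDeriv q₀ z.1 y₁ = baseDeriv q₀ z.1 y₂ :=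
    hreg (ContinuousLinearMap.ext fun w => by
      refine (h3 _ _).trans (Eq.trans ?_ (h3 _ _).symm)
      rw [hAB, hAB, hy])
  rw [← hAB y₁, h4, hAB]

theorem poincareCartan_injective (hL : ContMDiff 𝓘(ℝ, E).tangent 𝓘(ℝ, ℝ) ∞ L)
    (hLreg : IsRegularLagrangian L) (v : TangentBundle 𝓘(ℝ, E) Q) (X : E × E)
    (hX : poincareCartan L v X = 0) : X = 0 := by
  obtain ⟨q₀, z, hz, rfl⟩ : ∃ q₀ : Q, ∃ z ∈ (natChart q₀).target, (natChart q₀).symm z = v :=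
    ⟨v.proj, _, mem_extChartAt_target v, extChartAt_to_inv (I := 𝓘(ℝ, E).tangent) v⟩
  obtain ⟨a, rfl⟩ := (natDeriv_bijective hz).2 X
  have ha := symplectic_nondegenerate (contDiffAt_localLagrangian hL hz)
    (localHessian_injective hL hLreg hz) a fun Y => by
      have h1 := poincareCartan_natDeriv hL hz a Y
      have h2 : poincareCartan L ((natChart q₀).symm z) (natDeriv q₀ z a) (natDeriv q₀ z Y) = 0 :=
        DFunLike.congr_fun hX (natDeriv q₀ z Y)
      rw [h2] at h1
      linarith
  rw [ha, map_zero]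

theorem forced_equation_iff (hL : ContMDiff 𝓘(ℝ, E).tangent 𝓘(ℝ, ℝ) ∞ L)
    (hLreg : IsRegularLagrangian L) (hz : z ∈ (natChart q₀).target)
    (F : (v : TangentBundle 𝓘(ℝ, E) Q) → TangentSpace 𝓘(ℝ, E) v.proj →L[ℝ] ℝ) (a : E × E) :
    poincareCartan L ((natChart q₀).symm z) (natDeriv q₀ z a) =
      dFun (energy L) ((natChart q₀).symm z) -
        (F ((natChart q₀).symm z)).comp (tangentProj ((natChart q₀).symm z)) ↔
    a.1 = z.2 ∧ ∀ w, fderiv ℝ (localMomentum (localLagrangian L q₀)) z a w =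
      fderiv ℝ (localLagrangian L q₀) z (w, 0) + localForce F q₀ z w := by
  rw [← symplectic_eq_iff (contDiffAt_localLagrangian hL hz) (localHessian_injective hL hLreg hz)]
  have hF : ∀ Y : E × E, F ((natChart q₀).symm z)
      (tangentProj ((natChart q₀).symm z) (natDeriv q₀ z Y)) = localForce F q₀ z Y.1 := fun Y =>
    congrArg (F ((natChart q₀).symm z)) (tangentProj_natDeriv hz Y)
  constructor
  · intro h Y
    rw [← poincareCartan_natDeriv hL hz, ← dFun_energy_natDeriv hL hz, ← hF]
    exact DFunLike.congr_fun h (natDeriv q₀ z Y)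
  · intro h
    refine ContinuousLinearMap.ext fun Y' => ?_
    obtain ⟨Y, rfl⟩ := (natDeriv_bijective hz).2 Y'
    have := h Y
    rw [← poincareCartan_natDeriv hL hz, ← dFun_energy_natDeriv hL hz, ← hF] at this
    exact this

/-- The Poincaré-Cartan two-form at `v` as a linear map. -/
def poincareCartanLinear (L : TangentBundle 𝓘(ℝ, E) Q → ℝ) (v : TangentBundle 𝓘(ℝ, E) Q) :
    E × E →ₗ[ℝ] E × E →L[ℝ] ℝ :=
  let Θ := fderiv ℝ (localForm 𝓘(ℝ, E).tangent (lagrangeForm L) v)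
    (extChartAt 𝓘(ℝ, E).tangent v v);
  (-(Θ - Θ.flip) : E × E →L[ℝ] E × E →L[ℝ] ℝ).toLinearMap

/-- `poincareCartan` is a bare function of the vector; its linear version, definitionally equal to
it, turns the trivial kernel into uniqueness of solutions. -/
theorem poincareCartanLinear_injective (hL : ContMDiff 𝓘(ℝ, E).tangent 𝓘(ℝ, ℝ) ∞ L)
    (hLreg : IsRegularLagrangian L) (v : TangentBundle 𝓘(ℝ, E) Q) :
    Function.Injective (poincareCartanLinear L v) :=
  (injective_iff_map_eq_zero _).2 fun X hX => poincareCartan_injective hL hLreg v X hX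

theorem forced_equation_unique (hL : ContMDiff 𝓘(ℝ, E).tangent 𝓘(ℝ, ℝ) ∞ L)
    (hLreg : IsRegularLagrangian L) {v : TangentBundle 𝓘(ℝ, E) Q}
    {X Y : TangentSpace 𝓘(ℝ, E).tangent v} (h : poincareCartan L v X = poincareCartan L v Y) :
    X = Y :=
  poincareCartanLinear_injective hL hLreg v h

variable [FiniteDimensional ℝ E]

/-- The coordinate field solves the defining equation, so the default branch of `forcedField` never
occurs, and uniqueness identifies the chosen solution. -/
theorem forcedField_natChart_symm (hL : ContMDiff 𝓘(ℝ, E).tangent 𝓘(ℝ, ℝ) ∞ L)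
    (hLreg : IsRegularLagrangian L) (hz : z ∈ (natChart q₀).target)
    (F : (v : TangentBundle 𝓘(ℝ, E) Q) → TangentSpace 𝓘(ℝ, E) v.proj →L[ℝ] ℝ) :
    forcedField L F ((natChart q₀).symm z) =
      natDeriv q₀ z (localField (localLagrangian L q₀) (localForce F q₀) z) := by
  have hsol := (forced_equation_iff hL hLreg hz F
    (localField (localLagrangian L q₀) (localForce F q₀) z)).2
    ⟨rfl, fun w => fderiv_localMomentum_localField (localHessian_injective hL hLreg hz) _ w⟩
  have hex : ∃ X : TangentSpace 𝓘(ℝ, E).tangent ((natChart q₀).symm z),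
      poincareCartan L ((natChart q₀).symm z) X = dFun (energy L) ((natChart q₀).symm z) -
        (F ((natChart q₀).symm z)).comp (tangentProj ((natChart q₀).symm z)) := ⟨_, hsol⟩
  rw [forcedField, dif_pos hex]
  exact forced_equation_unique hL hLreg (hex.choose_spec.trans hsol.symm)

theorem contDiffAt_localField_natChart (hL : ContMDiff 𝓘(ℝ, E).tangent 𝓘(ℝ, ℝ) ∞ L)
    (hLreg : IsRegularLagrangian L)
    {F : (v : TangentBundle 𝓘(ℝ, E) Q) → TangentSpace 𝓘(ℝ, E) v.proj →L[ℝ] ℝ}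
    (hF : IsSmoothForce F) (hz : z ∈ (natChart q₀).target) :
    ContDiffAt ℝ ∞ (localField (localLagrangian L q₀) (localForce F q₀)) z :=
  contDiffAt_localField (contDiffAt_localLagrangian hL hz) (localHessian_injective hL hLreg hz)
    ((contDiffOn_localForce hF q₀).contDiffAt ((isOpen_natChart_target q₀).mem_nhds hz))

/-- Class `C¹` is what uniqueness of integral curves requires. The trivialization at `v` acts
through `natFDeriv` and turns the field into `localField`. -/
theorem contMDiff_forcedField (hL : ContMDiff 𝓘(ℝ, E).tangent 𝓘(ℝ, ℝ) ∞ L)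
    (hLreg : IsRegularLagrangian L)
    {F : (v : TangentBundle 𝓘(ℝ, E) Q) → TangentSpace 𝓘(ℝ, E) v.proj →L[ℝ] ℝ}
    (hF : IsSmoothForce F) :
    ContMDiff 𝓘(ℝ, E).tangent 𝓘(ℝ, E).tangent.tangent 1
      (fun v => (⟨v, forcedField L F v⟩ :
        TangentBundle 𝓘(ℝ, E).tangent (TangentBundle 𝓘(ℝ, E) Q))) := by
  intro v
  refine (Bundle.contMDiffAt_section v).2 ?_
  -- The preferred chart of `TQ` at `v` depends only on `v.proj`, so it is `natChart v.proj` by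
  -- definition.
  have hv : v ∈ (natChart v.proj).source := mem_extChartAt_source (I := 𝓘(ℝ, E).tangent) v
  have h1 := ((contDiffAt_localField_natChart hL hLreg hF
    ((natChart v.proj).map_source hv)).of_le (m := 1) (by simp)).contMDiffAt.comp v
    ((contMDiffAt_natChart hv).of_le (by simp))
  refine h1.congr_of_eventuallyEq ?_
  filter_upwards [(isOpen_natChart_source v.proj).mem_nhds hv] with u hu
  have hu' : u ∈ (chartAt (ModelProd E E) v).source := by
    have : u ∈ (extChartAt 𝓘(ℝ, E).tangent v).source := hu
    rwa [extChartAt_source] at this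
  have h2 := TangentBundle.continuousLinearMapAt_trivializationAt (I := 𝓘(ℝ, E).tangent) hu'
  have hut := (natChart v.proj).map_source hu
  have h3 := forcedField_natChart_symm hL hLreg hut F
  rw [(natChart v.proj).left_inv hu] at h3
  have h4 := natFDeriv_natDeriv hut
    (localField (localLagrangian L v.proj) (localForce F v.proj) (natChart v.proj u))
  rw [(natChart v.proj).left_inv hu] at h4
  have h5 : natFDeriv v.proj u (forcedField L F u) =
      localField (localLagrangian L v.proj) (localForce F v.proj) (natChart v.proj u) :=
    (congrArg (natFDeriv v.proj u) h3).trans h4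
  refine Eq.trans ?_ h5
  have h6 := DFunLike.congr_fun h2 (forcedField L F u)
  refine Eq.trans ?_ h6
  rw [Trivialization.continuousLinearMapAt_apply, Trivialization.linearMapAt_apply, if_pos]
  rwa [TangentBundle.trivializationAt_baseSet]

end ForcedField

/-! ### Flows on the tangent bundle. -/

section Flow

variable {E : Type*} [NormedAddCommGroup E] [NormedSpace ℝ E]
  {Q : Type*} [TopologicalSpace Q] [ChartedSpace E Q] [IsManifold 𝓘(ℝ, E) ∞ Q]
  {Γ : (v : TangentBundle 𝓘(ℝ, E) Q) → TangentSpace 𝓘(ℝ, E).tangent v}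

variable (Γ) in
/-- The forward flow of `Γ` through `v` is defined up to time `t`. -/
def HasFlowUpTo (t : ℝ) (v : TangentBundle 𝓘(ℝ, E) Q) : Prop :=
  ∃ (γ : ℝ → TangentBundle 𝓘(ℝ, E) Q) (a b : ℝ), a < 0 ∧ 0 < b ∧ t < b ∧ γ 0 = v ∧
    IsMIntegralCurveOn γ Γ (Ioo a b)

theorem hasFlowUpTo_of_mem_flowDomain {h : ℝ} (hh : 0 ≤ h) {v : TangentBundle 𝓘(ℝ, E) Q}
    (hv : v ∈ flowDomain Γ univ h) : HasFlowUpTo Γ h v := by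
  obtain ⟨γ, a, b, h0, ht, hγ0, -, hγ⟩ := hv h ⟨hh, le_rfl⟩
  exact ⟨γ, a, b, h0.1, h0.2, ht.2, hγ0, hγ⟩

theorem HasFlowUpTo.mono {s t : ℝ} {v : TangentBundle 𝓘(ℝ, E) Q} (h : HasFlowUpTo Γ t v)
    (hst : s ≤ t) : HasFlowUpTo Γ s v := by
  obtain ⟨γ, a, b, ha, hb, ht, h0, hγ⟩ := h
  exact ⟨γ, a, b, ha, hb, hst.trans_lt ht, h0, hγ⟩

variable [T2Space Q]

/-- The trajectory chosen in `flow` may change with the time `t`; uniqueness on the intersection of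
the two intervals makes the value independent of the choice. -/
theorem flow_eq_of_isMIntegralCurveOn
    (hΓ : ContMDiff 𝓘(ℝ, E).tangent 𝓘(ℝ, E).tangent.tangent 1
      (fun v => (⟨v, Γ v⟩ : TangentBundle 𝓘(ℝ, E).tangent (TangentBundle 𝓘(ℝ, E) Q))))
    {γ : ℝ → TangentBundle 𝓘(ℝ, E) Q} {a b t : ℝ} (h0 : 0 ∈ Ioo a b) (ht : t ∈ Ioo a b)
    (hγ : IsMIntegralCurveOn γ Γ (Ioo a b)) : flow Γ univ t (γ 0) = γ t := by
  have hex : ∃ γ', IsTrajectory Γ univ t (γ 0) γ' :=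
    ⟨γ, a, b, h0, ht, rfl, fun _ _ => mem_univ _, hγ⟩
  rw [flow, dif_pos hex]
  obtain ⟨a', b', h0', ht', hv, -, hγ'⟩ := hex.choose_spec
  have hmem : ∀ s, s ∈ Ioo a b → s ∈ Ioo a' b' → s ∈ Ioo (max a a') (min b b') := fun s h h' =>
    ⟨max_lt h.1 h'.1, lt_min h.2 h'.2⟩
  exact isMIntegralCurveOn_Ioo_eqOn_of_contMDiff_boundaryless (hmem 0 h0 h0') hΓ
    (hγ'.mono (Ioo_subset_Ioo (le_max_right _ _) (min_le_right _ _)))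
    (hγ.mono (Ioo_subset_Ioo (le_max_left _ _) (min_le_left _ _))) hv (hmem t ht ht')

theorem flow_add_of_isMIntegralCurveOn
    (hΓ : ContMDiff 𝓘(ℝ, E).tangent 𝓘(ℝ, E).tangent.tangent 1
      (fun v => (⟨v, Γ v⟩ : TangentBundle 𝓘(ℝ, E).tangent (TangentBundle 𝓘(ℝ, E) Q))))
    {γ : ℝ → TangentBundle 𝓘(ℝ, E) Q} {a b s τ : ℝ} (h0 : 0 ∈ Ioo a b) (hs : s ∈ Ioo a b)
    (hτ : τ + s ∈ Ioo a b) (hγ : IsMIntegralCurveOn γ Γ (Ioo a b)) :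
    flow Γ univ (τ + s) (γ 0) = flow Γ univ τ (flow Γ univ s (γ 0)) := by
  rw [flow_eq_of_isMIntegralCurveOn hΓ h0 hτ hγ, flow_eq_of_isMIntegralCurveOn hΓ h0 hs hγ]
  have h1 : IsMIntegralCurveOn (γ ∘ (· + s)) Γ (Ioo (a - s) (b - s)) :=
    (hγ.comp_add s).mono fun t ht => ⟨by linarith [ht.1], by linarith [ht.2]⟩
  have h2 := flow_eq_of_isMIntegralCurveOn hΓ (γ := γ ∘ (· + s)) (a := a - s) (b := b - s)
    (t := τ) ⟨by linarith [hs.1], by linarith [hs.2]⟩ ⟨by linarith [hτ.1], by linarith [hτ.2]⟩ h1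
  simp only [Function.comp_apply, zero_add] at h2
  exact h2.symm

theorem HasFlowUpTo.flow_add
    (hΓ : ContMDiff 𝓘(ℝ, E).tangent 𝓘(ℝ, E).tangent.tangent 1
      (fun v => (⟨v, Γ v⟩ : TangentBundle 𝓘(ℝ, E).tangent (TangentBundle 𝓘(ℝ, E) Q))))
    {s τ : ℝ} {v : TangentBundle 𝓘(ℝ, E) Q} (hs : 0 ≤ s) (hτ : 0 ≤ τ)
    (h : HasFlowUpTo Γ (τ + s) v) :
    flow Γ univ (τ + s) v = flow Γ univ τ (flow Γ univ s v) := by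
  obtain ⟨γ, a, b, ha, hb, ht, rfl, hγ⟩ := h
  exact flow_add_of_isMIntegralCurveOn hΓ ⟨ha, hb⟩ ⟨by linarith, by linarith⟩
    ⟨by linarith, ht⟩ hγ

theorem HasFlowUpTo.continuousOn_flow
    (hΓ : ContMDiff 𝓘(ℝ, E).tangent 𝓘(ℝ, E).tangent.tangent 1
      (fun v => (⟨v, Γ v⟩ : TangentBundle 𝓘(ℝ, E).tangent (TangentBundle 𝓘(ℝ, E) Q))))
    {t : ℝ} {v : TangentBundle 𝓘(ℝ, E) Q} (h : HasFlowUpTo Γ t v) :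
    ContinuousOn (fun τ => flow Γ univ τ v) (Icc 0 t) := by
  obtain ⟨γ, a, b, ha, hb, ht, rfl, hγ⟩ := h
  have hsub : Icc 0 t ⊆ Ioo a b := fun τ hτ => ⟨by linarith [hτ.1], by linarith [hτ.2]⟩
  refine ContinuousOn.congr (fun τ hτ => ?_) fun τ hτ =>
    flow_eq_of_isMIntegralCurveOn hΓ ⟨ha, hb⟩ (hsub hτ) hγ
  exact (hγ τ (hsub hτ)).continuousWithinAt.mono hsub

theorem HasFlowUpTo.flow_zero
    (hΓ : ContMDiff 𝓘(ℝ, E).tangent 𝓘(ℝ, E).tangent.tangent 1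
      (fun v => (⟨v, Γ v⟩ : TangentBundle 𝓘(ℝ, E).tangent (TangentBundle 𝓘(ℝ, E) Q))))
    {t : ℝ} {v : TangentBundle 𝓘(ℝ, E) Q} (h : HasFlowUpTo Γ t v) :
    flow Γ univ 0 v = v := by
  obtain ⟨γ, a, b, ha, hb, ht, rfl, hγ⟩ := h
  exact flow_eq_of_isMIntegralCurveOn hΓ ⟨ha, hb⟩ ⟨ha, hb⟩ hγ

end Flow

/-! ### Propagation of the first variation formula along trajectories. -/

section VariationIdentity

variable {E : Type*} [NormedAddCommGroup E] [NormedSpace ℝ E]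
  {Q : Type*} [TopologicalSpace Q] [ChartedSpace E Q] [IsManifold 𝓘(ℝ, E) ∞ Q]
  (L : TangentBundle 𝓘(ℝ, E) Q → ℝ)
  (F : (v : TangentBundle 𝓘(ℝ, E) Q) → TangentSpace 𝓘(ℝ, E) v.proj →L[ℝ] ℝ)
  (Γ : (v : TangentBundle 𝓘(ℝ, E) Q) → TangentSpace 𝓘(ℝ, E).tangent v)

/-- The action of `L` along the trajectory of `Γ` through `v` up to time `t`. -/
def flowAction (t : ℝ) (v : TangentBundle 𝓘(ℝ, E) Q) : ℝ :=
  ∫ τ in (0 : ℝ)..t, L (flow Γ univ τ v)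

/-- The derivative of the time-`t` flow of `Γ` at `v`. -/
def flowDeriv (t : ℝ) (v : TangentBundle 𝓘(ℝ, E) Q) : E × E →L[ℝ] E × E :=
  mfderiv 𝓘(ℝ, E).tangent 𝓘(ℝ, E).tangent (flow Γ univ t) v

/-- The force `F`, evaluated along the variation of the flow of `Γ` generated by `X`. -/
def flowWork (v : TangentBundle 𝓘(ℝ, E) Q) (X : E × E) (t : ℝ) : ℝ :=
  F (flow Γ univ t v) (tangentProj (flow Γ univ t v) (flowDeriv Γ t v X))

/-- The flow of `Γ` is differentiable at `v` up to time `t`, and satisfies the first variation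
formula for the action of `L` with the force `F`. -/
structure SatisfiesVariationFormula (v : TangentBundle 𝓘(ℝ, E) Q) (t : ℝ) : Prop where
  mdifferentiableAt : ∀ τ ∈ Icc 0 t,
    MDifferentiableAt 𝓘(ℝ, E).tangent 𝓘(ℝ, E).tangent (flow Γ univ τ) v
  action : MDifferentiableAt 𝓘(ℝ, E).tangent 𝓘(ℝ, ℝ) (flowAction L Γ t) v
  integrable : ∀ X, IntervalIntegrable (flowWork F Γ v X) MeasureTheory.volume 0 t
  formula : ∀ X : E × E, dFun (flowAction L Γ t) v X + ∫ τ in (0 : ℝ)..t, flowWork F Γ v X τ =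
    lagrangeForm L (flow Γ univ t v) (flowDeriv Γ t v X) - lagrangeForm L v X

variable {L F Γ} [T2Space Q]

/-- Near `v` the flow at time `t + s` is a composite, so derivatives compose by the chain rule while
action and work add up. The boundary terms at the intermediate point cancel. The flow must exist on
a neighbourhood of `v` for these identities to be differentiated. -/
theorem SatisfiesVariationFormula.add (hLc : Continuous L)
    (hΓ : ContMDiff 𝓘(ℝ, E).tangent 𝓘(ℝ, E).tangent.tangent 1
      (fun v => (⟨v, Γ v⟩ : TangentBundle 𝓘(ℝ, E).tangent (TangentBundle 𝓘(ℝ, E) Q))))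
    {v : TangentBundle 𝓘(ℝ, E) Q} {s t : ℝ} (hs : 0 ≤ s) (ht : 0 ≤ t)
    (hv : ∀ᶠ u in 𝓝 v, HasFlowUpTo Γ (t + s) u) (h₁ : SatisfiesVariationFormula L F Γ v s)
    (h₂ : SatisfiesVariationFormula L F Γ (flow Γ univ s v) t) :
    SatisfiesVariationFormula L F Γ v (t + s) := by
  have hS := h₁.mdifferentiableAt s ⟨hs, le_rfl⟩
  have hadd : ∀ τ ∈ Icc 0 t, flow Γ univ (τ + s) =ᶠ[𝓝 v] flow Γ univ τ ∘ flow Γ univ s :=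
    fun τ hτ => by
      filter_upwards [hv] with u hu
      exact (hu.mono (by linarith [hτ.2])).flow_add hΓ hs hτ.1
  have hder : ∀ τ ∈ Icc 0 t, HasMFDerivAt 𝓘(ℝ, E).tangent 𝓘(ℝ, E).tangent (flow Γ univ (τ + s)) v
      ((flowDeriv (E := E) Γ τ (flow Γ univ s v)).comp (flowDeriv Γ s v)) := fun τ hτ =>
    ((h₂.mdifferentiableAt τ hτ).hasMFDerivAt.comp v hS.hasMFDerivAt).congr_of_eventuallyEq
      (hadd τ hτ)
  have hflow : ∀ τ ∈ Icc 0 t, flow Γ univ (τ + s) v = flow Γ univ τ (flow Γ univ s v) :=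
    fun τ hτ => (hadd τ hτ).self_of_nhds
  have hfd : ∀ τ ∈ Icc 0 t, flowDeriv Γ (τ + s) v =
      (flowDeriv Γ τ (flow Γ univ s v)).comp (flowDeriv Γ s v) := fun τ hτ => (hder τ hτ).mfderiv
  have hwork : ∀ X, ∀ τ ∈ Icc 0 t, flowWork F Γ v X (τ + s) =
      flowWork F Γ (flow Γ univ s v) (flowDeriv Γ s v X) τ := fun X τ hτ => by
    have key : ∀ (a b : TangentBundle 𝓘(ℝ, E) Q) (Y : E × E), a = b →
        F a (tangentProj a Y) = F b (tangentProj b Y) := by rintro a _ Y rfl; rfl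
    rw [flowWork, flowWork, hfd τ hτ]
    exact key _ _ _ (hflow τ hτ)
  have hact : flowAction L Γ (t + s) =ᶠ[𝓝 v]
      fun u => flowAction L Γ s u + flowAction L Γ t (flow Γ univ s u) := by
    filter_upwards [hv] with u hu
    have hc : ContinuousOn (fun τ => L (flow Γ univ τ u)) (Icc 0 (t + s)) :=
      hLc.comp_continuousOn (hu.continuousOn_flow hΓ)
    have hi : ∀ a b, a ∈ Icc 0 (t + s) → b ∈ Icc 0 (t + s) →
        IntervalIntegrable (fun τ => L (flow Γ univ τ u)) MeasureTheory.volume a b :=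
      fun a b ha hb => (hc.mono (uIcc_subset_Icc ha hb)).intervalIntegrable
    have h0 : (0 : ℝ) ∈ Icc 0 (t + s) := ⟨le_rfl, by linarith⟩
    have hs' : s ∈ Icc 0 (t + s) := ⟨hs, by linarith⟩
    have hts : t + s ∈ Icc 0 (t + s) := ⟨by linarith, le_rfl⟩
    simp only [flowAction]
    rw [← intervalIntegral.integral_add_adjacent_intervals (hi 0 s h0 hs') (hi s (t + s) hs' hts)]
    congr 1
    have h3 := intervalIntegral.integral_comp_add_right (a := 0) (b := t)
      (fun τ => L (flow Γ univ τ u)) s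
    rw [zero_add] at h3
    rw [← h3]
    refine intervalIntegral.integral_congr fun τ hτ => ?_
    rw [uIcc_of_le ht] at hτ
    exact congrArg L ((hu.mono (by linarith [hτ.2])).flow_add hΓ hs hτ.1)
  have hactd : HasMFDerivAt 𝓘(ℝ, E).tangent 𝓘(ℝ, ℝ) (flowAction L Γ (t + s)) v
      ((show E × E →L[ℝ] ℝ from dFun (flowAction L Γ s) v) +
        (show E × E →L[ℝ] ℝ from dFun (flowAction L Γ t) (flow Γ univ s v)).comp
          (flowDeriv Γ s v)) :=
    (h₁.action.hasMFDerivAt.add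
      (h₂.action.hasMFDerivAt.comp v hS.hasMFDerivAt)).congr_of_eventuallyEq hact
  have hint₂ : ∀ X, IntervalIntegrable (flowWork F Γ v X) MeasureTheory.volume s (t + s) :=
    fun X => by
      have h4 : IntervalIntegrable (fun τ => flowWork F Γ v X (τ + s))
          MeasureTheory.volume 0 t := (h₂.integrable (flowDeriv Γ s v X)).congr fun τ hτ => by
        rw [uIoc_of_le ht] at hτ
        exact (hwork X τ (Ioc_subset_Icc_self hτ)).symm
      have h5 := h4.comp_sub_right s
      simpa using h5
  refine ⟨fun τ hτ => ?_, hactd.mdifferentiableAt, fun X => (h₁.integrable X).trans (hint₂ X),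
    fun X => ?_⟩
  · rcases le_total τ s with h | h
    · exact h₁.mdifferentiableAt τ ⟨hτ.1, h⟩
    · have := (hder (τ - s) ⟨by linarith, by linarith [hτ.2]⟩).mdifferentiableAt
      rwa [sub_add_cancel] at this
  · have htt : t ∈ Icc 0 t := ⟨ht, le_rfl⟩
    have h6 : dFun (flowAction L Γ (t + s)) v X = dFun (flowAction L Γ s) v X +
        dFun (flowAction L Γ t) (flow Γ univ s v) (flowDeriv Γ s v X) :=
      DFunLike.congr_fun hactd.mfderiv X
    have h7 : ∫ τ in s..(t + s), flowWork F Γ v X τ =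
        ∫ τ in (0 : ℝ)..t, flowWork F Γ (flow Γ univ s v) (flowDeriv Γ s v X) τ := by
      have h3 := intervalIntegral.integral_comp_add_right (a := 0) (b := t) (flowWork F Γ v X) s
      rw [zero_add] at h3
      rw [← h3]
      refine intervalIntegral.integral_congr fun τ hτ => ?_
      rw [uIcc_of_le ht] at hτ
      exact hwork X τ hτ
    have h8 : lagrangeForm L (flow Γ univ (t + s) v) (flowDeriv Γ (t + s) v X) =
        lagrangeForm L (flow Γ univ t (flow Γ univ s v))
          (flowDeriv Γ t (flow Γ univ s v) (flowDeriv Γ s v X)) := by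
      have key : ∀ (a b : TangentBundle 𝓘(ℝ, E) Q) (Y : E × E), a = b →
        lagrangeForm L a Y = lagrangeForm L b Y := by rintro a _ Y rfl; rfl
      rw [hfd t htt]
      exact key _ _ _ (hflow t htt)
    rw [h6, ← intervalIntegral.integral_add_adjacent_intervals (h₁.integrable X) (hint₂ X), h7, h8]
    have e₁ := h₁.formula X
    have e₂ := h₂.formula (flowDeriv Γ s v X)
    linarith

/-- The first variation formula propagates along trajectories. -/
theorem satisfiesVariationFormula_of_local (hLc : Continuous L)
    (hΓ : ContMDiff 𝓘(ℝ, E).tangent 𝓘(ℝ, E).tangent.tangent 1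
      (fun v => (⟨v, Γ v⟩ : TangentBundle 𝓘(ℝ, E).tangent (TangentBundle 𝓘(ℝ, E) Q))))
    (hloc : ∀ u₀ : TangentBundle 𝓘(ℝ, E) Q, ∃ ε > 0, ∀ᶠ u in 𝓝 u₀, ∀ τ ∈ Icc 0 ε,
      SatisfiesVariationFormula L F Γ u τ)
    {v : TangentBundle 𝓘(ℝ, E) Q} {h : ℝ} (hh : 0 ≤ h)
    (hv : ∀ᶠ u in 𝓝 v, HasFlowUpTo Γ h u) :
    ∀ t ∈ Icc 0 h, SatisfiesVariationFormula L F Γ v t := by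
  have hc := hv.self_of_nhds.continuousOn_flow hΓ
  obtain ⟨δ, hδ, hgood⟩ : ∃ δ > 0, ∀ s ∈ Icc 0 h, ∀ τ ∈ Icc 0 δ,
      SatisfiesVariationFormula L F Γ (flow Γ univ s v) τ := by
    -- Compactness of the time interval yields one step length `δ` valid along the whole trajectory.
    refine isCompact_Icc.induction_on (p := fun S => ∃ δ > 0, ∀ s ∈ S, ∀ τ ∈ Icc 0 δ,
      SatisfiesVariationFormula L F Γ (flow Γ univ s v) τ) ⟨1, one_pos, by simp⟩ ?_ ?_ ?_
    · rintro S T hST ⟨δ, hδ, hT⟩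
      exact ⟨δ, hδ, fun s hs => hT s (hST hs)⟩
    · rintro S T ⟨δ, hδ, hS⟩ ⟨δ', hδ', hT⟩
      refine ⟨min δ δ', lt_min hδ hδ', fun s hs τ hτ => ?_⟩
      rcases hs with hs | hs
      · exact hS s hs τ ⟨hτ.1, hτ.2.trans (min_le_left _ _)⟩
      · exact hT s hs τ ⟨hτ.1, hτ.2.trans (min_le_right _ _)⟩
    · intro s hs
      obtain ⟨ε, hε, hev⟩ := hloc (flow Γ univ s v)
      exact ⟨_, (hc s hs).eventually hev, ε, hε, fun _ hs' => hs'⟩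
  have hzero : flow Γ univ 0 v = v := hv.self_of_nhds.flow_zero hΓ
  -- Each induction step splits off a final piece of length `δ`, started at the flow at time `t -
  -- δ`.
  have hind : ∀ (n : ℕ), ∀ t ∈ Icc 0 h, t ≤ n * δ → SatisfiesVariationFormula L F Γ v t := by
    intro n
    induction n with
    | zero =>
      intro t ht htn
      have := hgood 0 ⟨le_rfl, hh⟩ t ⟨ht.1, by
        simp only [Nat.cast_zero, zero_mul] at htn; linarith⟩
      rwa [hzero] at this
    | succ n ih =>
      intro t ht htn
      rcases le_total t δ with hle | hle
      · have := hgood 0 ⟨le_rfl, hh⟩ t ⟨ht.1, hle⟩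
        rwa [hzero] at this
      · push_cast at htn
        have hmem : t - δ ∈ Icc 0 h := ⟨by linarith, by linarith [ht.2]⟩
        have := (ih (t - δ) hmem (by linarith)).add hLc hΓ hmem.1 hδ.le
          (hv.mono fun u hu => hu.mono (by linarith [ht.2]))
          (hgood (t - δ) hmem δ ⟨hδ.le, le_rfl⟩)
        rwa [add_sub_cancel] at this
  intro t ht
  obtain ⟨n, hn⟩ := exists_nat_ge (t / δ)
  exact hind n t ht ((div_le_iff₀ hδ).1 hn)

end VariationIdentity

/-! ### The first variation formula for small times. -/

section LocalVariation

variable {E : Type*} [NormedAddCommGroup E] [NormedSpace ℝ E] [FiniteDimensional ℝ E]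

/-- The first variation formula in coordinates: `β` is a trajectory of the forced Euler-Lagrange
field, `(N.1, N.2)` its variation together with the variation of the action. -/
theorem local_first_variation {ℓ : E × E → ℝ} {f : E × E → E →L[ℝ] ℝ} {T : Set (E × E)}
    (hℓ : ∀ z ∈ T, ContDiffAt ℝ ∞ ℓ z) (hf : ∀ z ∈ T, ContinuousAt f z)
    (hH : ∀ z ∈ T, Function.Injective (localHessian ℓ z))
    (hΓ : ∀ z ∈ T, DifferentiableAt ℝ (localField ℓ f) z)
    {β ξ : ℝ → E × E} {η : ℝ → ℝ} {t : ℝ} (ht : 0 ≤ t) (hT : ∀ τ ∈ Icc 0 t, β τ ∈ T)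
    (hβ : ∀ τ ∈ Icc 0 t, HasDerivAt β (localField ℓ f (β τ)) τ)
    (hξ : ∀ τ ∈ Icc 0 t, HasDerivAt ξ (fderiv ℝ (localField ℓ f) (β τ) (ξ τ)) τ)
    (hη : ∀ τ ∈ Icc 0 t, HasDerivAt η (fderiv ℝ ℓ (β τ) (ξ τ)) τ) :
    ContinuousOn (fun τ => f (β τ) (ξ τ).1) (Icc 0 t) ∧
    η t - η 0 + ∫ τ in (0 : ℝ)..t, f (β τ) (ξ τ).1 =
      localMomentum ℓ (β t) (ξ t).1 - localMomentum ℓ (β 0) (ξ 0).1 := by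
  have hcont : ContinuousOn (fun τ => f (β τ) (ξ τ).1) (Icc 0 t) := fun τ hτ =>
    ((ContinuousAt.comp (f := β) (hf _ (hT τ hτ)) (hβ τ hτ).continuousAt).clm_apply
      (hξ τ hτ).continuousAt.fst).continuousWithinAt
  refine ⟨hcont, ?_⟩
  -- The classical integration by parts: the Euler-Lagrange equation differentiates the momentum,
  -- and the variation of the position has the variation of the velocity as derivative, since the
  -- first component of the field is `y`. Only the work term survives.
  have hd : ∀ τ ∈ Icc 0 t, HasDerivAt (fun τ => localMomentum ℓ (β τ) (ξ τ).1 - η τ)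
      (f (β τ) (ξ τ).1) τ := fun τ hτ => by
    have h1 : HasDerivAt (fun τ => localMomentum ℓ (β τ))
        (fderiv ℝ (localMomentum ℓ) (β τ) (localField ℓ f (β τ))) τ :=
      (hasFDerivAt_localMomentum (hℓ _ (hT τ hτ))).comp_hasDerivAt τ (hβ τ hτ)
    have h2 : HasDerivAt (fun τ => (ξ τ).1) (fderiv ℝ (localField ℓ f) (β τ) (ξ τ)).1 τ :=
      (hξ τ hτ).fst
    have h3 : (fderiv ℝ (localField ℓ f) (β τ) (ξ τ)).1 = (ξ τ).2 := by
      have h4 : HasFDerivAt (fun z => (localField ℓ f z).1) _ (β τ) :=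
        (hΓ _ (hT τ hτ)).hasFDerivAt.fst
      have h5 : HasFDerivAt (fun z => (localField ℓ f z).1) (ContinuousLinearMap.snd ℝ E E) (β τ) :=
        hasFDerivAt_snd
      exact DFunLike.congr_fun (h4.unique h5) (ξ τ)
    have h6 := (h1.clm_apply h2).sub (hη τ hτ)
    refine h6.congr_deriv ?_
    rw [h3, fderiv_localMomentum_localField (hH _ (hT τ hτ))]
    have h7 : fderiv ℝ ℓ (β τ) (ξ τ) =
        fderiv ℝ ℓ (β τ) ((ξ τ).1, 0) + localMomentum ℓ (β τ) (ξ τ).2 := by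
      rw [localMomentum, ContinuousLinearMap.comp_apply, ContinuousLinearMap.inr_apply, ← map_add]
      simp
    rw [h7]
    ring
  have hint := intervalIntegral.integral_eq_sub_of_hasDerivAt (a := 0) (b := t)
    (fun τ hτ => hd τ (by rwa [uIcc_of_le ht] at hτ))
    (by rw [← uIcc_of_le ht] at hcont; exact hcont.intervalIntegrable)
  rw [hint]
  ring

variable {Q : Type*} [TopologicalSpace Q] [ChartedSpace E Q] [IsManifold 𝓘(ℝ, E) ∞ Q]
  {L : TangentBundle 𝓘(ℝ, E) Q → ℝ}
  {F : (v : TangentBundle 𝓘(ℝ, E) Q) → TangentSpace 𝓘(ℝ, E) v.proj →L[ℝ] ℝ}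

theorem isMIntegralCurveOn_natChart_symm (hL : ContMDiff 𝓘(ℝ, E).tangent 𝓘(ℝ, ℝ) ∞ L)
    (hLreg : IsRegularLagrangian L) {q₀ : Q} {β : ℝ → E × E} {a b : ℝ}
    (hT : ∀ t ∈ Ioo a b, β t ∈ (natChart q₀).target)
    (hβ : ∀ t ∈ Ioo a b,
      HasDerivAt β (localField (localLagrangian L q₀) (localForce F q₀) (β t)) t) :
    IsMIntegralCurveOn (fun t => (natChart q₀).symm (β t)) (forcedField L F) (Ioo a b) := by
  intro t ht
  have h1 := (hasMFDerivAt_natChart_symm (hT t ht)).comp t (hβ t ht).hasFDerivAt.hasMFDerivAt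
  refine HasMFDerivAt.hasMFDerivWithinAt ?_
  rw [forcedField_natChart_symm hL hLreg (hT t ht)]
  have h2 : ∀ (A : E × E →L[ℝ] E × E) (X : E × E),
      (1 : ℝ →L[ℝ] ℝ).smulRight (A X) = A.comp (ContinuousLinearMap.toSpanSingleton ℝ X) :=
    fun A X => ContinuousLinearMap.ext fun c => (map_smul A c X).symm
  have h3 := h2 (natDeriv q₀ (β t)) (localField (localLagrangian L q₀) (localForce F q₀) (β t))
  exact (congrArg (fun B : ℝ →L[ℝ] E × E => HasMFDerivAt 𝓘(ℝ, ℝ) 𝓘(ℝ, E).tangent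
    (fun t => (natChart q₀).symm (β t)) t B) h3).mpr h1

variable [T2Space Q]

/-- The first variation formula of the forced Lagrangian vector field for small times. -/
theorem exists_satisfiesVariationFormula (hL : ContMDiff 𝓘(ℝ, E).tangent 𝓘(ℝ, ℝ) ∞ L)
    (hLreg : IsRegularLagrangian L) (hF : IsSmoothForce F) (u₀ : TangentBundle 𝓘(ℝ, E) Q) :
    ∃ ε > 0, ∀ᶠ u in 𝓝 u₀, ∀ τ ∈ Icc 0 ε,
      SatisfiesVariationFormula L F (forcedField L F) u τ := by
  have hΓ := contMDiff_forcedField hL hLreg hF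
  set q₀ : Q := u₀.proj
  set ℓ := localLagrangian L q₀ with hℓdef
  set f := localForce F q₀ with hfdef
  set T : Set (E × E) := (natChart q₀).target with hTdef
  have hTo : IsOpen T := isOpen_natChart_target q₀
  have hℓ : ∀ z ∈ T, ContDiffAt ℝ ∞ ℓ z := fun z hz => contDiffAt_localLagrangian hL hz
  have hfs : ∀ z ∈ T, ContDiffAt ℝ ∞ f z := fun z hz =>
    (contDiffOn_localForce hF q₀).contDiffAt (hTo.mem_nhds hz)
  have hX : ∀ z ∈ T, ContDiffAt ℝ ∞ (localField ℓ f) z := fun z hz =>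
    contDiffAt_localField_natChart hL hLreg hF hz
  -- The accumulated action is adjoined as an extra coordinate with velocity `ℓ` and initial value
  -- `0`. A single flow theorem then differentiates trajectory and action together.
  set g : (E × E) × ℝ → (E × E) × ℝ := fun p => (localField ℓ f p.1, ℓ p.1) with hg
  have hgs : ∀ p ∈ T ×ˢ (univ : Set ℝ), ContDiffAt ℝ ∞ g p := fun p hp =>
    ((hX p.1 hp.1).comp p contDiffAt_fst).prodMk ((hℓ p.1 hp.1).comp p contDiffAt_fst)
  have hgd : ∀ p ∈ T ×ˢ (univ : Set ℝ), ∀ n, fderiv ℝ g p n =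
      (fderiv ℝ (localField ℓ f) p.1 n.1, fderiv ℝ ℓ p.1 n.1) := fun p hp n => by
    have h1 : HasFDerivAt g _ p :=
      (((hX p.1 hp.1).differentiableAt (by simp)).hasFDerivAt.comp p hasFDerivAt_fst).prodMk
        (((hℓ p.1 hp.1).differentiableAt (by simp)).hasFDerivAt.comp p hasFDerivAt_fst)
    rw [h1.fderiv]
    rfl
  have hu₀ : u₀ ∈ (natChart (E := E) q₀).source := mem_extChartAt_source (I := 𝓘(ℝ, E).tangent) u₀
  obtain ⟨r, hr, ε, hε, α, M, hαM⟩ := exists_local_flow_hasFDerivAt (f := g)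
    (U := T ×ˢ (univ : Set ℝ)) (hTo.prod isOpen_univ)
    (fun p hp => ((hgs p hp).of_le (by exact WithTop.coe_le_coe.2 le_top)).contDiffWithinAt)
    (x₀ := (natChart q₀ u₀, 0)) ⟨(natChart q₀).map_source hu₀, mem_univ _⟩
  set x : TangentBundle 𝓘(ℝ, E) Q → (E × E) × ℝ := fun u => (natChart q₀ u, 0) with hxdef
  have hN : ∀ᶠ u in 𝓝 u₀, u ∈ (natChart (E := E) q₀).source ∧ x u ∈ Metric.ball (x u₀) r := by
    refine Filter.Eventually.and ((isOpen_natChart_source q₀).mem_nhds hu₀) ?_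
    have hc : ContinuousAt x u₀ :=
      ((contMDiffAt_natChart hu₀).continuousAt).prodMk continuousAt_const
    exact hc.eventually (Metric.isOpen_ball.mem_nhds (Metric.mem_ball_self hr))
  refine ⟨ε / 2, by positivity, ?_⟩
  have hsub : ∀ τ ∈ Icc 0 (ε / 2), τ ∈ Ioo (-ε) ε := fun τ hτ =>
    ⟨by linarith [hτ.1], by linarith [hτ.2]⟩
  have hzero : (0 : ℝ) ∈ Ioo (-ε) ε := ⟨by linarith, hε⟩
  have hflow : ∀ u, u ∈ (natChart (E := E) q₀).source ∧ x u ∈ Metric.ball (x u₀) r →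
      ∀ τ ∈ Ioo (-ε) ε,
      flow (forcedField L F) univ τ u = (natChart q₀).symm (α (x u) τ).1 := by
    rintro u ⟨hu, hxu⟩ τ hτ
    have h1 := isMIntegralCurveOn_natChart_symm (F := F) hL hLreg (q₀ := q₀)
      (β := fun t => (α (x u) t).1) (a := -ε) (b := ε)
      (fun t ht => ((hαM _ hxu).2.2 t ht).1.1) (fun t ht => ((hαM _ hxu).2.2 t ht).2.1.fst)
    have h2 := flow_eq_of_isMIntegralCurveOn hΓ hzero hτ h1
    simp only [(hαM _ hxu).1] at h2
    rwa [(natChart q₀).left_inv hu] at h2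
  -- The coordinate description of the flow is needed on a neighbourhood of `u`, so that it can be
  -- differentiated at `u`.
  filter_upwards [hN.eventually_nhds] with u hu' τ hτ
  obtain ⟨hu, hxu⟩ := hu'.self_of_nhds
  have hα := hαM _ hxu
  have hT : ∀ σ ∈ Ioo (-ε) ε, (α (x u) σ).1 ∈ T := fun σ hσ => (hα.2.2 σ hσ).1.1
  have hxd : HasMFDerivAt 𝓘(ℝ, E).tangent 𝓘(ℝ, (E × E) × ℝ) x u
      ((ContinuousLinearMap.inl ℝ (E × E) ℝ).comp (natFDeriv (E := E) q₀ u)) := by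
    have h1 : HasFDerivAt (fun y : E × E => ((y, 0) : (E × E) × ℝ))
        (ContinuousLinearMap.inl ℝ (E × E) ℝ) (natChart q₀ u) := by
      exact (hasFDerivAt_id _).prodMk (hasFDerivAt_const _ _)
    exact h1.hasMFDerivAt.comp u (hasMFDerivAt_natChart hu)
  have hαd : ∀ σ ∈ Icc 0 (ε / 2), HasMFDerivAt 𝓘(ℝ, E).tangent 𝓘(ℝ, (E × E) × ℝ)
      (fun u => α (x u) σ) u ((M (x u) σ).comp
        ((ContinuousLinearMap.inl ℝ (E × E) ℝ).comp (natFDeriv (E := E) q₀ u))) := fun σ hσ =>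
    ((hα.2.2 σ (hsub σ hσ)).2.2.2 hσ.1).hasMFDerivAt.comp u hxd
  -- The variation of trajectory and action generated by `X`; the action starts unvaried, whence the
  -- `0`.
  set N : E × E → ℝ → (E × E) × ℝ := fun X σ => M (x u) σ (natFDeriv q₀ u X, 0) with hNdef
  have hflowd : ∀ σ ∈ Icc 0 (ε / 2), HasMFDerivAt 𝓘(ℝ, E).tangent 𝓘(ℝ, E).tangent
      (flow (forcedField L F) univ σ) u ((natDeriv (E := E) q₀ (α (x u) σ).1).comp
        ((ContinuousLinearMap.fst ℝ (E × E) ℝ).comp ((M (x u) σ).comp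
        ((ContinuousLinearMap.inl ℝ (E × E) ℝ).comp (natFDeriv (E := E) q₀ u))))) := fun σ hσ => by
    have h1 := (hasMFDerivAt_natChart_symm (hT σ (hsub σ hσ))).comp u
      ((hasFDerivAt_fst (𝕜 := ℝ) (p := α (x u) σ)).hasMFDerivAt.comp u (hαd σ hσ))
    refine h1.congr_of_eventuallyEq ?_
    filter_upwards [hu'] with w hw
    exact hflow w hw σ (hsub σ hσ)
  have hfd : ∀ σ ∈ Icc 0 (ε / 2), ∀ X, flowDeriv (forcedField L F) σ u X =
      natDeriv q₀ (α (x u) σ).1 (N X σ).1 := fun σ hσ X =>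
    DFunLike.congr_fun (hflowd σ hσ).mfderiv X
  have hsubτ : ∀ σ ∈ Icc 0 τ, σ ∈ Icc 0 (ε / 2) := fun σ hσ => ⟨hσ.1, hσ.2.trans hτ.2⟩
  have hact : flowAction L (forcedField L F) τ =ᶠ[𝓝 u] fun w => (α (x w) τ).2 := by
    filter_upwards [hu'] with w hw
    have hαw := hαM _ hw.2
    have hd : ∀ σ ∈ uIcc 0 τ, HasDerivAt (fun σ => (α (x w) σ).2) (ℓ (α (x w) σ).1) σ :=
      fun σ hσ => by
        rw [uIcc_of_le hτ.1] at hσ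
        exact (hαw.2.2 σ (hsub σ (hsubτ σ hσ))).2.1.snd
    have hc : ContinuousOn (fun σ => ℓ (α (x w) σ).1) (uIcc 0 τ) := fun σ hσ => by
      rw [uIcc_of_le hτ.1] at hσ
      have h1 := hαw.2.2 σ (hsub σ (hsubτ σ hσ))
      exact (ContinuousAt.comp (f := fun σ => (α (x w) σ).1) (hℓ _ h1.1.1).continuousAt
        h1.2.1.continuousAt.fst).continuousWithinAt
    have h2 := intervalIntegral.integral_eq_sub_of_hasDerivAt hd hc.intervalIntegrable
    rw [hαw.1, sub_zero] at h2
    rw [← h2, flowAction]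
    refine intervalIntegral.integral_congr fun σ hσ => ?_
    rw [uIcc_of_le hτ.1] at hσ
    exact congrArg L (hflow w hw σ (hsub σ (hsubτ σ hσ)))
  have hactd : HasMFDerivAt 𝓘(ℝ, E).tangent 𝓘(ℝ, ℝ) (flowAction L (forcedField L F) τ) u
      ((ContinuousLinearMap.snd ℝ (E × E) ℝ).comp ((M (x u) τ).comp
        ((ContinuousLinearMap.inl ℝ (E × E) ℝ).comp (natFDeriv (E := E) q₀ u)))) :=
    ((hasFDerivAt_snd (𝕜 := ℝ) (p := α (x u) τ)).hasMFDerivAt.comp u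
      (hαd τ hτ)).congr_of_eventuallyEq hact
  have hNd : ∀ X, ∀ σ ∈ Icc 0 τ, HasDerivAt (N X)
      (fderiv ℝ (localField ℓ f) (α (x u) σ).1 (N X σ).1, fderiv ℝ ℓ (α (x u) σ).1 (N X σ).1) σ :=
    fun X σ hσ => by
      have h1 := hα.2.2 σ (hsub σ (hsubτ σ hσ))
      have h2 := h1.2.2.1.clm_apply (hasDerivAt_const σ ((natFDeriv q₀ u X, 0) : (E × E) × ℝ))
      rw [map_zero, add_zero, ContinuousLinearMap.comp_apply, hgd _ h1.1] at h2
      exact h2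
  have hvar := fun X => local_first_variation (f := f) hℓ (fun z hz => (hfs z hz).continuousAt)
    (fun z hz => localHessian_injective hL hLreg hz)
    (fun z hz => (hX z hz).differentiableAt (by simp)) (β := fun σ => (α (x u) σ).1)
    (ξ := fun σ => (N X σ).1) (η := fun σ => (N X σ).2) hτ.1
    (fun σ hσ => hT σ (hsub σ (hsubτ σ hσ)))
    (fun σ hσ => (hα.2.2 σ (hsub σ (hsubτ σ hσ))).2.1.fst)
    (fun σ hσ => (hNd X σ hσ).fst) (fun σ hσ => (hNd X σ hσ).snd)
  have hwork : ∀ X, ∀ σ ∈ Icc 0 τ, flowWork F (forcedField L F) u X σ =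
      f (α (x u) σ).1 (N X σ).1.1 := fun X σ hσ => by
    have key : ∀ (a b : TangentBundle 𝓘(ℝ, E) Q) (Y : E × E), a = b →
        F a (tangentProj a Y) = F b (tangentProj b Y) := by rintro a _ Y rfl; rfl
    rw [flowWork, hfd σ (hsubτ σ hσ)]
    refine (key _ _ _ (hflow u ⟨hu, hxu⟩ σ (hsub σ (hsubτ σ hσ)))).trans ?_
    exact congrArg (F ((natChart q₀).symm (α (x u) σ).1))
      (tangentProj_natDeriv (hT σ (hsub σ (hsubτ σ hσ))) _)
  have hlag : ∀ X, ∀ σ ∈ Icc 0 τ, lagrangeForm L (flow (forcedField L F) univ σ u)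
      (flowDeriv (forcedField L F) σ u X) = localMomentum ℓ (α (x u) σ).1 (N X σ).1.1 :=
    fun X σ hσ => by
      have key : ∀ (a b : TangentBundle 𝓘(ℝ, E) Q) (Y : E × E), a = b →
        lagrangeForm L a Y = lagrangeForm L b Y := by rintro a _ Y rfl; rfl
      rw [hfd σ (hsubτ σ hσ)]
      exact (key _ _ _ (hflow u ⟨hu, hxu⟩ σ (hsub σ (hsubτ σ hσ)))).trans
        (lagrangeForm_natDeriv hL (hT σ (hsub σ (hsubτ σ hσ))) _)
  have h0 : (0 : ℝ) ∈ Icc 0 τ := ⟨le_rfl, hτ.1⟩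
  have hN0 : ∀ X, N X 0 = (natFDeriv q₀ u X, 0) := fun X => by
    simp only [hNdef, hα.2.1]; rfl
  refine ⟨fun σ hσ => (hflowd σ (hsubτ σ hσ)).mdifferentiableAt, hactd.mdifferentiableAt,
    fun X => ?_, fun X => ?_⟩
  · refine IntervalIntegrable.congr (f := fun σ => f (α (x u) σ).1 (N X σ).1.1)
      (fun σ hσ => ?_) ?_
    · rw [uIoc_of_le hτ.1] at hσ
      exact (hwork X σ (Ioc_subset_Icc_self hσ)).symm
    · have := (hvar X).1
      rw [← uIcc_of_le hτ.1] at this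
      exact this.intervalIntegrable
  · have h1 : dFun (flowAction L (forcedField L F) τ) u X = (N X τ).2 :=
      DFunLike.congr_fun hactd.mfderiv X
    have h2 : ∫ σ in (0 : ℝ)..τ, flowWork F (forcedField L F) u X σ =
        ∫ σ in (0 : ℝ)..τ, f (α (x u) σ).1 (N X σ).1.1 :=
      intervalIntegral.integral_congr fun σ hσ => hwork X σ (by rwa [uIcc_of_le hτ.1] at hσ)
    have h3 : lagrangeForm L u X = localMomentum ℓ (α (x u) 0).1 (N X 0).1.1 := by
      have h4 := lagrangeForm_natDeriv hL ((natChart q₀).map_source hu) (natFDeriv q₀ u X)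
      have h5 := natDeriv_natFDeriv ((natChart q₀).map_source hu) X
      rw [(natChart q₀).left_inv hu] at h4 h5
      rw [h5] at h4
      rw [hN0, hα.1]
      exact h4
    have h4 := (hvar X).2
    rw [hN0 X] at h4
    rw [h1, h2, hlag X τ ⟨hτ.1, le_rfl⟩, h3, hN0 X, ← h4]
    simp

end LocalVariation

/-! ### Retractions as inverses of exponential maps. -/

section Retraction

variable {E : Type*} [NormedAddCommGroup E] [NormedSpace ℝ E]
  {Q : Type*} [TopologicalSpace Q] [ChartedSpace E Q] [IsManifold 𝓘(ℝ, E) ∞ Q]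
  {Γ : (v : TangentBundle 𝓘(ℝ, E) Q) → TangentSpace 𝓘(ℝ, E).tangent v}
  {C : Set (TangentBundle 𝓘(ℝ, E) Q)} {h : ℝ} {W : Set (TangentBundle 𝓘(ℝ, E) Q)}

theorem retractMinus_mem {p : Q × Q} (hp : p ∈ expMap Γ C h '' W) :
    retractMinus Γ C h W p ∈ W := by
  rw [retractMinus, dif_pos (show ∃ v ∈ W, expMap Γ C h v = p from hp)]
  exact (show ∃ v ∈ W, expMap Γ C h v = p from hp).choose_spec.1

theorem expMap_retractMinus {p : Q × Q} (hp : p ∈ expMap Γ C h '' W) :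
    expMap Γ C h (retractMinus Γ C h W p) = p := by
  rw [retractMinus, dif_pos (show ∃ v ∈ W, expMap Γ C h v = p from hp)]
  exact (show ∃ v ∈ W, expMap Γ C h v = p from hp).choose_spec.2

theorem retractMinus_expMap (hinj : InjOn (expMap Γ C h) W) {v : TangentBundle 𝓘(ℝ, E) Q}
    (hv : v ∈ W) : retractMinus Γ C h W (expMap Γ C h v) = v :=
  hinj (retractMinus_mem (mem_image_of_mem _ hv)) hv (expMap_retractMinus (mem_image_of_mem _ hv))

/-- Injectivity on `W` forces the chosen preimage to agree, near `p`, with the local inverse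
supplied by the local diffeomorphism. -/
theorem IsRetractionDomain.mdifferentiableAt_retractMinus (hW : IsRetractionDomain Γ h W)
    {p : Q × Q} (hp : p ∈ expMap Γ univ h '' W) :
    MDifferentiableAt (𝓘(ℝ, E).prod 𝓘(ℝ, E)) 𝓘(ℝ, E).tangent (retractMinus Γ univ h W) p ∧
      ∀ᶠ p' in 𝓝 p, expMap Γ univ h (retractMinus Γ univ h W p') = p' := by
  obtain ⟨v, hv, rfl⟩ := hp
  have hloc := hW.isLocalDiffeomorphOn ⟨v, hv⟩
  have hd := hloc.localInverse_mdifferentiableAt (by simp)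
  have hmem : ∀ᶠ p' in 𝓝 (expMap Γ univ h v), hloc.localInverse p' ∈ W := by
    refine hd.continuousAt.eventually (hW.isOpen.mem_nhds ?_)
    rw [hloc.localInverse_left_inv hloc.localInverse_mem_target]
    exact hv
  have hright : ∀ᶠ p' in 𝓝 (expMap Γ univ h v),
      expMap Γ univ h (hloc.localInverse p') = p' := hloc.localInverse_eventuallyEq_right
  have heq : retractMinus Γ univ h W =ᶠ[𝓝 (expMap Γ univ h v)] hloc.localInverse := by
    filter_upwards [hmem, hright] with p' h1 h2
    conv_lhs => rw [← h2]
    exact retractMinus_expMap hW.injOn h1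
  refine ⟨hd.congr_of_eventuallyEq heq, ?_⟩
  filter_upwards [heq, hright] with p' h1 h2
  rw [h1, h2]

end Retraction

/-! ### Discrete momenta of the exact Lagrangian and forces. -/

section ExactDiscrete

variable {E : Type*} [NormedAddCommGroup E] [NormedSpace ℝ E]
  {Q : Type*} [TopologicalSpace Q] [ChartedSpace E Q] [IsManifold 𝓘(ℝ, E) ∞ Q]
  {L : TangentBundle 𝓘(ℝ, E) Q → ℝ}

theorem legendreNh_eq_dFun (hL : ContMDiff 𝓘(ℝ, E).tangent 𝓘(ℝ, ℝ) ∞ L)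
    (u : TangentBundle 𝓘(ℝ, E) Q) (w : E) :
    legendreNh L u w = dFun L u (verticalLift u w) := by
  have h1 := HasMFDerivAt.comp (M := E) (I := 𝓘(ℝ, E)) (show E from u.snd)
    (hL.mdifferentiableAt (by simp) (x := u)).hasMFDerivAt (hasMFDerivAt_verticalLift u)
  have h2 : HasFDerivAt (fun w : E => L ⟨u.proj, w⟩)
      ((show E × E →L[ℝ] ℝ from dFun L u).comp (show E →L[ℝ] E × E from verticalLift u))
      (show E from u.snd) := hasMFDerivAt_iff_hasFDerivAt.1 h1
  have h3 : HasDerivAt (fun t : ℝ => (show E from u.snd) + t • w) w 0 := by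
    simpa using ((hasDerivAt_id (0 : ℝ)).smul_const w).const_add (show E from u.snd)
  have h4 : (show E from u.snd) + (0 : ℝ) • w = u.snd := by rw [zero_smul, add_zero]
  exact (h2.comp_hasDerivAt_of_eq 0 h3 h4.symm).deriv

theorem legendreNh_zero (hL : ContMDiff 𝓘(ℝ, E).tangent 𝓘(ℝ, ℝ) ∞ L)
    (u : TangentBundle 𝓘(ℝ, E) Q) : legendreNh L u (0 : E) = 0 := by
  rw [legendreNh_eq_dFun hL]
  exact (congrArg (dFun L u) (map_zero (verticalLift u))).trans (map_zero (dFun L u))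

theorem exactDoubleForce_zero (L : TangentBundle 𝓘(ℝ, E) Q → ℝ)
    (F : (v : TangentBundle 𝓘(ℝ, E) Q) → TangentSpace 𝓘(ℝ, E) v.proj →L[ℝ] ℝ) (h : ℝ)
    (W : Set (TangentBundle 𝓘(ℝ, E) Q)) (p : Q × Q) :
    exactDoubleForce L F h W p (0 : E) (0 : E) = 0 := by
  refine Eq.trans (intervalIntegral.integral_congr (g := fun _ => (0 : ℝ)) fun t _ => ?_)
    intervalIntegral.integral_zero
  have key : ∀ (A : E × E →L[ℝ] E) (f : E →L[ℝ] ℝ), f (A ((0 : E), (0 : E))) = 0 := fun A f => by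
    rw [Prod.mk_zero_zero, map_zero, map_zero]
  exact key _ _

variable [FiniteDimensional ℝ E] [T2Space Q]
  {F : (v : TangentBundle 𝓘(ℝ, E) Q) → TangentSpace 𝓘(ℝ, E) v.proj →L[ℝ] ℝ}

/-- The exact discrete Lagrangian and the exact discrete forces satisfy the forced discrete
version of the first variation formula: the discrete Legendre transformations are the
continuous ones, composed with the retractions. -/
theorem exactLagrangian_first_variation (hL : ContMDiff 𝓘(ℝ, E).tangent 𝓘(ℝ, ℝ) ∞ L)
    (hLreg : IsRegularLagrangian L) (hF : IsSmoothForce F) {h : ℝ} (hh : 0 < h)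
    {W : Set (TangentBundle 𝓘(ℝ, E) Q)} (hW : IsRetractionDomain (forcedField L F) h W)
    {p : Q × Q} (hp : p ∈ expMap (forcedField L F) univ h '' W) :
    MDifferentiableAt (𝓘(ℝ, E).prod 𝓘(ℝ, E)) 𝓘(ℝ, ℝ) (exactLagrangian L F h W) p ∧
      ∀ X₀ X₁ : E, (show E × E →L[ℝ] ℝ from mfderiv (𝓘(ℝ, E).prod 𝓘(ℝ, E)) 𝓘(ℝ, ℝ)
        (exactLagrangian L F h W) p) (X₀, X₁) + exactDoubleForce L F h W p X₀ X₁ =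
      legendreNh L (retractPlus (forcedField L F) univ h W p) X₁ -
        legendreNh L (retractMinus (forcedField L F) univ h W p) X₀ := by
  have hΓ := contMDiff_forcedField hL hLreg hF
  set Γ := forcedField L F with hΓdef
  set R := retractMinus Γ univ h W with hRdef
  have hmem : R p ∈ W := retractMinus_mem hp
  -- Openness of `W` gives trajectories up to time `h` from all vectors near `R p`.
  have hsat := satisfiesVariationFormula_of_local (v := R p) hL.continuous hΓ
    (exists_satisfiesVariationFormula hL hLreg hF) hh.le (by
      filter_upwards [hW.isOpen.mem_nhds hmem] with u hu
      exact hasFlowUpTo_of_mem_flowDomain hh.le (hW.subset hu)) h ⟨hh.le, le_rfl⟩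
  obtain ⟨hRd, hexp⟩ := hW.mdifferentiableAt_retractMinus hp
  set A : E × E →L[ℝ] E × E :=
    mfderiv (𝓘(ℝ, E).prod 𝓘(ℝ, E)) 𝓘(ℝ, E).tangent R p with hAdef
  have hA : HasMFDerivAt (𝓘(ℝ, E).prod 𝓘(ℝ, E)) 𝓘(ℝ, E).tangent R p A := hRd.hasMFDerivAt
  have hLd : HasMFDerivAt (𝓘(ℝ, E).prod 𝓘(ℝ, E)) 𝓘(ℝ, ℝ) (exactLagrangian L F h W) p
      ((show E × E →L[ℝ] ℝ from dFun (flowAction L Γ h) (R p)).comp A) :=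
    hsat.action.hasMFDerivAt.comp p hA
  have hflow : ∀ τ ∈ Icc 0 h, HasMFDerivAt (𝓘(ℝ, E).prod 𝓘(ℝ, E)) 𝓘(ℝ, E)
      (fun p' : Q × Q => (flow Γ univ τ (R p')).proj) p
      ((show E × E →L[ℝ] E from tangentProj (flow Γ univ τ (R p))).comp
        ((flowDeriv (E := E) Γ τ (R p)).comp A)) := fun τ hτ =>
    (hasMFDerivAt_proj (flow Γ univ τ (R p))).comp p
      ((hsat.mdifferentiableAt τ hτ).hasMFDerivAt.comp p hA)
  -- Since `R` inverts the exponential map near `p`, its base point and that of its time-`h` flow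
  -- are the two projections of `Q × Q`; this and `hright` are their derivatives.
  have hleft : ∀ X, tangentProj (R p) (A X) = X.1 := fun X => by
    have h1 := (hasMFDerivAt_proj (R p)).comp p hA
    have h2 : HasMFDerivAt (𝓘(ℝ, E).prod 𝓘(ℝ, E)) 𝓘(ℝ, E)
        ((fun u : TangentBundle 𝓘(ℝ, E) Q => u.proj) ∘ R) p (ContinuousLinearMap.fst ℝ E E) :=
      (hasMFDerivAt_fst (I := 𝓘(ℝ, E)) (I' := 𝓘(ℝ, E)) (x := p)).congr_of_eventuallyEq
        (hexp.mono fun p' hp' => congrArg Prod.fst hp')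
    exact DFunLike.congr_fun (hasMFDerivAt_unique h1 h2) X
  have hright : ∀ X, tangentProj (flow Γ univ h (R p)) (flowDeriv Γ h (R p) (A X)) = X.2 :=
    fun X => by
      have h2 : HasMFDerivAt (𝓘(ℝ, E).prod 𝓘(ℝ, E)) 𝓘(ℝ, E)
          (fun p' : Q × Q => (flow Γ univ h (R p')).proj) p (ContinuousLinearMap.snd ℝ E E) :=
        (hasMFDerivAt_snd (I := 𝓘(ℝ, E)) (I' := 𝓘(ℝ, E)) (x := p)).congr_of_eventuallyEq
          (hexp.mono fun p' hp' => congrArg Prod.snd hp')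
      exact DFunLike.congr_fun (hasMFDerivAt_unique (hflow h ⟨hh.le, le_rfl⟩) h2) X
  refine ⟨hLd.mdifferentiableAt, fun X₀ X₁ => ?_⟩
  have hforce : exactDoubleForce L F h W p X₀ X₁ =
      ∫ τ in (0 : ℝ)..h, flowWork F Γ (R p) (A (X₀, X₁)) τ := by
    refine intervalIntegral.integral_congr fun τ hτ => ?_
    rw [uIcc_of_le hh.le] at hτ
    exact congrArg (F (flow Γ univ τ (R p)))
      (DFunLike.congr_fun (hflow τ hτ).mfderiv ((X₀, X₁) : E × E))
  have h1 : (show E × E →L[ℝ] ℝ from mfderiv (𝓘(ℝ, E).prod 𝓘(ℝ, E)) 𝓘(ℝ, ℝ)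
      (exactLagrangian L F h W) p) (X₀, X₁) = dFun (flowAction L Γ h) (R p) (A (X₀, X₁)) :=
    DFunLike.congr_fun hLd.mfderiv ((X₀, X₁) : E × E)
  -- `S^* dL` sees a vector only through its projection to `TQ`, where it is the fibre derivative of
  -- `L`; so the boundary terms depend only on the end point displacements.
  have h2 : lagrangeForm L (flow Γ univ h (R p)) (flowDeriv Γ h (R p) (A (X₀, X₁))) =
      legendreNh L (retractPlus Γ univ h W p) X₁ :=
    (congrArg (fun w => dFun L (flow Γ univ h (R p)) (verticalLift (flow Γ univ h (R p)) w))
      (hright (X₀, X₁))).trans (legendreNh_eq_dFun hL (flow Γ univ h (R p)) X₁).symm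
  have h3 : lagrangeForm L (R p) (A (X₀, X₁)) = legendreNh L (R p) X₀ :=
    (congrArg (fun w => dFun L (R p) (verticalLift (R p) w))
      (hleft (X₀, X₁))).trans (legendreNh_eq_dFun hL (R p) X₀).symm
  rw [hforce, ← h2, ← h3]
  exact (congrArg (fun x : ℝ => x + _) h1).trans (hsat.formula (A (X₀, X₁)))

end ExactDiscrete

/-! ### Comparison of nonholonomic and forced dynamics. -/

section Nonholonomic

/-- A linear system with constraints `T` and reactions `R` of complementary dimensions has a
solution, as soon as its homogeneous version only has the trivial one. -/
theorem exists_mem_sub_mem_of_injective {V : Type*} [AddCommGroup V] [Module ℝ V]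
    [FiniteDimensional ℝ V] {B : V →ₗ[ℝ] Module.Dual ℝ V} (hB : Function.Injective B)
    {T : Submodule ℝ V} {R : Submodule ℝ (Module.Dual ℝ V)}
    (hdim : Module.finrank ℝ T.dualAnnihilator = Module.finrank ℝ R)
    (hTR : ∀ X ∈ T, B X ∈ R → X = 0) (e : Module.Dual ℝ V) : ∃ X ∈ T, B X - e ∈ R := by
  set Φ := LinearMap.linearEquivOfInjective B hB Subspace.dual_finrank_eq.symm with hΦ
  have hΦa : ∀ X, Φ X = B X := fun X => LinearMap.linearEquivOfInjective_apply _ _ X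
  have hmem : ∀ Y, Y ∈ R.map (Φ.symm : Module.Dual ℝ V →ₗ[ℝ] V) ↔ B Y ∈ R := fun Y => by
    rw [← hΦa]
    exact Submodule.mem_map_equiv (e := Φ.symm) R
  -- Pulled back to `V`, the reactions have dimension complementary to that of `T` and meet it
  -- trivially, so they span with it. The `T`-component of the preimage of `e` is the solution.
  have htop : T ⊔ R.map (Φ.symm : Module.Dual ℝ V →ₗ[ℝ] V) = ⊤ := by
    refine Submodule.eq_top_of_disjoint _ _ ?_ ?_
    · rw [LinearEquiv.finrank_map_eq, ← hdim, Subspace.finrank_add_finrank_dualAnnihilator_eq]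
    · rw [Submodule.disjoint_def]
      exact fun X hX hX' => hTR X hX ((hmem X).1 hX')
  obtain ⟨X, hX, Y, hY, hXY⟩ := Submodule.mem_sup.1
    (show Φ.symm e ∈ T ⊔ R.map (Φ.symm : Module.Dual ℝ V →ₗ[ℝ] V) from htop ▸ Submodule.mem_top)
  refine ⟨X, hX, ?_⟩
  have h1 : B X + B Y = e := by rw [← map_add, hXY, ← hΦa, LinearEquiv.apply_symm_apply]
  have h2 : B X - e = -B Y := by rw [← h1]; abel
  rw [h2]
  exact R.neg_mem ((hmem Y).1 hY)

variable {E : Type*} [NormedAddCommGroup E] [NormedSpace ℝ E] [FiniteDimensional ℝ E]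
  {Q : Type*} [TopologicalSpace Q] [ChartedSpace E Q] [IsManifold 𝓘(ℝ, E) ∞ Q]
  {L : TangentBundle 𝓘(ℝ, E) Q → ℝ} {D : (q : Q) → Submodule ℝ (TangentSpace 𝓘(ℝ, E) q)}
  {F : (v : TangentBundle 𝓘(ℝ, E) Q) → TangentSpace 𝓘(ℝ, E) v.proj →L[ℝ] ℝ}

/-- Admissibility and compatibility are exactly the two hypotheses of the linear lemma, with the
Poincaré-Cartan form as `B`; hence the choice in the definition is never the default. -/
theorem nonholonomicField_spec (hL : ContMDiff 𝓘(ℝ, E).tangent 𝓘(ℝ, ℝ) ∞ L)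
    (hLreg : IsRegularLagrangian L) (hreg : IsRegularSystem L D)
    {v : TangentBundle 𝓘(ℝ, E) Q} (hv : v ∈ distSet D) :
    nonholonomicField L D v ∈ distTangent D v ∧
      (poincareCartan L v (nonholonomicField L D v) - dFun (energy L) v).toLinearMap ∈
        reactionForms D v := by
  have hex : ∃ X : TangentSpace 𝓘(ℝ, E).tangent v, X ∈ distTangent D v ∧
      (poincareCartan L v X - dFun (energy L) v).toLinearMap ∈ reactionForms D v :=
    exists_mem_sub_mem_of_injective (V := E × E)
      (B := (ContinuousLinearMap.coeLM ℝ).comp (poincareCartanLinear L v))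
      (ContinuousLinearMap.coe_injective.comp (poincareCartanLinear_injective hL hLreg v))
      (T := distTangent D v) (R := reactionForms D v) (hreg.admissible v hv)
      (hreg.compatible v hv) (dFun (energy L) v).toLinearMap
  rw [nonholonomicField, dif_pos hex]
  exact hex.choose_spec

/-- A reaction form `S^* α` factors through the projection to `TQ`, because `S` does; the force is
`-α` composed with the vertical lift. -/
theorem nonholonomicForce_spec (hL : ContMDiff 𝓘(ℝ, E).tangent 𝓘(ℝ, ℝ) ∞ L)
    (hLreg : IsRegularLagrangian L) (hreg : IsRegularSystem L D)
    {v : TangentBundle 𝓘(ℝ, E) Q} (hv : v ∈ distSet D) :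
    poincareCartan L v (nonholonomicField L D v) =
      dFun (energy L) v - (nonholonomicForce L D v).comp (tangentProj v) := by
  have hex : ∃ β : TangentSpace 𝓘(ℝ, E) v.proj →L[ℝ] ℝ,
      poincareCartan L v (nonholonomicField L D v) =
        dFun (energy L) v - β.comp (tangentProj v) := by
    obtain ⟨α, -, hα⟩ := (nonholonomicField_spec hL hLreg hreg hv).2
    have hβ : ∃ β : E →L[ℝ] ℝ, ∀ w, β w = -α (verticalLift v w) :=
      ⟨LinearMap.toContinuousLinearMap
        (-((show E × E →ₗ[ℝ] ℝ from α).comp (show E →L[ℝ] E × E from verticalLift v).toLinearMap)),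
        fun w => rfl⟩
    obtain ⟨β, hβ⟩ := hβ
    refine ⟨β, ContinuousLinearMap.ext fun X => ?_⟩
    have h1 : α (verticalLift v (tangentProj v X)) =
        poincareCartan L v (nonholonomicField L D v) X - dFun (energy L) v X :=
      DFunLike.congr_fun hα X
    have h2 : β (tangentProj v X) = -α (verticalLift v (tangentProj v X)) := hβ _
    have h3 : poincareCartan L v (nonholonomicField L D v) X =
        dFun (energy L) v X - β (tangentProj v X) := by rw [h2, h1]; ring
    exact h3
  rw [nonholonomicForce, dif_pos hex]
  exact hex.choose_spec

theorem forcedField_eq_nonholonomicField (hL : ContMDiff 𝓘(ℝ, E).tangent 𝓘(ℝ, ℝ) ∞ L)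
    (hLreg : IsRegularLagrangian L) (hreg : IsRegularSystem L D)
    (hFext : ∀ v ∈ distSet D, F v = nonholonomicForce L D v)
    {v : TangentBundle 𝓘(ℝ, E) Q} (hv : v ∈ distSet D) :
    forcedField L F v = nonholonomicField L D v := by
  have hex : ∃ X : TangentSpace 𝓘(ℝ, E).tangent v,
      poincareCartan L v X = dFun (energy L) v - (F v).comp (tangentProj v) :=
    ⟨nonholonomicField L D v, by
      rw [hFext v hv]; exact nonholonomicForce_spec hL hLreg hreg hv⟩
  rw [forcedField, dif_pos hex]
  refine forced_equation_unique hL hLreg (hex.choose_spec.trans ?_)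
  rw [hFext v hv]
  exact (nonholonomicForce_spec hL hLreg hreg hv).symm

variable [T2Space Q]

/-- The fields agree on `D` and trajectories of the nonholonomic one stay in `D` by definition, so
they are integral curves of the forced field; uniqueness concludes. -/
theorem flow_nonholonomicField (hL : ContMDiff 𝓘(ℝ, E).tangent 𝓘(ℝ, ℝ) ∞ L)
    (hLreg : IsRegularLagrangian L) (hreg : IsRegularSystem L D) (hF : IsSmoothForce F)
    (hFext : ∀ v ∈ distSet D, F v = nonholonomicForce L D v) {t : ℝ}
    {v : TangentBundle 𝓘(ℝ, E) Q}
    (hv : ∃ γ, IsTrajectory (nonholonomicField L D) (distSet D) t v γ) :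
    flow (nonholonomicField L D) (distSet D) t v = flow (forcedField L F) univ t v := by
  rw [flow, dif_pos hv]
  obtain ⟨a, b, h0, ht, hγ0, hγD, hγ⟩ := hv.choose_spec
  have h1 := flow_eq_of_isMIntegralCurveOn (contMDiff_forcedField hL hLreg hF) h0 ht
    (γ := hv.choose) fun s hs => by
      rw [forcedField_eq_nonholonomicField hL hLreg hreg hFext (hγD s hs)]
      exact hγ s hs
  rw [hγ0] at h1
  exact h1.symm

/-- A nonholonomic preimage of `p` lies in `W` and is also a preimage under the forced exponential
map, where preimages in `W` are unique. -/
theorem retract_eq_of_mem_exactConstraint (hL : ContMDiff 𝓘(ℝ, E).tangent 𝓘(ℝ, ℝ) ∞ L)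
    (hLreg : IsRegularLagrangian L) (hreg : IsRegularSystem L D) (hF : IsSmoothForce F)
    (hFext : ∀ v ∈ distSet D, F v = nonholonomicForce L D v) {h : ℝ} (hh : 0 < h)
    {W : Set (TangentBundle 𝓘(ℝ, E) Q)} (hinj : InjOn (expMap (forcedField L F) univ h) W)
    {p : Q × Q} (hp : p ∈ exactConstraint L D h W) :
    p ∈ expMap (forcedField L F) univ h '' W ∧
      nhRetractMinus L D h W p = retractMinus (forcedField L F) univ h W p ∧
      nhRetractPlus L D h W p = retractPlus (forcedField L F) univ h W p := by
  have hmem : nhRetractMinus L D h W p ∈ nhDomain L D h W := retractMinus_mem hp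
  have hflow := flow_nonholonomicField hL hLreg hreg hF hFext (hmem.2 h ⟨hh.le, le_rfl⟩)
  have hexp : expMap (forcedField L F) univ h (nhRetractMinus L D h W p) = p :=
    (congrArg (fun u : TangentBundle 𝓘(ℝ, E) Q => ((nhRetractMinus L D h W p).proj, u.proj))
      hflow.symm).trans (expMap_retractMinus hp)
  have hminus : nhRetractMinus L D h W p = retractMinus (forcedField L F) univ h W p := by
    have := retractMinus_expMap hinj hmem.1
    rw [hexp] at this
    exact this.symm
  refine ⟨⟨_, hmem.1, hexp⟩, hminus, hflow.trans ?_⟩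
  rw [hminus]
  rfl

end Nonholonomic

/-! ### Discrete variational principle and summation by parts. -/

section DiscretePrinciple

variable {E : Type*} [NormedAddCommGroup E] [NormedSpace ℝ E]
  {Q : Type*} [TopologicalSpace Q] [ChartedSpace E Q]

/-- Discrete integration by parts: `b 0 = b N = 0` permits the index shift, and `a 0 = b 0 = 0`
removes the left end point. -/
theorem sum_range_add_shift_eq_sum_Ioo {N : ℕ} {a b : ℕ → ℝ} (ha : a 0 = 0) (hb : b 0 = 0)
    (hbN : b N = 0) :
    ∑ k ∈ Finset.range N, (a k + b (k + 1)) = ∑ k ∈ Finset.Ioo 0 N, (b k + a k) := by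
  have h1 : ∑ k ∈ Finset.range N, b (k + 1) = ∑ k ∈ Finset.range N, b k := by
    have h2 := Finset.sum_range_succ' b N
    rw [Finset.sum_range_succ, hb, hbN] at h2
    linarith
  rw [Finset.sum_add_distrib, h1, ← Finset.sum_add_distrib]
  symm
  rw [Finset.sum_congr rfl fun k _ => add_comm (b k) (a k)]
  refine Finset.sum_subset (fun k hk => Finset.mem_range.2 (Finset.mem_Ioo.1 hk).2)
    fun k hk hk' => ?_
  have : k = 0 := by
    rw [Finset.mem_range] at hk
    rw [Finset.mem_Ioo] at hk'
    omega
  rw [this, ha, hb, add_zero]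

variable {D : (q : Q) → Submodule ℝ (TangentSpace 𝓘(ℝ, E) q)} {M : Set (Q × Q)} {Ld : Q × Q → ℝ}
  {Fp : (p : Q × Q) → TangentSpace 𝓘(ℝ, E) p.2 → ℝ}
  {Fm : (p : Q × Q) → TangentSpace 𝓘(ℝ, E) p.1 → ℝ} {N : ℕ} {q : ℕ → Q}

theorem partialOne_zero (p : Q × Q) : partialOne (E := E) Ld p (0 : E) = 0 :=
  map_zero (show E × E →L[ℝ] ℝ from mfderiv (𝓘(ℝ, E).prod 𝓘(ℝ, E)) 𝓘(ℝ, ℝ) Ld p)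

theorem partialTwo_zero (p : Q × Q) : partialTwo (E := E) Ld p (0 : E) = 0 :=
  map_zero (show E × E →L[ℝ] ℝ from mfderiv (𝓘(ℝ, E).prod 𝓘(ℝ, E)) 𝓘(ℝ, ℝ) Ld p)

theorem IsVariation.hasDerivAt_discreteAction {δ : (k : ℕ) → TangentSpace 𝓘(ℝ, E) (q k)}
    {c : ℕ → ℝ → Q} (hc : IsVariation N q δ c)
    (hd : ∀ k < N, MDifferentiableAt (𝓘(ℝ, E).prod 𝓘(ℝ, E)) 𝓘(ℝ, ℝ) Ld (q k, q (k + 1))) :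
    HasDerivAt (fun s => discreteAction Ld N (fun k => c k s))
      (∑ k ∈ Finset.Ioo 0 N, (partialTwo Ld (q (k - 1), q k) (δ k) +
        partialOne Ld (q k, q (k + 1)) (δ k))) 0 := by
  have hcd : ∀ k ≤ N, HasMFDerivAt 𝓘(ℝ, ℝ) 𝓘(ℝ, E) (c k) 0
      (ContinuousLinearMap.toSpanSingleton ℝ (show E from δ k)) := fun k hk => by
    have h1 := ((hc.smooth k hk).mdifferentiableAt (by simp)).hasMFDerivAt
    have h2 : (mfderiv 𝓘(ℝ, ℝ) 𝓘(ℝ, E) (c k) 0 : ℝ →L[ℝ] E) =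
        ContinuousLinearMap.toSpanSingleton ℝ (show E from δ k) :=
      ContinuousLinearMap.ext_ring ((hc.velocity k hk).trans (one_smul ℝ (show E from δ k)).symm)
    exact (congrArg (fun A : ℝ →L[ℝ] E => HasMFDerivAt 𝓘(ℝ, ℝ) 𝓘(ℝ, E) (c k) 0 A) h2).mp h1
  -- The vanishing of `δ` at the end points is not a field of `IsVariation`; it follows because the
  -- end curves are constant.
  have hfix : ∀ k ≤ N, (∀ s, c k s = q k) → δ k = (0 : E) := fun k hk hk' => by
    have h1 : c k = fun _ => q k := funext hk'
    have h2 := hc.velocity k hk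
    rw [h1, mfderiv_const] at h2
    exact h2.symm
  have h0 : δ 0 = (0 : E) := hfix 0 (Nat.zero_le N) hc.fixed_left
  have hN : δ N = (0 : E) := hfix N le_rfl hc.fixed_right
  have hterm : ∀ k ∈ Finset.range N, HasDerivAt (fun s => Ld (c k s, c (k + 1) s))
      (partialOne Ld (q k, q (k + 1)) (δ k) +
        partialTwo Ld (q (k + 1 - 1), q (k + 1)) (δ (k + 1))) 0 := fun k hk => by
    have hk := Finset.mem_range.1 hk
    have h1 : HasMFDerivAt 𝓘(ℝ, ℝ) (𝓘(ℝ, E).prod 𝓘(ℝ, E)) (fun s => (c k s, c (k + 1) s)) 0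
        ((ContinuousLinearMap.toSpanSingleton ℝ (show E from δ k)).prod
          (ContinuousLinearMap.toSpanSingleton ℝ (show E from δ (k + 1)))) :=
      (hcd k hk.le).prodMk (hcd (k + 1) hk)
    have h2 : MDifferentiableAt (𝓘(ℝ, E).prod 𝓘(ℝ, E)) 𝓘(ℝ, ℝ) Ld (c k 0, c (k + 1) 0) := by
      rw [hc.base k hk.le, hc.base (k + 1) hk]
      exact hd k hk
    set A : E × E →L[ℝ] ℝ := mfderiv (𝓘(ℝ, E).prod 𝓘(ℝ, E)) 𝓘(ℝ, ℝ) Ld (c k 0, c (k + 1) 0)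
      with hA
    have h3 : HasFDerivAt (fun s => Ld (c k s, c (k + 1) s))
        (A.comp ((ContinuousLinearMap.toSpanSingleton ℝ (show E from δ k)).prod
          (ContinuousLinearMap.toSpanSingleton ℝ (show E from δ (k + 1))))) 0 :=
      hasMFDerivAt_iff_hasFDerivAt.1 (h2.hasMFDerivAt.comp 0 h1)
    refine h3.hasDerivAt.congr_deriv ?_
    have key : ∀ (A : E × E →L[ℝ] ℝ) (X Y : E), A ((1 : ℝ) • X, (1 : ℝ) • Y) =
        A (X, 0) + A (0, Y) := fun A X Y => by
      rw [← map_add, one_smul, one_smul, Prod.mk_add_mk, add_zero, zero_add]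
    have h4 : (c k 0, c (k + 1) 0) = (q k, q (k + 1)) := by
      rw [hc.base k hk.le, hc.base (k + 1) hk]
    refine (key A (δ k) (δ (k + 1))).trans ?_
    rw [hA, h4]
    rfl
  have hsum := HasDerivAt.fun_sum hterm
  refine hsum.congr_deriv (sum_range_add_shift_eq_sum_Ioo
    (a := fun k => partialOne Ld (q k, q (k + 1)) (δ k))
    (b := fun k => partialTwo Ld (q (k - 1), q k) (δ k)) ?_ ?_ ?_)
  · exact (congrArg (partialOne (E := E) Ld (q 0, q (0 + 1))) h0).trans (partialOne_zero _)
  · exact (congrArg (partialTwo (E := E) Ld (q (0 - 1), q 0)) h0).trans (partialTwo_zero _)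
  · exact (congrArg (partialTwo (E := E) Ld (q (N - 1), q N)) hN).trans (partialTwo_zero _)

/-- A straight line in the preferred chart at `x`, whose derivative at `x` is the identity. -/
theorem exists_contMDiffAt_curve [IsManifold 𝓘(ℝ, E) ∞ Q] (x : Q) (w : E) :
    ∃ c : ℝ → Q, c 0 = x ∧ ContMDiffAt 𝓘(ℝ, ℝ) 𝓘(ℝ, E) ∞ c 0 ∧
      (mfderiv 𝓘(ℝ, ℝ) 𝓘(ℝ, E) c 0 (1 : ℝ) : E) = w := by
  set z := extChartAt 𝓘(ℝ, E) x x
  set l : ℝ → E := fun s => z + s • w with hl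
  have hl0 : l 0 = z := by simp [hl]
  have hz : l 0 ∈ (extChartAt 𝓘(ℝ, E) x).target := hl0 ▸ mem_extChartAt_target x
  have hld : HasFDerivAt l (ContinuousLinearMap.toSpanSingleton ℝ w) 0 := by
    have : HasDerivAt l w 0 := by
      simpa [hl] using ((hasDerivAt_id (0 : ℝ)).smul_const w).const_add z
    exact this.hasFDerivAt
  have hls : ContDiffAt ℝ ∞ l 0 := contDiffAt_const.add (contDiffAt_id.smul contDiffAt_const)
  refine ⟨fun s => (extChartAt 𝓘(ℝ, E) x).symm (l s), ?_,
    (contMDiffAt_extChartAt_symm hz).comp 0 hls.contMDiffAt, ?_⟩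
  · simp only [hl0]
    exact extChartAt_to_inv x
  · have h1 := (hasMFDerivAt_extChartAt_symm hz).comp 0 hld.hasMFDerivAt
    refine (DFunLike.congr_fun h1.mfderiv (1 : ℝ)).trans ?_
    change chartDeriv 𝓘(ℝ, E) x (l 0) ((1 : ℝ) • w) = w
    rw [hl0, chartDeriv_self, one_smul]
    rfl

theorem modifiedLdAPrinciple_iff_equations [IsManifold 𝓘(ℝ, E) ∞ Q]
    (hd : ∀ p ∈ M, MDifferentiableAt (𝓘(ℝ, E).prod 𝓘(ℝ, E)) 𝓘(ℝ, ℝ) Ld p)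
    (hFp : ∀ p, Fp p (0 : E) = 0) (hFm : ∀ p, Fm p (0 : E) = 0) :
    ModifiedLdAPrinciple D M Ld Fp Fm N q ↔ ModifiedLdAEquations D M Ld Fp Fm N q := by
  refine and_congr_left fun hM => ⟨fun hvar j hj hjN w hw => ?_, fun heq δ c hc hδ => ?_⟩
  · obtain ⟨c₀, hc0, hcs, hcv⟩ := exists_contMDiffAt_curve (E := E) (q j) w
    -- Only the `j`-th point moves, so one term of the sum survives; `0 < j < N` keeps the end
    -- points fixed.
    set δ : (k : ℕ) → TangentSpace 𝓘(ℝ, E) (q k) := fun k => if k = j then (w : E) else (0 : E)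
    set c : ℕ → ℝ → Q := fun k => if k = j then c₀ else fun _ => q k
    have hδj : δ j = w := if_pos rfl
    have hδk : ∀ k, k ≠ j → δ k = (0 : E) := fun k hk => if_neg hk
    have hcj : c j = c₀ := if_pos rfl
    have hck : ∀ k, k ≠ j → c k = fun _ => q k := fun k hk => if_neg hk
    have hvc : IsVariation N q δ c := by
      refine ⟨fun k _ => ?_, fun k _ => ?_, fun k _ => ?_, fun s => ?_, fun s => ?_⟩
      · rcases eq_or_ne k j with rfl | hk
        · rw [hcj, hc0]
        · rw [hck k hk]
      · rcases eq_or_ne k j with rfl | hk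
        · rw [hcj]; exact hcs
        · rw [hck k hk]; exact contMDiffAt_const
      · rcases eq_or_ne k j with rfl | hk
        · rw [hcj, hδj]; exact hcv
        · rw [hck k hk, hδk k hk, mfderiv_const]; rfl
      · rw [hck 0 hj.ne]
      · rw [hck N hjN.ne']
    obtain ⟨dS, hdS, hzero⟩ := hvar δ c hvc fun k _ => by
      rcases eq_or_ne k j with rfl | hk
      · rw [hδj]; exact hw
      · rw [hδk k hk]; exact (D (q k)).zero_mem
    have hdS' := hvc.hasDerivAt_discreteAction fun k hk => hd _ (hM k hk)
    rw [hdS.unique hdS', ← Finset.sum_add_distrib,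
      Finset.sum_eq_single_of_mem j (Finset.mem_Ioo.2 ⟨hj, hjN⟩), hδj] at hzero
    · rw [← hzero]; ring
    · intro k _ hk
      rw [hδk k hk, partialOne_zero, partialTwo_zero, hFp, hFm]
      norm_num
  · refine ⟨_, hc.hasDerivAt_discreteAction fun k hk => hd _ (hM k hk), ?_⟩
    rw [← Finset.sum_add_distrib]
    refine Finset.sum_eq_zero fun k hk => ?_
    have hk := Finset.mem_Ioo.1 hk
    rw [← heq k hk.1 hk.2 (δ k) (hδ k hk.2.le)]
    ring

end DiscretePrinciple

end NonholonomicMechanics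

end

theorem mainTheorem4
    {E : Type*} [NormedAddCommGroup E] [NormedSpace ℝ E] [FiniteDimensional ℝ E]
    {Q : Type*} [TopologicalSpace Q] [T2Space Q] [ChartedSpace E Q] [IsManifold 𝓘(ℝ, E) ∞ Q]
    (L : TangentBundle 𝓘(ℝ, E) Q → ℝ)
    (hL : ContMDiff 𝓘(ℝ, E).tangent 𝓘(ℝ, ℝ) ∞ L)
    (hLreg : NonholonomicMechanics.IsRegularLagrangian L)
    (k : ℕ) (D : (q : Q) → Submodule ℝ (TangentSpace 𝓘(ℝ, E) q))
    (hD : NonholonomicMechanics.IsSmoothDistribution k D)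
    (hreg : NonholonomicMechanics.IsRegularSystem L D)
    (F : (v : TangentBundle 𝓘(ℝ, E) Q) → TangentSpace 𝓘(ℝ, E) v.proj →L[ℝ] ℝ)
    (hF : NonholonomicMechanics.IsSmoothForce F)
    (hFext : ∀ v ∈ NonholonomicMechanics.distSet D,
      F v = NonholonomicMechanics.nonholonomicForce L D v)
    (h : ℝ) (hh : 0 < h) (W : Set (TangentBundle 𝓘(ℝ, E) Q))
    (hW : NonholonomicMechanics.IsRetractionDomain
      (NonholonomicMechanics.forcedField L F) h W)
    (N : ℕ) (q : ℕ → Q) :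
    (NonholonomicMechanics.ModifiedLdAPrinciple D
        (NonholonomicMechanics.exactConstraint L D h W)
        (NonholonomicMechanics.exactLagrangian L F h W)
        (NonholonomicMechanics.exactForcePlus L F h W)
        (NonholonomicMechanics.exactForceMinus L F h W) N q ↔
      NonholonomicMechanics.ModifiedLdAEquations D
        (NonholonomicMechanics.exactConstraint L D h W)
        (NonholonomicMechanics.exactLagrangian L F h W)
        (NonholonomicMechanics.exactForcePlus L F h W)
        (NonholonomicMechanics.exactForceMinus L F h W) N q) ∧
    (NonholonomicMechanics.ModifiedLdAEquations D
        (NonholonomicMechanics.exactConstraint L D h W)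
        (NonholonomicMechanics.exactLagrangian L F h W)
        (NonholonomicMechanics.exactForcePlus L F h W)
        (NonholonomicMechanics.exactForceMinus L F h W) N q ↔
      NonholonomicMechanics.MomentumMatching L D h W N q) := by
  have hret := fun p (hp : p ∈ NonholonomicMechanics.exactConstraint L D h W) =>
    NonholonomicMechanics.retract_eq_of_mem_exactConstraint hL hLreg hreg hF hFext hh hW.injOn hp
  have hvar := fun p (hp : p ∈ NonholonomicMechanics.exactConstraint L D h W) =>
    NonholonomicMechanics.exactLagrangian_first_variation hL hLreg hF hh hW (hret p hp).1
  have hzero := NonholonomicMechanics.exactDoubleForce_zero L F h W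
  refine ⟨NonholonomicMechanics.modifiedLdAPrinciple_iff_equations
    (fun p hp => (hvar p hp).1) hzero hzero, and_congr_left fun hM => ?_⟩
  refine forall_congr' fun j => forall_congr' fun hj => forall_congr' fun hjN =>
    forall₂_congr fun w hw => ?_
  have hp := hM (j - 1) (by omega)
  rw [Nat.sub_add_cancel hj] at hp
  have hp' := hM j hjN
  -- The momentum identity splits into its two halves: freezing the first point leaves the final
  -- momentum on `(q (j - 1), q j)`, freezing the second leaves minus the initial momentum on `(q j,
  -- q (j + 1))`. Their sum is the momentum mismatch at `q j`.
  have h1 := (hvar _ hp).2 0 w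
  have h2 := (hvar _ hp').2 w 0
  rw [NonholonomicMechanics.legendreNh_zero hL, sub_zero, ← (hret _ hp).2.2] at h1
  rw [NonholonomicMechanics.legendreNh_zero hL, zero_sub, ← (hret _ hp').2.1] at h2
  rw [← h1, ← neg_eq_iff_eq_neg.2 h2, sub_neg_eq_add]
  refine Eq.congr_left ?_
  exact (add_assoc _ _ _).trans (add_add_add_comm _ _ _ _)
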